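/- Let $d\ge 0$ be a constant and $P:\{0,1\}^d\to\{0,1\}$ any predicate. A hypergraph $G$ with $n$ vertices and $m$ ordered hyperedges is a tuple $(S_1,\dots,S_m)$ with $S_i=(j_{i,1},\dots,j_{i,d})\in[n]^d$ (repeated vertices allowed); let $\mathcal G_{n,m,d}$ be the set of all of them. For $s\in\{0,1\}^n$ put $f_{G,P}(s)_i=P(s_{j_{i,1}},\dots,s_{j_{i,d}})$. For a noise rate $\delta\in[0,1]$ let $\eta_\delta=\Pr[P(x)\oplus e=1]$ for uniform $x\in\{0,1\}^d$ and an independent $e\leftarrow\mathrm{Bern}(\delta)$. The noisy decision problem with $n$ inputs and $m$ outputs: an algorithm $D$ has advantage at least $\varepsilon$ if $$\Pr[D(1^n,G,f_{G,P}(s)\oplus e)=1]-\Pr[D(1^n,G,b)=1]\ge\varepsilon,$$ where $G\leftarrow\mathcal G_{n,m,d}$ and $s\leftarrow\{0,1\}^n$ are uniform, $e\leftarrow\mathrm{Bern}(\delta)^m$, $b\leftarrow\mathrm{Bern}(\eta_\delta)^m$, all independent. The noisy search problem with $n$ inputs and $M$ outputs: given $G\leftarrow\mathcal G_{n,M,d}$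 and $f_{G,P}(s)\oplus e$ with $s\leftarrow\{0,1\}^n$ uniform and $e\leftarrow\mathrm{Bern}(\delta)^M$, output $s$. Theorem. For every constant $d$, every predicate $P:\{0,1\}^d\to\{0,1\}$ and every $K\in\mathbb N$ there are constants $c,C>0$ such that the following holds. For every probabilistic polynomial-time algorithm $D$ for the decision problem there is a probabilistic polynomial-time algorithm $A$ for the search problem such that for all $n\ge1$, all $m\le K n^K$, all $\varepsilon>0$ and all $\delta\in[0,1]$: if $D$ has advantage at least $\varepsilon$ in the noisy decision problem with $n$ inputs, $m$ outputs and noise rate $\delta$, then $A$, given the parameters $1^n,1^m,1^{\lceil 1/\varepsilon\rceil}$ and an instance of the noisy search problem with $n$ inputs, noise rate $\delta$ and $$M=\big\lfloor C\,m\,(n/\varepsilon)^2\,\log^3(n/\varepsilon)\big\rfloor$$ outputs, outputs $s$ with probability at least $c\,\varepsilon$. (For $P$ the parity of $d$ bits this is the sparse LPN / noisy XOR problem; for $\delta=0$ it is the noiseless problem.) -/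

import Mathlib

open scoped BigOperators

namespace RandomLocal

/-! ### Machine model

Imperative programs over finitely many registers, each holding a binary tree (a LISP value), with
the constant-time operations `nil`, `cons`, `head`, `tail`, assignment, and a test for `nil`.
This is the classical WHILE language with unit costs. Values can be kept as pointers into a shared
heap, each operation then costs `O(1)` pointer operations, so polynomial time in this model is
polynomial time on Turing machines. -/

/-- Values: binary trees. -/
inductive Data : Type
  | nil : Data
  | cons (a b : Data) : Data

namespace Data

/-- Number of nodes of a tree: the length of an input. -/
def size : Data → ℕ
  | nil => 1
  | cons a b => a.size + b.size + 1

/-- First component (`nil` has first component `nil`). -/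
def head : Data → Data
  | nil => nil
  | cons a _ => a

/-- Second component (`nil` has second component `nil`). -/
def tail : Data → Data
  | nil => nil
  | cons _ b => b

/-- Bits. -/
def ofBool : Bool → Data
  | false => nil
  | true => cons nil nil

/-- Natural numbers, in unary. -/
def ofNat : ℕ → Data
  | 0 => nil
  | k + 1 => cons nil (ofNat k)

/-- Lists. -/
def ofList : List Data → Data
  | [] => nil
  | a :: l => cons a (ofList l)

/-- Bit strings. -/
def ofBits {k : ℕ} (y : Fin k → Bool) : Data :=
  ofList (List.ofFn fun i => ofBool (y i))

end Data

/-- Contents of the registers. -/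
abbrev Store : Type := ℕ → Data

/-- Programs; the registers are numbered by natural numbers. -/
inductive Cmd : Type
  | skip : Cmd
  | setNil (x : ℕ) : Cmd
  | copy (x y : ℕ) : Cmd
  | setCons (x y z : ℕ) : Cmd
  | setHead (x y : ℕ) : Cmd
  | setTail (x y : ℕ) : Cmd
  | seq (p q : Cmd) : Cmd
  | branch (x : ℕ) (p q : Cmd) : Cmd
  | loop (x : ℕ) (p : Cmd) : Cmd

/-- `Exec p σ t τ`: the program `p`, started with the register contents `σ`, halts after exactly
`t` steps with the register contents `τ`. Here `branch x p q` runs `p` if register `x` is not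
`nil` and `q` otherwise, and `loop x p` repeats `p` as long as register `x` is not `nil`. -/
inductive Exec : Cmd → Store → ℕ → Store → Prop
  | skip (σ : Store) : Exec .skip σ 1 σ
  | setNil (σ : Store) (x : ℕ) : Exec (.setNil x) σ 1 (Function.update σ x .nil)
  | copy (σ : Store) (x y : ℕ) : Exec (.copy x y) σ 1 (Function.update σ x (σ y))
  | setCons (σ : Store) (x y z : ℕ) :
      Exec (.setCons x y z) σ 1 (Function.update σ x (.cons (σ y) (σ z)))
  | setHead (σ : Store) (x y : ℕ) :
      Exec (.setHead x y) σ 1 (Function.update σ x (σ y).head)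
  | setTail (σ : Store) (x y : ℕ) :
      Exec (.setTail x y) σ 1 (Function.update σ x (σ y).tail)
  | seq {p q : Cmd} {σ τ ρ : Store} {t u : ℕ} (hp : Exec p σ t τ) (hq : Exec q τ u ρ) :
      Exec (.seq p q) σ (t + u + 1) ρ
  | branchTrue {x : ℕ} {p q : Cmd} {σ τ : Store} {t : ℕ} (hx : σ x ≠ .nil)
      (hp : Exec p σ t τ) : Exec (.branch x p q) σ (t + 1) τ
  | branchFalse {x : ℕ} {p q : Cmd} {σ τ : Store} {t : ℕ} (hx : σ x = .nil)
      (hq : Exec q σ t τ) : Exec (.branch x p q) σ (t + 1) τ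
  | loopDone {x : ℕ} {p : Cmd} {σ : Store} (hx : σ x = .nil) : Exec (.loop x p) σ 1 σ
  | loopStep {x : ℕ} {p : Cmd} {σ τ ρ : Store} {t u : ℕ} (hx : σ x ≠ .nil)
      (hp : Exec p σ t τ) (hl : Exec (.loop x p) τ u ρ) : Exec (.loop x p) σ (t + u + 1) ρ

/-- Programs are deterministic, so a run has at most one result. -/
theorem Exec.deterministic {p : Cmd} {σ τ τ' : Store} {t t' : ℕ} (h : Exec p σ t τ)
    (h' : Exec p σ t' τ') : t = t' ∧ τ = τ' := by
  induction h generalizing t' τ' with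
  | skip | setNil | copy | setCons | setHead | setTail => cases h'; exact ⟨rfl, rfl⟩
  | seq _ _ ih₁ ih₂ =>
    cases h' with
    | seq a b =>
      obtain ⟨rfl, rfl⟩ := ih₁ a
      obtain ⟨rfl, rfl⟩ := ih₂ b
      exact ⟨rfl, rfl⟩
  | branchTrue hx _ ih =>
    cases h' with
    | branchTrue _ a => obtain ⟨rfl, rfl⟩ := ih a; exact ⟨rfl, rfl⟩
    | branchFalse hx' _ => exact absurd hx' hx
  | branchFalse hx _ ih =>
    cases h' with
    | branchTrue hx' _ => exact absurd hx hx'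
    | branchFalse _ a => obtain ⟨rfl, rfl⟩ := ih a; exact ⟨rfl, rfl⟩
  | loopDone hx =>
    cases h' with
    | loopDone _ => exact ⟨rfl, rfl⟩
    | loopStep hx' _ _ => exact absurd hx hx'
  | loopStep hx _ _ ih₁ ih₂ =>
    cases h' with
    | loopDone hx' => exact absurd hx' hx
    | loopStep _ a b =>
      obtain ⟨rfl, rfl⟩ := ih₁ a
      obtain ⟨rfl, rfl⟩ := ih₂ b
      exact ⟨rfl, rfl⟩

/-- Register contents at the start: the input in register 0, the coins in register 1. -/
def initStore (x r : Data) : Store := fun i => if i = 0 then x else if i = 1 then r else .nil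

/-- The polynomials `a k ^ a + a`, which dominate all polynomials. -/
def polyBound (a k : ℕ) : ℕ := a * k ^ a + a

/-- A randomized algorithm: a program, together with the exponent of the polynomial
that gives the number of fair coins that the program is supplied with. -/
structure RandAlg : Type where
  prog : Cmd
  coinExp : ℕ

namespace RandAlg

/-- The number of fair coins supplied on input `x`. -/
def numCoins (A : RandAlg) (x : Data) : ℕ := polyBound A.coinExp x.size

/-- On input `x` and coins `r`, the algorithm halts with `v` in register 0. -/
def Outputs (A : RandAlg) (x : Data) (r : Fin (A.numCoins x) → Bool) (v : Data) : Prop :=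
  ∃ (t : ℕ) (σ : Store), Exec A.prog (initStore x (Data.ofBits r)) t σ ∧ σ 0 = v

open Classical in
/-- The probability, over uniform coins, that the output on input `x` is `v`. -/
noncomputable def outputProb (A : RandAlg) (x v : Data) : ℝ :=
  𝔼 r : Fin (A.numCoins x) → Bool, if A.Outputs x r v then (1 : ℝ) else 0

/-- Probabilistic polynomial time on a set of instances: the number of steps is bounded by a
polynomial in the size of the instance, whatever the coins. -/
def IsPolyTimeOn (A : RandAlg) (I : Set Data) : Prop :=
  ∃ a : ℕ, ∀ x ∈ I, ∀ r : Fin (A.numCoins x) → Bool, ∃ t ≤ polyBound a x.size, ∃ σ : Store,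
    Exec A.prog (initStore x (Data.ofBits r)) t σ

end RandAlg

/-! ### Random local functions -/

/-- Hypergraphs with `n` vertices and `m` ordered hyperedges of `d` vertices each
(vertices of a hyperedge may coincide). -/
abbrev Hypergraph (n m d : ℕ) : Type := Fin m → Fin d → Fin n

/-- The local function `f_{G,P}`. -/
def localFun {n m d : ℕ} (P : (Fin d → Bool) → Bool) (G : Hypergraph n m d) (s : Fin n → Bool) :
    Fin m → Bool :=
  fun i => P fun k => s (G i k)

/-- The local function with noise: the `i`-th output is flipped if `e i` is `true`. -/
def noisyFun {n m d : ℕ} (P : (Fin d → Bool) → Bool) (G : Hypergraph n m d) (s : Fin n → Bool)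
    (e : Fin m → Bool) : Fin m → Bool :=
  fun i => xor (localFun P G s i) (e i)

/-- The probability of `b` under the product distribution `Bern(p)^m`. -/
noncomputable def bernWeight {m : ℕ} (p : ℝ) (b : Fin m → Bool) : ℝ :=
  ∏ i, if b i then p else 1 - p

/-- The bias of the noisy predicate: the probability that `P(x) ⊕ e = 1`
for uniform `x` and `e ← Bern(δ)`. -/
noncomputable def noisyBias {d : ℕ} (P : (Fin d → Bool) → Bool) (δ : ℝ) : ℝ :=
  𝔼 x : Fin d → Bool, if P x then 1 - δ else δ

/-- A hypergraph as a list of lists of vertices. -/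
def encodeGraph {n m d : ℕ} (G : Hypergraph n m d) : Data :=
  Data.ofList (List.ofFn fun i => Data.ofList (List.ofFn fun k => Data.ofNat (G i k : ℕ)))

/-- The instance `(1^n, G, y)` of the decision problem. -/
def decisionInput {n m d : ℕ} (G : Hypergraph n m d) (y : Fin m → Bool) : Data :=
  .cons (.ofNat n) (.cons (encodeGraph G) (.ofBits y))

/-- The instance `(1^n, 1^m, 1^N, G, y)` of the search problem, where `G` has `M` hyperedges; `m`
and `N` are the parameters (number of outputs, inverse advantage) of a decision problem. -/
def searchInput {n M d : ℕ} (m N : ℕ) (G : Hypergraph n M d) (y : Fin M → Bool) : Data :=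
  .cons (.ofNat n) (.cons (.ofNat m) (.cons (.ofNat N) (.cons (encodeGraph G) (.ofBits y))))

/-- All instances of the decision problem with locality `d`. -/
def decisionInstances (d : ℕ) : Set Data :=
  {x | ∃ (n m : ℕ) (G : Hypergraph n m d) (y : Fin m → Bool), x = decisionInput G y}

/-- All instances of the search problem with locality `d`. -/
def searchInstances (d : ℕ) : Set Data :=
  {x | ∃ (n m N M : ℕ) (G : Hypergraph n M d) (y : Fin M → Bool), x = searchInput m N G y}

/-- The advantage of `D` in the decision problem with `n` inputs and `m` outputs:
`Pr[D(G, f_{G,P}(s) ⊕ e) = 1] - Pr[D(G, b) = 1]`, where `G` and `s` are uniform,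
`e ← Bern(δ)^m`, and `b ← Bern(η)^m` for the bias `η` of the noisy predicate. -/
noncomputable def decisionAdvantage {d : ℕ} (P : (Fin d → Bool) → Bool) (δ : ℝ) (D : RandAlg)
    (n m : ℕ) : ℝ :=
  (𝔼 G : Hypergraph n m d, 𝔼 s : Fin n → Bool, ∑ e : Fin m → Bool,
      bernWeight δ e * D.outputProb (decisionInput G (noisyFun P G s e)) (.ofBool true)) -
    𝔼 G : Hypergraph n m d, ∑ b : Fin m → Bool,
      bernWeight (noisyBias P δ) b * D.outputProb (decisionInput G b) (.ofBool true)

/-- The success probability of `A` in the search problem with `n` inputs and `M` outputs: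
`Pr[A(1^n, 1^m, 1^N, G, f_{G,P}(s) ⊕ e) = s]`, where `G` and `s` are uniform
and `e ← Bern(δ)^M`. -/
noncomputable def searchSuccess {d : ℕ} (P : (Fin d → Bool) → Bool) (δ : ℝ) (A : RandAlg)
    (n m N M : ℕ) : ℝ :=
  𝔼 G : Hypergraph n M d, 𝔼 s : Fin n → Bool, ∑ e : Fin M → Bool,
    bernWeight δ e * A.outputProb (searchInput m N G (noisyFun P G s e)) (.ofBits s)

end RandomLocal

/-!
The search algorithm estimates acceptance probabilities of the distinguisher `D` on relabelled
samples. For a family of bit distributions `x v`, one for each vertex `v`, let `acc x` be the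
probability that `D` accepts `m` independent samples, each of which is a uniform hyperedge with the
noisy value of `P` on independent bits drawn from `x v` for the occurrences of its vertices `v`.
If `x v` is the secret bit `s v`, this is the first distribution of the decision problem; if all
bits are fair coins, then the label is independent of the hyperedge and this is the second one.
Hence the advantage is the mean over `s` of `acc s - acc coin` (`decisionAdvantage_eq`), and by a
hybrid argument (`exists_hybrid_gap`) there is a vertex `i` such that, with coins below `i` and
secret bits above `i`, the two choices "secret bit" and "coin" for `i` differ by a fraction `1 / n`
of the difference.

Hybrids can be sampled from samples with the unknown secret. Relabelling the vertices of a
hyperedge changes the vertices but not the bits they carry, so a vertex `w` that receives the label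
`v` makes `v` carry the bit `s w`. If the labels below `i` receive random vertices of a window
`[t, t + 2 h)` on which `s` has as many ones as zeros, then they carry fair coins; if the label `i`
receives a random one of the vertices `a` and `b`, then it carries a coin when `s a ≠ s b`, and a
constant bit otherwise. Vertices are dropped with suitable probabilities so that the remaining
labels are uniform (`E_relabel`, `E_relabelSample`); a vertex survives with probability
`h / (2 n)`. So the differences between the acceptance frequencies for the pairs `(0, 0)`, `(0, a)`
and `(a, a)` tell whether `s 0 = s a`, which determines `s` up to a guess for `s 0`. All windows and
all `i` are tried: a significant difference can only occur if `s 0 ≠ s a`, whether or not the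
window is balanced (`different_eq_false`), and a good window and a good `i` show one
(`different_eq_true`). Accuracy of all frequencies follows from the Chernoff bound, applied to
disjoint groups of samples (`E_count_far_le`, `quarter_le_E_search`).

With a window of length about `n / k`, only a fraction of order `k ^ (-d)` of the samples is kept,
so that shorter windows are useful only for secrets with a larger gap `acc s - acc coin`. A string
without a balanced window of length `2 ⌊n / (2 k)⌋` has `k` disjoint blocks that are unbalanced in
the same direction, since the imbalance changes in small steps as the window moves; flipping
arbitrary sets of blocks shows that at most a fraction `2 / 2 ^ k` of all strings is of this kind
(`expect_unbalanced_le`). As `∑ k ^ d / 2 ^ k` converges, secrets whose gap is too small for their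
windows contribute at most half of the advantage (`half_le_expect_findable`), and the other ones are
found with probability at least `1 / 4`. Constant strings have no balanced window, but for them it
suffices that no significant difference shows up.

Polynomial running time is obtained from a small calculus of functions that are computed in
polynomial time by programs (`PT`), which includes calls of `D` (`PT.run`).
-/

namespace RandomLocal
open Polynomial

/-! ### Running times -/

/-- The program `c` leads from `σ` to `τ` in at most `T` steps. -/
def Runs (c : Cmd) (σ : Store) (T : ℕ) (τ : Store) : Prop := ∃ t ≤ T, Exec c σ t τ

theorem Runs.seq {p q : Cmd} {σ τ ρ : Store} {T U : ℕ} (hp : Runs p σ T τ) (hq : Runs q τ U ρ) :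
    Runs (.seq p q) σ (T + U + 1) ρ := by
  obtain ⟨t, ht, ep⟩ := hp
  obtain ⟨u, hu, eq⟩ := hq
  exact ⟨t + u + 1, by omega, .seq ep eq⟩

theorem Runs.mono {p : Cmd} {σ τ : Store} {T U : ℕ} (hp : Runs p σ T τ) (h : T ≤ U) :
    Runs p σ U τ := by
  obtain ⟨t, ht, ep⟩ := hp
  exact ⟨t, ht.trans h, ep⟩

theorem Exec.runs {p : Cmd} {σ τ : Store} {t : ℕ} (h : Exec p σ t τ) : Runs p σ t τ :=
  ⟨t, le_rfl, h⟩

theorem Runs.branchTrue {x : ℕ} {p q : Cmd} {σ τ : Store} {T : ℕ} (hx : σ x ≠ .nil)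
    (hp : Runs p σ T τ) : Runs (.branch x p q) σ (T + 1) τ := by
  obtain ⟨t, ht, ep⟩ := hp
  exact ⟨t + 1, by omega, .branchTrue hx ep⟩

theorem Runs.branchFalse {x : ℕ} {p q : Cmd} {σ τ : Store} {T : ℕ} (hx : σ x = .nil)
    (hp : Runs q σ T τ) : Runs (.branch x p q) σ (T + 1) τ := by
  obtain ⟨t, ht, ep⟩ := hp
  exact ⟨t + 1, by omega, .branchFalse hx ep⟩

theorem Runs.loopStep {x : ℕ} {p : Cmd} {σ τ ρ : Store} {T U : ℕ} (hx : σ x ≠ .nil)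
    (hp : Runs p σ T τ) (hq : Runs (.loop x p) τ U ρ) : Runs (.loop x p) σ (T + U + 1) ρ := by
  obtain ⟨t, ht, ep⟩ := hp
  obtain ⟨u, hu, eq⟩ := hq
  exact ⟨t + u + 1, by omega, .loopStep hx ep eq⟩

theorem eval_mono (P : ℕ[X]) {x y : ℕ} (h : x ≤ y) : P.eval x ≤ P.eval y := by
  rw [eval_eq_sum, eval_eq_sum]
  exact Finset.sum_le_sum fun i _ => Nat.mul_le_mul_left _ (Nat.pow_le_pow_left h i)

theorem polyBound_add_le (a b k : ℕ) : polyBound a k + polyBound b k ≤ polyBound (a + b) k := by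
  unfold polyBound
  rcases Nat.eq_zero_or_pos k with rfl | hk
  · rcases Nat.eq_zero_or_pos a with rfl | ha
    · simp
    · simp [ha.ne']
      rcases Nat.eq_zero_or_pos b with rfl | hb
      · simp
      · simp [hb.ne']
  · have h1 : k ^ a ≤ k ^ (a + b) := Nat.pow_le_pow_right hk (by omega)
    have h2 : k ^ b ≤ k ^ (a + b) := Nat.pow_le_pow_right hk (by omega)
    nlinarith [Nat.mul_le_mul_left a h1, Nat.mul_le_mul_left b h2]

theorem exists_eval_le_polyBound (P : ℕ[X]) : ∃ a, ∀ k, P.eval k ≤ polyBound a k := by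
  induction P using Polynomial.induction_on' with
  | add p q hp hq =>
    obtain ⟨a, ha⟩ := hp
    obtain ⟨b, hb⟩ := hq
    exact ⟨a + b, fun k => by
      rw [eval_add]; exact (add_le_add (ha k) (hb k)).trans (polyBound_add_le a b k)⟩
  | monomial n c =>
    refine ⟨n + c, fun k => ?_⟩
    rw [eval_monomial]
    unfold polyBound
    rcases Nat.eq_zero_or_pos k with rfl | hk
    · rcases Nat.eq_zero_or_pos n with rfl | hn
      · simp
      · simp [hn.ne']
    · have h1 : k ^ n ≤ k ^ (n + c) := Nat.pow_le_pow_right hk (by omega)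
      nlinarith [Nat.mul_le_mul_left c h1, Nat.zero_le (n * k ^ (n + c))]

/-- The polynomial whose values are `polyBound a`. -/
noncomputable def polyBoundPoly (a : ℕ) : ℕ[X] := C a * X ^ a + C a

theorem eval_polyBoundPoly (a k : ℕ) : (polyBoundPoly a).eval k = polyBound a k := by
  simp [polyBoundPoly, polyBound]

/-! ### Typed values and polynomial-time functions -/

/-- Types whose elements are represented by trees. -/
class Enc (α : Type) where
  /-- The tree that represents a value. -/
  toData : α → Data

/-- The tree that represents a value. -/
def enc {α : Type} [Enc α] (x : α) : Data := Enc.toData x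

instance : Enc Unit := ⟨fun _ => .nil⟩
instance : Enc Bool := ⟨Data.ofBool⟩
instance : Enc ℕ := ⟨Data.ofNat⟩
instance {α β : Type} [Enc α] [Enc β] : Enc (α × β) := ⟨fun p => .cons (enc p.1) (enc p.2)⟩
instance {α : Type} [Enc α] : Enc (List α) := ⟨fun l => .ofList (l.map enc)⟩

/-- The size of the tree that represents a value. -/
def sz {α : Type} [Enc α] (x : α) : ℕ := (enc x).size

section
variable {α β γ δ : Type} [Enc α] [Enc β] [Enc γ] [Enc δ]

theorem sz_pair (x : α) (y : β) : sz (x, y) = sz x + sz y + 1 := rfl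

theorem sz_nil : sz ([] : List α) = 1 := rfl

theorem sz_cons (x : α) (l : List α) : sz (x :: l) = sz x + sz l + 1 := rfl

theorem sz_nat (k : ℕ) : sz k = 2 * k + 1 := by
  induction k with
  | zero => rfl
  | succ k ih =>
    have : sz (k + 1) = 1 + sz k + 1 := rfl
    omega

theorem sz_bool_le (b : Bool) : sz b ≤ 3 := by
  cases b <;> simp [sz, enc, Enc.toData, Data.ofBool, Data.size]

theorem length_le_sz (l : List α) : l.length ≤ sz l := by
  induction l with
  | nil => simp
  | cons a l ih => rw [sz_cons, List.length_cons]; omega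

theorem sz_mem_le {a : α} {l : List α} (h : a ∈ l) : sz a ≤ sz l := by
  induction l with
  | nil => simp at h
  | cons b l ih =>
    rw [sz_cons]
    rcases List.mem_cons.1 h with rfl | h
    · omega
    · have := ih h; omega

theorem sz_sublist {l l' : List α} (h : l.Sublist l') : sz l ≤ sz l' := by
  induction h with
  | slnil => exact le_rfl
  | cons a _ ih => rw [sz_cons]; omega
  | cons_cons a _ ih => rw [sz_cons, sz_cons]; omega

theorem sz_le_of_forall_le {l : List α} {B : ℕ} (h : ∀ a ∈ l, sz a ≤ B) :
    sz l ≤ l.length * (B + 1) + 1 := by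
  induction l with
  | nil => simp [sz_nil]
  | cons a l ih =>
    rw [sz_cons, List.length_cons]
    have h1 := h a (by simp)
    have h2 := ih fun b hb => h b (by simp [hb])
    nlinarith

/-- `f` is computed on `S` by a program that reads its input from register 0, returns the value in
register 0, leaves the registers from `k` on unchanged, and works for all contents of the other
registers; the running time and the size of the value are polynomially bounded. -/
def PTOn (S : Set α) (f : α → β) : Prop :=
  ∃ (c : Cmd) (k : ℕ) (P : ℕ[X]), 1 ≤ k ∧ ∀ x ∈ S, sz (f x) ≤ P.eval (sz x) ∧
    ∀ σ : Store, σ 0 = enc x → ∃ τ, Runs c σ (P.eval (sz x)) τ ∧ τ 0 = enc (f x) ∧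
      ∀ j, k ≤ j → τ j = σ j

/-- Functions that are computed everywhere in polynomial time. -/
@[fun_prop]
def PT (f : α → β) : Prop := PTOn Set.univ f

theorem PTOn.mono {S T : Set α} {f : α → β} (h : PTOn T f) (hS : S ⊆ T) : PTOn S f := by
  obtain ⟨c, k, P, hk, h⟩ := h
  exact ⟨c, k, P, hk, fun x hx => h x (hS hx)⟩

theorem PT.on {f : α → β} (h : PT f) (S : Set α) : PTOn S f := PTOn.mono h (Set.subset_univ S)

theorem PTOn.congr {S : Set α} {f g : α → β} (h : PTOn S f) (hfg : ∀ x ∈ S, f x = g x) :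
    PTOn S g := by
  obtain ⟨c, k, P, hk, h⟩ := h
  refine ⟨c, k, P, hk, fun x hx => ?_⟩
  rw [← hfg x hx]
  exact h x hx

theorem PT.of_eq {f g : α → β} (h : PT f) (hfg : ∀ x, f x = g x) : PT g :=
  PTOn.congr h fun x _ => hfg x

/-- Functions that do not change the representation. -/
theorem PT.of_enc_eq {f : α → β} (h : ∀ x, enc (f x) = enc x) : PT f := by
  refine ⟨.skip, 1, X + 1, le_rfl, fun x _ => ?_⟩
  refine ⟨?_, fun σ hσ => ⟨σ, ?_, by rw [hσ, h], fun _ _ => rfl⟩⟩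
  · simp [sz, h]
  · exact (Exec.skip σ).runs.mono (by simp)

@[fun_prop]
theorem PT.id : PT (fun x : α => x) := PT.of_enc_eq fun _ => rfl

theorem PTOn.comp {S : Set α} {T : Set β} {g : β → γ} {f : α → β} (hg : PTOn T g)
    (hf : PTOn S f) (hST : ∀ x ∈ S, f x ∈ T) : PTOn S (fun x => g (f x)) := by
  obtain ⟨c, k, P, hk, h⟩ := hg
  obtain ⟨c', k', P', hk', h'⟩ := hf
  refine ⟨.seq c' c, max k k', P' + P.comp P' + 1, by omega, fun x hx => ?_⟩
  obtain ⟨hs', h'⟩ := h' x hx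
  obtain ⟨hs, h⟩ := h (f x) (hST x hx)
  have hm := eval_mono P hs'
  simp only [eval_add, eval_comp, eval_one]
  refine ⟨by omega, fun σ hσ => ?_⟩
  obtain ⟨τ, r, h0, hj⟩ := h' σ hσ
  obtain ⟨ρ, r', h0', hj'⟩ := h τ h0
  refine ⟨ρ, (r.seq r').mono (by omega), h0', fun j hjk => ?_⟩
  rw [hj' j (by omega), hj j (by omega)]

@[fun_prop]
theorem PT.comp {g : β → γ} {f : α → β} (hg : PT g) (hf : PT f) : PT (fun x => g (f x)) :=
  PTOn.comp hg hf fun _ _ => trivial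

theorem PTOn.prodMk {S : Set α} {f : α → β} {g : α → γ} (hf : PTOn S f) (hg : PTOn S g) :
    PTOn S (fun x => (f x, g x)) := by
  obtain ⟨c, k₁, P, hk₁, h⟩ := hf
  obtain ⟨c', k₂, P', hk₂, h'⟩ := hg
  obtain ⟨k, hk, hk'⟩ : ∃ k, k₁ ≤ k ∧ k₂ ≤ k := ⟨max k₁ k₂, by omega, by omega⟩
  refine ⟨.seq (.copy k 0) (.seq c (.seq (.copy (k + 1) 0) (.seq (.copy 0 k)
    (.seq c' (.setCons 0 (k + 1) 0))))), k + 2, P + P' + 10, by omega, fun x hx => ?_⟩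
  obtain ⟨hs, h⟩ := h x hx
  obtain ⟨hs', h'⟩ := h' x hx
  simp only [eval_add, eval_ofNat]
  refine ⟨by rw [sz_pair]; omega, fun σ hσ => ?_⟩
  have r1 := (Exec.copy σ k 0).runs
  obtain ⟨τ1, r2, e2, f2⟩ := h (Function.update σ k (σ 0)) (by
    rw [Function.update_of_ne (by omega)]; exact hσ)
  have r3 := (Exec.copy τ1 (k + 1) 0).runs
  have r4 := (Exec.copy (Function.update τ1 (k + 1) (τ1 0)) 0 k).runs
  set τ2 := Function.update (Function.update τ1 (k + 1) (τ1 0)) 0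
    (Function.update τ1 (k + 1) (τ1 0) k) with hτ2
  have hk0 : τ2 0 = enc x := by
    rw [hτ2, Function.update_self, Function.update_of_ne (by omega), f2 k hk,
      Function.update_self, hσ]
  obtain ⟨τ3, r5, e5, f5⟩ := h' τ2 hk0
  have r6 := (Exec.setCons τ3 0 (k + 1) 0).runs
  refine ⟨_, (r1.seq (r2.seq (r3.seq (r4.seq (r5.seq r6))))).mono (by omega), ?_, fun j hj => ?_⟩
  · rw [Function.update_self, e5, f5 (k + 1) (by omega), hτ2, Function.update_of_ne (by omega),
      Function.update_self, e2]
    rfl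
  · rw [Function.update_of_ne (by omega), f5 j (by omega), hτ2, Function.update_of_ne (by omega),
      Function.update_of_ne (by omega), f2 j (by omega), Function.update_of_ne (by omega)]

@[fun_prop]
theorem PT.prodMk {f : α → β} {g : α → γ} (hf : PT f) (hg : PT g) :
    PT (fun x => (f x, g x)) := PTOn.prodMk hf hg

/-- One instruction that writes to register 0 computes a function, if sizes do not grow much. -/
theorem PT.of_instruction {f : α → β} (c : Cmd)
    (h : ∀ (x : α) (σ : Store), σ 0 = enc x → Exec c σ 1 (Function.update σ 0 (enc (f x))))
    (hs : ∀ x, sz (f x) ≤ sz x + 10) : PT f := by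
  refine ⟨c, 1, X + 10, le_rfl, fun x _ => ?_⟩
  simp only [eval_add, eval_ofNat, eval_X]
  exact ⟨hs x, fun σ hσ => ⟨_, (h x σ hσ).runs.mono (by omega), Function.update_self .., fun j hj =>
    Function.update_of_ne (by omega) ..⟩⟩

theorem PT.fst' : PT (fun x : α × β => x.1) := by
  refine PT.of_instruction (.setHead 0 0) (fun x σ hσ => ?_) fun x => ?_
  · have := Exec.setHead σ 0 0
    rwa [hσ] at this
  · have : sz x = _ := sz_pair x.1 x.2
    omega

theorem PT.snd' : PT (fun x : α × β => x.2) := by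
  refine PT.of_instruction (.setTail 0 0) (fun x σ hσ => ?_) fun x => ?_
  · have := Exec.setTail σ 0 0
    rwa [hσ] at this
  · have : sz x = _ := sz_pair x.1 x.2
    omega

@[fun_prop]
theorem PT.fst {f : γ → α × β} (hf : PT f) : PT (fun x => (f x).1) := PT.fst'.comp hf

@[fun_prop]
theorem PT.snd {f : γ → α × β} (hf : PT f) : PT (fun x => (f x).2) := PT.snd'.comp hf

/-- Constants; the program depends on the constant. -/
theorem PT.const_data (d : Data) : ∃ (c : Cmd) (k T : ℕ), 1 ≤ k ∧ ∀ σ : Store, ∃ τ,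
    Runs c σ T τ ∧ τ 0 = d ∧ ∀ j, k ≤ j → τ j = σ j := by
  induction d with
  | nil =>
    exact ⟨.setNil 0, 1, 1, le_rfl, fun σ => ⟨_, (Exec.setNil σ 0).runs, Function.update_self ..,
      fun j hj => Function.update_of_ne (by omega) ..⟩⟩
  | cons a b iha ihb =>
    obtain ⟨c, k₁, T, hk₁, h⟩ := iha
    obtain ⟨c', k₂, T', hk₂, h'⟩ := ihb
    obtain ⟨k, hk, hk'⟩ : ∃ k, k₁ ≤ k ∧ k₂ ≤ k := ⟨max k₁ k₂, by omega, by omega⟩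
    refine ⟨.seq c (.seq (.copy k 0) (.seq c' (.setCons 0 k 0))), k + 1,
      T + (1 + (T' + 1 + 1) + 1) + 1, by omega, fun σ => ?_⟩
    obtain ⟨τ1, r1, e1, f1⟩ := h σ
    have r2 := (Exec.copy τ1 k 0).runs
    obtain ⟨τ2, r3, e3, f3⟩ := h' (Function.update τ1 k (τ1 0))
    have r4 := (Exec.setCons τ2 0 k 0).runs
    refine ⟨_, r1.seq (r2.seq (r3.seq r4)), ?_, fun j hj => ?_⟩
    · rw [Function.update_self, e3, f3 k hk', Function.update_self, e1]
    · rw [Function.update_of_ne (by omega), f3 j (by omega), Function.update_of_ne (by omega),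
        f1 j (by omega)]

@[fun_prop]
theorem PT.const (y : β) : PT (fun _ : α => y) := by
  obtain ⟨c, k, T, hk, h⟩ := PT.const_data (enc y)
  refine ⟨c, k, C (T + sz y), hk, fun x _ => ?_⟩
  rw [eval_C]
  refine ⟨Nat.le_add_left _ _, fun σ _ => ?_⟩
  obtain ⟨τ, r, e, f⟩ := h σ
  exact ⟨τ, r.mono (by omega), e, f⟩

/-- Case distinction. Each branch has to be correct only where it is taken. -/
theorem PTOn.ite {S : Set α} {b : α → Bool} {f g : α → β} (hb : PT b)
    (hf : PTOn {x ∈ S | b x = true} f) (hg : PTOn {x ∈ S | b x = false} g) :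
    PTOn S (fun x => if b x then f x else g x) := by
  obtain ⟨c, k₁, P, hk₁, h⟩ := hb
  obtain ⟨c', k₂, P', hk₂, h'⟩ := hf
  obtain ⟨c'', k₃, P'', hk₃, h''⟩ := hg
  obtain ⟨k, hk, hk', hk''⟩ : ∃ k, k₁ ≤ k ∧ k₂ ≤ k ∧ k₃ ≤ k :=
    ⟨max k₁ (max k₂ k₃), by omega, by omega, by omega⟩
  refine ⟨.seq (.copy k 0) (.seq c (.seq (.copy (k + 1) 0) (.seq (.copy 0 k)
    (.branch (k + 1) c' c'')))), k + 2, P + P' + P'' + 10, by omega, fun x hx => ?_⟩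
  obtain ⟨hs, h⟩ := h x trivial
  simp only [eval_add, eval_ofNat]
  -- the part common to both cases: the condition is evaluated into register `k + 1`
  have key : ∀ σ : Store, σ 0 = enc x → ∃ τ1 : Store, τ1 0 = enc x ∧ τ1 (k + 1) = enc (b x) ∧
      (∀ j, k + 2 ≤ j → τ1 j = σ j) ∧ ∀ T τ, Runs (.branch (k + 1) c' c'') τ1 T τ →
        Runs (.seq (.copy k 0) (.seq c (.seq (.copy (k + 1) 0) (.seq (.copy 0 k)
          (.branch (k + 1) c' c''))))) σ (P.eval (sz x) + T + 7) τ := by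
    intro σ hσ
    have r1 := (Exec.copy σ k 0).runs
    obtain ⟨τ1, r2, e2, f2⟩ := h (Function.update σ k (σ 0)) (by
      rw [Function.update_of_ne (by omega)]; exact hσ)
    have r3 := (Exec.copy τ1 (k + 1) 0).runs
    have r4 := (Exec.copy (Function.update τ1 (k + 1) (τ1 0)) 0 k).runs
    refine ⟨_, ?_, ?_, fun j hj => ?_, fun T τ hT =>
      (r1.seq (r2.seq (r3.seq (r4.seq hT)))).mono (by omega)⟩
    · rw [Function.update_self, Function.update_of_ne (by omega), f2 k hk,
        Function.update_self, hσ]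
    · rw [Function.update_of_ne (by omega), Function.update_self, e2]
    · rw [Function.update_of_ne (by omega), Function.update_of_ne (by omega), f2 j (by omega),
        Function.update_of_ne (by omega)]
  cases hbx : b x with
  | true =>
    obtain ⟨hs', h'⟩ := h' x ⟨hx, hbx⟩
    refine ⟨by simp; omega, fun σ hσ => ?_⟩
    obtain ⟨τ1, e1, e2, f1, hr⟩ := key σ hσ
    obtain ⟨τ, r, e3, f3⟩ := h' τ1 e1
    refine ⟨τ, (hr _ τ (Runs.branchTrue ?_ r)).mono (by omega), by simpa using e3, fun j hj => ?_⟩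
    · rw [e2, hbx]; exact Data.noConfusion
    · rw [f3 j (by omega), f1 j hj]
  | false =>
    obtain ⟨hs', h'⟩ := h'' x ⟨hx, hbx⟩
    refine ⟨by simp; omega, fun σ hσ => ?_⟩
    obtain ⟨τ1, e1, e2, f1, hr⟩ := key σ hσ
    obtain ⟨τ, r, e3, f3⟩ := h' τ1 e1
    refine ⟨τ, (hr _ τ (Runs.branchFalse ?_ r)).mono (by omega), by simpa using e3, fun j hj => ?_⟩
    · rw [e2, hbx]; rfl
    · rw [f3 j (by omega), f1 j hj]

@[fun_prop]
theorem PT.ite {b : α → Bool} {f g : α → β} (hb : PT b) (hf : PT f) (hg : PT g) :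
    PT (fun x => if b x then f x else g x) :=
  PTOn.ite hb (hf.on _) (hg.on _)

/-- Iteration along a list, with bounded intermediate results. -/
theorem PT.foldl_of_bound {l : γ → List α} {init : γ → β} {body : γ → β → α → β} (hl : PT l)
    (hi : PT init) (hb : PT (fun p : γ × β × α => body p.1 p.2.1 p.2.2)) (Q : ℕ[X])
    (hQ : ∀ x l₁ l₂, l x = l₁ ++ l₂ → sz (l₁.foldl (body x) (init x)) ≤ Q.eval (sz x)) :
    PT (fun x => (l x).foldl (body x) (init x)) := by
  obtain ⟨c, k₁, P, hk₁, h⟩ := hl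
  obtain ⟨c', k₂, P', hk₂, h'⟩ := hi
  obtain ⟨c'', k₃, P'', hk₃, h''⟩ := hb
  obtain ⟨k, hk, hk', hk''⟩ : ∃ k, k₁ ≤ k ∧ k₂ ≤ k ∧ k₃ ≤ k :=
    ⟨max k₁ (max k₂ k₃), by omega, by omega, by omega⟩
  set B : Cmd := .seq (.setHead (k + 2) (k + 1)) (.seq (.setCons 0 0 (k + 2))
    (.seq (.setCons 0 k 0) (.seq c'' (.setTail (k + 1) (k + 1))))) with hB
  refine ⟨.seq (.copy k 0) (.seq c (.seq (.copy (k + 1) 0) (.seq (.copy 0 k) (.seq c'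
    (.loop (k + 1) B))))), k + 3, P + P' + P * (P''.comp (X + Q + P + 2) + 10) + Q + 20,
    by omega, fun x hx => ?_⟩
  obtain ⟨hs, h⟩ := h x trivial
  obtain ⟨hs', h'⟩ := h' x trivial
  simp only [eval_add, eval_ofNat, eval_mul, eval_comp, eval_X]
  set T := P''.eval (sz x + Q.eval (sz x) + P.eval (sz x) + 2) with hT
  refine ⟨by have := hQ x (l x) [] (by simp); omega, fun σ hσ => ?_⟩
  have r1 := (Exec.copy σ k 0).runs
  obtain ⟨τ1, r2, e2, f2⟩ := h (Function.update σ k (σ 0)) (by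
    rw [Function.update_of_ne (by omega)]; exact hσ)
  have r3 := (Exec.copy τ1 (k + 1) 0).runs
  have r4 := (Exec.copy (Function.update τ1 (k + 1) (τ1 0)) 0 k).runs
  set τ2 := Function.update (Function.update τ1 (k + 1) (τ1 0)) 0
    (Function.update τ1 (k + 1) (τ1 0) k) with hτ2
  have hk0 : τ2 0 = enc x := by
    rw [hτ2, Function.update_self, Function.update_of_ne (by omega), f2 k hk,
      Function.update_self, hσ]
  obtain ⟨τ3, r5, e5, f5⟩ := h' τ2 hk0
  -- the loop
  have loop : ∀ l₂ l₁, l x = l₁ ++ l₂ → ∀ ρ : Store, ρ 0 = enc (l₁.foldl (body x) (init x)) →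
      ρ k = enc x → ρ (k + 1) = enc l₂ → ∃ ρ', Runs (.loop (k + 1) B) ρ
        (l₂.length * (T + 10) + 1) ρ' ∧ ρ' 0 = enc ((l x).foldl (body x) (init x)) ∧
        ∀ j, k + 3 ≤ j → ρ' j = ρ j := by
    intro l₂
    induction l₂ with
    | nil =>
      intro l₁ hl ρ h0 _ h1
      refine ⟨ρ, (Exec.loopDone h1).runs.mono (by simp), ?_, fun _ _ => rfl⟩
      rw [h0, hl, List.append_nil]
    | cons a l₂ ih =>
      intro l₁ hl ρ h0 hρk h1
      have hne : ρ (k + 1) ≠ .nil := by rw [h1]; exact Data.noConfusion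
      have s1 := (Exec.setHead ρ (k + 2) (k + 1)).runs
      set ρ1 := Function.update ρ (k + 2) (ρ (k + 1)).head with hρ1
      have s2 := (Exec.setCons ρ1 0 0 (k + 2)).runs
      set ρ2 := Function.update ρ1 0 (.cons (ρ1 0) (ρ1 (k + 2))) with hρ2
      have s3 := (Exec.setCons ρ2 0 k 0).runs
      set ρ3 := Function.update ρ2 0 (.cons (ρ2 k) (ρ2 0)) with hρ3
      have g1 : ρ1 (k + 2) = enc a := by rw [hρ1, Function.update_self, h1]; rfl
      have g0 : ρ1 0 = enc (l₁.foldl (body x) (init x)) := by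
        rw [hρ1, Function.update_of_ne (by omega), h0]
      have gk : ρ2 k = enc x := by
        rw [hρ2, Function.update_of_ne (by omega), hρ1, Function.update_of_ne (by omega), hρk]
      have g3 : ρ3 0 = enc (x, l₁.foldl (body x) (init x), a) := by
        rw [hρ3, Function.update_self, gk, hρ2, Function.update_self, g1, g0]
        rfl
      obtain ⟨hs'', h''⟩ := h'' (x, l₁.foldl (body x) (init x), a) trivial
      obtain ⟨ρ4, s4, e4, f4⟩ := h'' ρ3 g3
      have s5 := (Exec.setTail ρ4 (k + 1) (k + 1)).runs
      have g4 : ρ4 (k + 1) = enc (a :: l₂) := by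
        rw [f4 _ (by omega), hρ3, Function.update_of_ne (by omega), hρ2,
          Function.update_of_ne (by omega), hρ1, Function.update_of_ne (by omega), h1]
      obtain ⟨ρ', s6, e6, f6⟩ := ih (l₁ ++ [a]) (by rw [hl]; simp)
        (Function.update ρ4 (k + 1) (ρ4 (k + 1)).tail)
        (by rw [Function.update_of_ne (by omega), e4, List.foldl_append]; rfl)
        (by rw [Function.update_of_ne (by omega), f4 _ (by omega), hρ3,
              Function.update_of_ne (by omega), gk])
        (by rw [Function.update_self, g4]; rfl)
      have hT' : P''.eval (sz (x, l₁.foldl (body x) (init x), a)) ≤ T := by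
        refine eval_mono _ ?_
        rw [sz_pair, sz_pair]
        have q1 := hQ x l₁ _ hl
        have q2 : sz a ≤ sz (l x) := sz_mem_le (by rw [hl]; simp)
        omega
      refine ⟨ρ', (Runs.loopStep hne (s1.seq (s2.seq (s3.seq (s4.seq s5)))) s6).mono ?_, e6,
        fun j hj => ?_⟩
      · rw [List.length_cons, add_mul]; omega
      · rw [f6 j hj, Function.update_of_ne (by omega), f4 j (by omega), hρ3,
          Function.update_of_ne (by omega), hρ2, Function.update_of_ne (by omega), hρ1,
          Function.update_of_ne (by omega)]
  obtain ⟨ρ', r6, e6, f6⟩ := loop (l x) [] rfl τ3 e5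
    (by rw [f5 k hk', hτ2, Function.update_of_ne (by omega), Function.update_of_ne (by omega),
          f2 k hk, Function.update_self, hσ])
    (by rw [f5 _ (by omega), hτ2, Function.update_of_ne (by omega), Function.update_self, e2])
  have hlen : (l x).length * (T + 10) ≤ P.eval (sz x) * (T + 10) :=
    Nat.mul_le_mul_right _ ((length_le_sz _).trans hs)
  refine ⟨ρ', (r1.seq (r2.seq (r3.seq (r4.seq (r5.seq r6))))).mono (by omega), e6, fun j hj => ?_⟩
  rw [f6 j hj, f5 j (by omega), hτ2, Function.update_of_ne (by omega),
    Function.update_of_ne (by omega), f2 j (by omega), Function.update_of_ne (by omega)]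

/-- In polynomial time only values of polynomial size are computed. -/
theorem PT.size_le {f : α → β} (h : PT f) : ∃ P : ℕ[X], ∀ x, sz (f x) ≤ P.eval (sz x) := by
  obtain ⟨_, _, P, _, h⟩ := h
  exact ⟨P, fun x => (h x trivial).1⟩

/-- Iteration along a list, when every step adds a bounded amount to the size of the result. -/
theorem PT.foldl {l : γ → List α} {init : γ → β} {body : γ → β → α → β} (hl : PT l)
    (hi : PT init) (hb : PT (fun p : γ × β × α => body p.1 p.2.1 p.2.2)) (Q : ℕ[X])
    (hQ : ∀ x b, ∀ a ∈ l x, sz (body x b a) ≤ sz b + Q.eval (sz x)) :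
    PT (fun x => (l x).foldl (body x) (init x)) := by
  obtain ⟨P, hP⟩ := hl.size_le
  obtain ⟨P', hP'⟩ := hi.size_le
  refine PT.foldl_of_bound hl hi hb (P' + P * Q) fun x l₁ l₂ h => ?_
  have : ∀ l₁ : List α, (∀ a ∈ l₁, a ∈ l x) → ∀ b,
      sz (l₁.foldl (body x) b) ≤ sz b + l₁.length * Q.eval (sz x) := by
    intro l₁
    induction l₁ with
    | nil => intro _ b; simp
    | cons a l₁ ih =>
      intro h b
      have h1 := ih (fun a ha => h a (by simp [ha])) (body x b a)
      have h2 := hQ x b a (h a (by simp))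
      rw [List.foldl_cons, List.length_cons, add_mul]
      omega
  have h1 := this l₁ (fun a ha => by rw [h]; simp [ha]) (init x)
  have h2 : l₁.length ≤ P.eval (sz x) := by
    have := length_le_sz (l x)
    have := hP x
    have : (l x).length = l₁.length + l₂.length := by rw [h, List.length_append]
    omega
  have h3 := Nat.mul_le_mul_right (Q.eval (sz x)) h2
  have h4 := hP' x
  simp only [eval_add, eval_mul]
  omega

end

section
variable {α β γ δ : Type} [Enc α] [Enc β] [Enc γ] [Enc δ]

/-! ### Polynomial-time functions on booleans, numbers and lists -/

/-- Tests whether the input is represented by `nil`. -/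
theorem PT.of_isNil {f : α → Bool} (h : ∀ x, f x = true ↔ enc x = .nil) : PT f := by
  refine ⟨.branch 0 (.setNil 0) (.seq (.setNil 0) (.setCons 0 0 0)), 1, X + 10, le_rfl,
    fun x _ => ?_⟩
  simp only [eval_add, eval_ofNat, eval_X]
  refine ⟨(sz_bool_le _).trans (by omega), fun σ hσ => ?_⟩
  by_cases hx : enc x = .nil
  · refine ⟨_, (Runs.branchFalse (hσ.trans hx) ((Exec.setNil σ 0).runs.seq
      (Exec.setCons _ 0 0 0).runs)).mono (by omega), ?_, fun j hj => ?_⟩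
    · rw [(h x).2 hx]; simp; rfl
    · simp [show j ≠ 0 by omega]
  · have hf : f x = false := by
      cases hb : f x
      · rfl
      · exact absurd ((h x).1 hb) hx
    refine ⟨_, (Runs.branchTrue (fun h' => hx (hσ ▸ h')) (Exec.setNil σ 0).runs).mono (by omega),
      ?_, fun j hj => ?_⟩
    · rw [hf]; simp; rfl
    · simp [show j ≠ 0 by omega]

@[fun_prop]
theorem PT.not {f : α → Bool} (hf : PT f) : PT (fun x => !f x) :=
  PT.of_eq (f := fun x => if f x then false else true) (by fun_prop) fun x => by cases f x <;> rfl

@[fun_prop]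
theorem PT.and {f g : α → Bool} (hf : PT f) (hg : PT g) : PT (fun x => f x && g x) :=
  PT.of_eq (f := fun x => if f x then g x else false) (by fun_prop) fun x => by cases f x <;> rfl

@[fun_prop]
theorem PT.or {f g : α → Bool} (hf : PT f) (hg : PT g) : PT (fun x => f x || g x) :=
  PT.of_eq (f := fun x => if f x then true else g x) (by fun_prop) fun x => by cases f x <;> rfl

@[fun_prop]
theorem PT.xor {f g : α → Bool} (hf : PT f) (hg : PT g) : PT (fun x => xor (f x) (g x)) :=
  PT.of_eq (f := fun x => if f x then !g x else g x) (by fun_prop)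
    fun x => by cases f x <;> simp

@[fun_prop]
theorem PT.list_cons {f : γ → α} {l : γ → List α} (hf : PT f) (hl : PT l) :
    PT (fun x => f x :: l x) :=
  (PT.of_enc_eq (f := fun p : α × List α => p.1 :: p.2) fun _ => rfl).comp (hf.prodMk hl)

@[fun_prop]
theorem PT.list_tail {l : γ → List α} (hl : PT l) : PT (fun x => (l x).tail) := by
  refine PT.comp (g := List.tail) (PT.of_instruction (.setTail 0 0) (fun x σ hσ => ?_)
    fun x => ?_) hl
  · have := Exec.setTail σ 0 0
    rw [hσ] at this
    cases x <;> exact this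
  · exact (sz_sublist (List.tail_sublist x)).trans (by omega)

@[fun_prop]
theorem PT.isEmpty {l : γ → List α} (hl : PT l) : PT (fun x => (l x).isEmpty) := by
  refine PT.comp (g := List.isEmpty) (PT.of_isNil fun x => ?_) hl
  cases x <;> simp [enc, Enc.toData, Data.ofList]

@[fun_prop]
theorem PT.headD {l : γ → List α} {d : γ → α} (hl : PT l) (hd : PT d) :
    PT (fun x => (l x).headD (d x)) := by
  suffices h : PT (fun p : List α × α => p.1.headD p.2) from h.comp (hl.prodMk hd)
  refine PTOn.congr (f := fun p : List α × α => if p.1.isEmpty then p.2 else p.1.headD p.2)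
    (PTOn.ite (b := fun p : List α × α => p.1.isEmpty) (by fun_prop) (PT.snd'.on _) ?_) ?_
  · refine ⟨.seq (.setHead 0 0) (.setHead 0 0), 1, X + 10, le_rfl, fun x hx => ?_⟩
    obtain ⟨l, d⟩ := x
    simp only [eval_add, eval_ofNat, eval_X]
    cases l with
    | nil => simp at hx
    | cons a l =>
      refine ⟨?_, fun σ hσ => ⟨_, ((Exec.setHead σ 0 0).runs.seq (Exec.setHead _ 0 0).runs).mono
        (by omega), ?_, fun j hj => ?_⟩⟩
      · rw [sz_pair, sz_cons, List.headD_cons]; omega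
      · rw [Function.update_self, Function.update_self, hσ]; rfl
      · rw [Function.update_of_ne (by omega), Function.update_of_ne (by omega)]
  · rintro ⟨l, d⟩ _
    cases l <;> rfl

/-- A number in unary is represented like a list of units. -/
theorem PT.replicate_unit : PT (fun k : ℕ => List.replicate k ()) := by
  refine PT.of_enc_eq fun k => ?_
  induction k with
  | zero => rfl
  | succ k ih =>
    rw [List.replicate_succ]
    exact congrArg (Data.cons Data.nil) ih

@[fun_prop]
theorem PT.nat_succ {f : γ → ℕ} (hf : PT f) : PT (fun x => f x + 1) :=
  (PT.of_enc_eq (f := fun p : Unit × ℕ => p.2 + 1) fun _ => rfl).comp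
    ((PT.const ()).prodMk hf)

theorem PT.nat_pred {f : γ → ℕ} (hf : PT f) : PT (fun x => f x - 1) := by
  refine PT.comp (g := fun k => k - 1) (PT.of_instruction (.setTail 0 0) (fun x σ hσ => ?_)
    fun x => ?_) hf
  · have := Exec.setTail σ 0 0
    rw [hσ] at this
    cases x <;> exact this
  · rw [sz_nat, sz_nat]; omega

/-- Iterating a function, with a number of iterations given in unary. -/
theorem PT.iterate {k : γ → ℕ} {init : γ → β} {body : γ → β → β} (hk : PT k)
    (hi : PT init) (hb : PT (fun p : γ × β => body p.1 p.2)) (Q : ℕ[X])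
    (hQ : ∀ x b, sz (body x b) ≤ sz b + Q.eval (sz x)) :
    PT (fun x => (body x)^[k x] (init x)) := by
  have := PT.foldl (l := fun x => List.replicate (k x) ()) (init := init)
    (body := fun x b _ => body x b) (PT.replicate_unit.comp hk) hi
    (hb.comp (f := fun p : γ × β × Unit => (p.1, p.2.1)) (by fun_prop)) Q
    (fun x b a _ => hQ x b)
  refine this.of_eq fun x => ?_
  generalize init x = b
  induction k x generalizing b with
  | zero => rfl
  | succ n ih => rw [List.replicate_succ, List.foldl_cons, ih, Function.iterate_succ_apply]

@[fun_prop]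
theorem PT.nat_add {f g : γ → ℕ} (hf : PT f) (hg : PT g) : PT (fun x => f x + g x) := by
  refine (PT.iterate (k := g) (init := f) (body := fun _ b => b + 1) hg hf (by fun_prop) 2
    fun x b => ?_).of_eq fun x => ?_
  · simp only [sz_nat, eval_ofNat]; omega
  · generalize f x = a
    induction g x generalizing a with
    | zero => rfl
    | succ n ih => rw [Function.iterate_succ_apply, ih]; omega

@[fun_prop]
theorem PT.nat_sub {f g : γ → ℕ} (hf : PT f) (hg : PT g) : PT (fun x => f x - g x) := by
  refine (PT.iterate (k := g) (init := f) (body := fun _ b => b - 1) hg hf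
    (PT.nat_pred PT.snd') 0 fun x b => ?_).of_eq fun x => ?_
  · simp only [sz_nat, eval_zero]; omega
  · generalize f x = a
    induction g x generalizing a with
    | zero => rfl
    | succ n ih => rw [Function.iterate_succ_apply, ih]; omega

@[fun_prop]
theorem PT.nat_mul {f g : γ → ℕ} (hf : PT f) (hg : PT g) : PT (fun x => f x * g x) := by
  obtain ⟨P, hP⟩ := hf.size_le
  refine (PT.iterate (k := g) (init := fun _ => 0) (body := fun x b => b + f x) hg (by fun_prop)
    (PT.nat_add (by fun_prop) (hf.comp (by fun_prop))) P fun x b => ?_).of_eq fun x => ?_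
  · have := hP x
    simp only [sz_nat] at this ⊢; omega
  · generalize f x = a
    have : ∀ n c, (fun b => b + a)^[n] c = c + a * n := by
      intro n
      induction n with
      | zero => simp
      | succ n ih => intro c; rw [Function.iterate_succ_apply, ih]; ring
    rw [this]; omega

@[fun_prop]
theorem PT.nat_pow {f : γ → ℕ} (hf : PT f) (k : ℕ) : PT (fun x => f x ^ k) := by
  induction k with
  | zero => simpa using PT.const 1
  | succ k ih => simp only [pow_succ]; fun_prop

@[fun_prop]
theorem PT.nat_le {f g : γ → ℕ} (hf : PT f) (hg : PT g) : PT (fun x => decide (f x ≤ g x)) := by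
  have h : PT (fun k : ℕ => decide (k = 0)) := PT.of_isNil fun k => by
    cases k <;> simp [enc, Enc.toData, Data.ofNat]
  refine (h.comp (hf.nat_sub hg)).of_eq fun x => ?_
  simp [Nat.sub_eq_zero_iff_le]

@[fun_prop]
theorem PT.nat_lt {f g : γ → ℕ} (hf : PT f) (hg : PT g) : PT (fun x => decide (f x < g x)) :=
  (PT.nat_le (hf.nat_succ) hg).of_eq fun _ => rfl

@[fun_prop]
theorem PT.nat_eq {f g : γ → ℕ} (hf : PT f) (hg : PT g) : PT (fun x => decide (f x = g x)) :=
  PT.of_eq (f := fun x => decide (f x ≤ g x) && decide (g x ≤ f x)) (by fun_prop) fun x => by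
    rw [← Bool.decide_and, decide_eq_decide]; omega

@[fun_prop]
theorem PT.length {l : γ → List α} (hl : PT l) : PT (fun x => (l x).length) := by
  refine (PT.foldl (init := fun _ => 0) (body := fun _ b _ => b + 1) hl (by fun_prop)
    (by fun_prop) 2 fun x b a _ => ?_).of_eq fun x => ?_
  · simp only [sz_nat, eval_ofNat]; omega
  · have : ∀ (l : List α) c, l.foldl (fun b _ => b + 1) c = c + l.length := by
      intro l
      induction l with
      | nil => simp
      | cons a l ih => intro c; rw [List.foldl_cons, ih, List.length_cons]; omega
    rw [this]; omega

@[fun_prop]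
theorem PT.reverse {l : γ → List α} (hl : PT l) : PT (fun x => (l x).reverse) := by
  obtain ⟨P, hP⟩ := hl.size_le
  refine (PT.foldl (init := fun _ => []) (body := fun _ b a => a :: b) hl (by fun_prop)
    (by fun_prop) (P + 1) fun x b a ha => ?_).of_eq fun x => ?_
  · have := (sz_mem_le ha).trans (hP x)
    rw [sz_cons, eval_add, eval_one]; omega
  · have : ∀ (l c : List α), l.foldl (fun b a => a :: b) c = l.reverse ++ c := by
      intro l
      induction l with
      | nil => simp
      | cons a l ih => intro c; rw [List.foldl_cons, ih]; simp
    rw [this]; simp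

/-- Filtering and mapping in one pass; the pass collects the values in reversed order. -/
theorem PT.filterMap_aux {l : γ → List α} {p : γ → α → Bool} {f : γ → α → β} (hl : PT l)
    (hp : PT (fun q : γ × α => p q.1 q.2)) (hf : PT (fun q : γ × α => f q.1 q.2)) :
    PT (fun x => ((l x).filter (p x)).map (f x)) := by
  obtain ⟨P, hP⟩ := hl.size_le
  obtain ⟨P', hP'⟩ := hf.size_le
  have h := (PT.foldl (init := fun _ => []) (body := fun x b a => if p x a then f x a :: b else b)
    hl (by fun_prop) (PT.ite (hp.comp (f := fun p : γ × List β × α => (p.1, p.2.2)) (by fun_prop))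
      (PT.list_cons (hf.comp (f := fun p : γ × List β × α => (p.1, p.2.2)) (by fun_prop))
        (by fun_prop)) (by fun_prop)) (P'.comp (X + P + 1) + 1) fun x b a ha => ?_).reverse
  · refine h.of_eq fun x => ?_
    have : ∀ (l : List α) c, (l.foldl (fun b a => if p x a then f x a :: b else b) c).reverse =
        c.reverse ++ (l.filter (p x)).map (f x) := by
      intro l
      induction l with
      | nil => simp
      | cons a l ih =>
        intro c
        rw [List.foldl_cons, ih, List.filter_cons]
        split <;> simp
    rw [this]; rfl
  · simp only [eval_add, eval_one, eval_comp, eval_X]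
    have h1 := (sz_mem_le ha).trans (hP x)
    have h2 : sz (f x a) ≤ P'.eval (sz (x, a)) := hP' (x, a)
    have h3 := eval_mono P' (x := sz (x, a)) (y := sz x + P.eval (sz x) + 1) (by
      rw [sz_pair]; omega)
    split
    · rw [sz_cons]; omega
    · omega

@[fun_prop]
theorem PT.map {l : γ → List α} {f : γ → α → β} (hl : PT l)
    (hf : PT (fun q : γ × α => f q.1 q.2)) : PT (fun x => (l x).map (f x)) :=
  (PT.filterMap_aux (p := fun _ _ => true) hl (by fun_prop) hf).of_eq fun x => by simp

@[fun_prop]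
theorem PT.filter {l : γ → List α} {p : γ → α → Bool} (hl : PT l)
    (hp : PT (fun q : γ × α => p q.1 q.2)) : PT (fun x => (l x).filter (p x)) :=
  (PT.filterMap_aux (f := fun _ a => a) hl hp (by fun_prop)).of_eq fun x => by simp

@[fun_prop]
theorem PT.any {l : γ → List α} {p : γ → α → Bool} (hl : PT l)
    (hp : PT (fun q : γ × α => p q.1 q.2)) : PT (fun x => (l x).any (p x)) :=
  PT.of_eq (f := fun x => !((l x).filter (p x)).isEmpty) (by fun_prop) fun x => by
    induction l x with
    | nil => rfl
    | cons a l ih =>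
      rw [List.filter_cons, List.any_cons, ← ih]
      cases p x a <;> simp

@[fun_prop]
theorem PT.all {l : γ → List α} {p : γ → α → Bool} (hl : PT l)
    (hp : PT (fun q : γ × α => p q.1 q.2)) : PT (fun x => (l x).all (p x)) :=
  PT.of_eq (f := fun x => !((l x).any (fun a => !p x a))) (by fun_prop) fun x => by
    rw [List.not_any_eq_all_not]; simp

@[fun_prop]
theorem PT.drop {k : γ → ℕ} {l : γ → List α} (hk : PT k) (hl : PT l) :
    PT (fun x => (l x).drop (k x)) := by
  refine (PT.iterate (k := k) (init := l) (body := fun _ b => b.tail) hk hl (by fun_prop) 0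
    fun x b => ?_).of_eq fun x => ?_
  · exact (sz_sublist (List.tail_sublist b)).trans (by omega)
  · generalize l x = a
    induction k x generalizing a with
    | zero => rfl
    | succ n ih => rw [Function.iterate_succ_apply, ih]; simp

@[fun_prop]
theorem PT.take {k : γ → ℕ} {l : γ → List α} (hk : PT k) (hl : PT l) :
    PT (fun x => (l x).take (k x)) := by
  obtain ⟨P, hP⟩ := hl.size_le
  have h := (PT.foldl (init := fun x => (([] : List α), k x))
    (body := fun _ b a => if decide (b.2 ≤ 0) then b else (a :: b.1, b.2 - 1))
    hl (by fun_prop) (by fun_prop) (P + 1) fun x b a ha => ?_).fst.reverse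
  · refine h.of_eq fun x => ?_
    have : ∀ (l : List α) c, (l.foldl (fun (b : List α × ℕ) a => if decide (b.2 ≤ 0) then b else
        (a :: b.1, b.2 - 1)) c).1.reverse = c.1.reverse ++ l.take c.2 := by
      intro l
      induction l with
      | nil => simp
      | cons a l ih =>
        rintro ⟨c, k⟩
        rw [List.foldl_cons, ih]
        cases k <;> simp
    rw [this]; rfl
  · have := (sz_mem_le ha).trans (hP x)
    simp only [eval_add, eval_one]
    split
    · omega
    · rw [sz_pair, sz_cons, show sz b = sz b.1 + sz b.2 + 1 from rfl, sz_nat, sz_nat]; omega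

@[fun_prop]
theorem PT.getD {l : γ → List α} {k : γ → ℕ} {d : γ → α} (hl : PT l) (hk : PT k) (hd : PT d) :
    PT (fun x => (l x).getD (k x) (d x)) :=
  PT.of_eq (f := fun x => ((l x).drop (k x)).headD (d x)) (by fun_prop) fun x => by
    generalize l x = a
    induction k x generalizing a with
    | zero => cases a <;> rfl
    | succ n ih => cases a with
      | nil => rfl
      | cons b a => simp

@[fun_prop]
theorem PT.range {k : γ → ℕ} (hk : PT k) : PT (fun x => List.range (k x)) := by
  -- the numbers are collected from `k - 1` down to `0`
  have key : ∀ m j : ℕ, j ≤ m → (List.replicate j ()).foldl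
      (fun (b : ℕ × List ℕ) _ => (b.1 - 1, (b.1 - 1) :: b.2)) (m, []) =
        (m - j, (List.range' (m - j) j)) := by
    intro m j
    induction j with
    | zero => intro _; rfl
    | succ j ih =>
      intro hj
      rw [List.replicate_succ', List.foldl_append, ih (by omega)]
      simp only [List.foldl_cons, List.foldl_nil, Nat.sub_sub]
      rw [List.range'_succ, show m - (j + 1) + 1 = m - j by omega]
  suffices h : PT (fun k : ℕ => (List.replicate k ()).foldl
      (fun (b : ℕ × List ℕ) _ => (b.1 - 1, (b.1 - 1) :: b.2)) (k, [])) by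
    refine (h.snd.comp hk).of_eq fun x => ?_
    rw [key _ _ le_rfl, Nat.sub_self, List.range_eq_range']
  refine PT.foldl_of_bound (body := fun _ (b : ℕ × List ℕ) _ => (b.1 - 1, (b.1 - 1) :: b.2))
    PT.replicate_unit (by fun_prop) (by fun_prop) (X + X * (X + 1) + 3) fun x l₁ l₂ h => ?_
  have hl : l₁ = List.replicate l₁.length () := by
    rw [List.eq_replicate_iff]; exact ⟨rfl, fun _ _ => rfl⟩
  have hlen : l₁.length ≤ x := by
    have := congrArg List.length h
    simp at this; omega
  rw [hl, key _ _ hlen]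
  simp only [eval_add, eval_mul, eval_X, eval_one, eval_ofNat]
  have h1 : sz (List.range' (x - l₁.length) l₁.length) ≤ l₁.length * (sz x + 1) + 1 := by
    have := sz_le_of_forall_le (l := List.range' (x - l₁.length) l₁.length) (B := sz x) (by
      intro a ha
      rw [List.mem_range'_1] at ha
      rw [sz_nat, sz_nat]; omega)
    rwa [List.length_range'] at this
  have h2 : l₁.length * (sz x + 1) ≤ sz x * (sz x + 1) := Nat.mul_le_mul_right _ (by
    rw [sz_nat]; omega)
  rw [sz_pair, show sz (x - l₁.length) = 2 * (x - l₁.length) + 1 from sz_nat _]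
  rw [sz_nat] at h1 h2 ⊢
  omega

/-- A quotient as the number of positive multiples of `b` up to `a`. -/
theorem filter_range_length (a b : ℕ) (hb : 0 < b) :
    ((List.range a).filter (fun j => decide ((j + 1) * b ≤ a))).length = a / b := by
  have h : ∀ n, ((List.range n).filter (fun j => decide ((j + 1) * b ≤ a))).length =
      min n (a / b) := by
    intro n
    induction n with
    | zero => simp
    | succ n ih =>
      rw [List.range_succ, List.filter_append, List.length_append, ih, List.filter_singleton]
      by_cases hn : (n + 1) * b ≤ a
      · have := (Nat.le_div_iff_mul_le hb).2 hn
        simp [hn]; omega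
      · have : a / b < n + 1 := (Nat.div_lt_iff_lt_mul hb).2 (by omega)
        simp [hn]; omega
  rw [h, min_eq_right (Nat.div_le_self a b)]

@[fun_prop]
theorem PT.nat_div {f g : γ → ℕ} (hf : PT f) (hg : PT g) : PT (fun x => f x / g x) := by
  suffices h : PT (fun p : ℕ × ℕ => p.1 / p.2) from h.comp (hf.prodMk hg)
  refine PT.of_eq (f := fun p : ℕ × ℕ => if decide (p.2 ≤ 0) then 0 else
    ((List.range p.1).filter (fun j => decide ((j + 1) * p.2 ≤ p.1))).length) (by fun_prop)
    fun p => ?_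
  rcases Nat.eq_zero_or_pos p.2 with h | h
  · simp [h]
  · rw [filter_range_length _ _ h]
    simp [h.ne']

end

section
variable {α β γ δ : Type} [Enc α] [Enc β] [Enc γ] [Enc δ]

/-! ### Calling a given algorithm -/

/-- A number such that the program uses only smaller registers. -/
def Cmd.regBound : Cmd → ℕ
  | .skip => 0
  | .setNil x => x + 1
  | .copy x y => x + y + 1
  | .setCons x y z => x + y + z + 1
  | .setHead x y => x + y + 1
  | .setTail x y => x + y + 1
  | .seq p q => p.regBound + q.regBound
  | .branch x p q => x + p.regBound + q.regBound + 1
  | .loop x p => x + p.regBound + 1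

/-- The registers from `k` on are neither read nor written, if `k` bounds the registers of the
program. -/
theorem Exec.local_of_regBound_le {p : Cmd} {σ τ : Store} {t k : ℕ} (h : Exec p σ t τ)
    (hk : p.regBound ≤ k) (σ' : Store) (hσ : ∀ j < k, σ' j = σ j) :
    ∃ τ', Exec p σ' t τ' ∧ (∀ j < k, τ' j = τ j) ∧ ∀ j, k ≤ j → τ' j = σ' j := by
  have upd : ∀ (x : ℕ) (a b : Data) (σ σ' : Store), (∀ j < k, σ' j = σ j) → a = b → x < k →
      (∀ j < k, Function.update σ' x a j = Function.update σ x b j) ∧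
        ∀ j, k ≤ j → Function.update σ' x a j = σ' j := by
    rintro x a _ σ σ' hσ rfl hx
    refine ⟨fun j hj => ?_, fun j hj => Function.update_of_ne (by omega) ..⟩
    by_cases hjx : j = x
    · subst hjx; simp
    · rw [Function.update_of_ne hjx, Function.update_of_ne hjx, hσ j hj]
  induction h generalizing σ' with
  | skip σ => exact ⟨σ', .skip σ', hσ, fun _ _ => rfl⟩
  | setNil σ x =>
    simp only [Cmd.regBound] at hk
    exact ⟨_, .setNil σ' x, upd x _ _ σ σ' hσ rfl (by omega)⟩
  | copy σ x y =>
    simp only [Cmd.regBound] at hk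
    exact ⟨_, .copy σ' x y, upd x _ _ σ σ' hσ (hσ y (by omega)) (by omega)⟩
  | setCons σ x y z =>
    simp only [Cmd.regBound] at hk
    exact ⟨_, .setCons σ' x y z, upd x _ _ σ σ' hσ
      (by rw [hσ y (by omega), hσ z (by omega)]) (by omega)⟩
  | setHead σ x y =>
    simp only [Cmd.regBound] at hk
    exact ⟨_, .setHead σ' x y, upd x _ _ σ σ' hσ (by rw [hσ y (by omega)]) (by omega)⟩
  | setTail σ x y =>
    simp only [Cmd.regBound] at hk
    exact ⟨_, .setTail σ' x y, upd x _ _ σ σ' hσ (by rw [hσ y (by omega)]) (by omega)⟩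
  | seq _ _ ih₁ ih₂ =>
    simp only [Cmd.regBound] at hk
    obtain ⟨τ', e, h1, h2⟩ := ih₁ (by omega) σ' hσ
    obtain ⟨ρ', e', h1', h2'⟩ := ih₂ (by omega) τ' h1
    exact ⟨ρ', .seq e e', h1', fun j hj => (h2' j hj).trans (h2 j hj)⟩
  | branchTrue hx _ ih =>
    simp only [Cmd.regBound] at hk
    obtain ⟨τ', e, h⟩ := ih (by omega) σ' hσ
    exact ⟨τ', .branchTrue (by rwa [hσ _ (by omega)]) e, h⟩
  | branchFalse hx _ ih =>
    simp only [Cmd.regBound] at hk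
    obtain ⟨τ', e, h⟩ := ih (by omega) σ' hσ
    exact ⟨τ', .branchFalse (by rwa [hσ _ (by omega)]) e, h⟩
  | loopDone hx =>
    simp only [Cmd.regBound] at hk
    exact ⟨σ', .loopDone (by rwa [hσ _ (by omega)]), hσ, fun _ _ => rfl⟩
  | loopStep hx _ _ ih₁ ih₂ =>
    have hk' := hk
    simp only [Cmd.regBound] at hk
    obtain ⟨τ', e, h1, h2⟩ := ih₁ (by omega) σ' hσ
    obtain ⟨ρ', e', h1', h2'⟩ := ih₂ hk' τ' h1
    exact ⟨ρ', .loopStep (by rwa [hσ _ (by omega)]) e e', h1',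
      fun j hj => (h2' j hj).trans (h2 j hj)⟩

/-- A program that empties `n` registers from register `a` on. -/
def clearRegs (a : ℕ) : ℕ → Cmd
  | 0 => .skip
  | n + 1 => .seq (clearRegs a n) (.setNil (a + n))

theorem runs_clearRegs (a n : ℕ) (σ : Store) : ∃ τ, Runs (clearRegs a n) σ (2 * n + 1) τ ∧
    (∀ j, a ≤ j → j < a + n → τ j = .nil) ∧ ∀ j, (j < a ∨ a + n ≤ j) → τ j = σ j := by
  induction n with
  | zero => exact ⟨σ, (Exec.skip σ).runs, fun j _ _ => by omega, fun _ _ => rfl⟩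
  | succ n ih =>
    obtain ⟨τ, r, h1, h2⟩ := ih
    refine ⟨_, (r.seq (Exec.setNil τ (a + n)).runs).mono (by omega), fun j hj hj' => ?_,
      fun j hj => ?_⟩
    · by_cases h : j = a + n
      · subst h; simp
      · rw [Function.update_of_ne h, h1 j hj (by omega)]
    · rw [Function.update_of_ne (by omega), h2 j (by omega)]

/-- Decision instances as typed values: number of vertices, hyperedges, and output bits. -/
abbrev DecInst : Type := ℕ × List (List ℕ) × List Bool

open Classical in
/-- The answer of `D` on the instance `x` with coins `r` is "1". -/
noncomputable def accepts (D : RandAlg) (x : DecInst) (r : List Bool) : Bool :=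
  decide (∃ t σ, Exec D.prog (initStore (enc x) (enc r)) t σ ∧ σ 0 = .ofBool true)

theorem enc_ofFn_bits {k : ℕ} (r : Fin k → Bool) : enc (List.ofFn r) = Data.ofBits r := by
  change Data.ofList _ = Data.ofList _
  rw [List.map_ofFn]; rfl

theorem eq_ofFn_of_length {α : Type} {l : List α} {k : ℕ} (h : l.length = k) :
    ∃ r : Fin k → α, l = List.ofFn r := by
  subst h
  exact ⟨l.get, (List.ofFn_get l).symm⟩

open Classical in
/-- A given algorithm can be called on its instances: its registers are cleared, its program is run,
and the result is compared with `true`. -/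
theorem PTOn.accepts {D : RandAlg} {I : Set Data} (hD : D.IsPolyTimeOn I) :
    PTOn {p : DecInst × List Bool | enc p.1 ∈ I ∧ p.2.length = D.numCoins (enc p.1)}
      (fun p => accepts D p.1 p.2) := by
  obtain ⟨a, ha⟩ := hD
  set k := D.prog.regBound + 2 with hk
  -- the answer is compared with the representation of `true`
  set out : Cmd := .branch 0 (.seq (.setHead 1 0) (.seq (.setTail 0 0)
    (.branch 0 (.setNil 0) (.branch 1 (.setNil 0) (.setCons 0 1 1))))) .skip with hout
  have hrun : ∀ σ : Store, ∃ τ, Runs out σ 10 τ ∧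
      (τ 0 = if σ 0 = Data.ofBool true then Data.ofBool true else Data.nil) ∧
      ∀ j, 2 ≤ j → τ j = σ j := by
    intro σ
    cases h0 : σ 0 with
    | nil =>
      exact ⟨σ, (Runs.branchFalse h0 (Exec.skip σ).runs).mono (by omega),
        by simp [h0, Data.ofBool], fun _ _ => rfl⟩
    | cons u v =>
      have hne : σ 0 ≠ .nil := by rw [h0]; exact Data.noConfusion
      have r1 := (Exec.setHead σ 1 0).runs
      set σ1 := Function.update σ 1 (σ 0).head with hσ1
      have r2 := (Exec.setTail σ1 0 0).runs
      set σ2 := Function.update σ1 0 (σ1 0).tail with hσ2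
      have e0 : σ2 0 = v := by simp [hσ2, hσ1, h0, Data.tail]
      have e1 : σ2 1 = u := by simp [hσ2, hσ1, h0, Data.head]
      have ej : ∀ j, 2 ≤ j → σ2 j = σ j := fun j hj => by
        rw [hσ2, hσ1, Function.update_of_ne (by omega), Function.update_of_ne (by omega)]
      cases v with
      | cons v w =>
        refine ⟨_, (Runs.branchTrue hne (r1.seq (r2.seq (Runs.branchTrue
          (by rw [e0]; exact Data.noConfusion) (Exec.setNil σ2 0).runs)))).mono (by omega),
          by simp [Data.ofBool], fun j hj => ?_⟩
        rw [Function.update_of_ne (by omega), ej j hj]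
      | nil =>
        cases u with
        | cons u w =>
          refine ⟨_, (Runs.branchTrue hne (r1.seq (r2.seq (Runs.branchFalse e0 (Runs.branchTrue
            (by rw [e1]; exact Data.noConfusion) (Exec.setNil σ2 0).runs))))).mono (by omega),
            by simp [Data.ofBool], fun j hj => ?_⟩
          rw [Function.update_of_ne (by omega), ej j hj]
        | nil =>
          refine ⟨_, (Runs.branchTrue hne (r1.seq (r2.seq (Runs.branchFalse e0 (Runs.branchFalse
            e1 (Exec.setCons σ2 0 1 1).runs))))).mono (by omega),
            by simp [Data.ofBool, e1], fun j hj => ?_⟩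
          rw [Function.update_of_ne (by omega), ej j hj]
  refine ⟨.seq (.setTail 1 0) (.seq (.setHead 0 0) (.seq (clearRegs 2 k) (.seq D.prog out))),
    k + 2, polyBoundPoly a + C (2 * k + 20), by omega, fun ⟨x, r⟩ ⟨hx, hr⟩ => ?_⟩
  simp only [eval_add, eval_C, eval_polyBoundPoly]
  refine ⟨(sz_bool_le _).trans (by omega), fun σ hσ => ?_⟩
  have r1 := (Exec.setTail σ 1 0).runs
  have r2 := (Exec.setHead (Function.update σ 1 (σ 0).tail) 0 0).runs
  set σ1 := Function.update (Function.update σ 1 (σ 0).tail) 0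
    ((Function.update σ 1 (σ 0).tail) 0).head with hσ1
  have e0 : σ1 0 = enc x := by simp [hσ1, hσ]; rfl
  have e1 : σ1 1 = enc r := by simp [hσ1, hσ]; rfl
  obtain ⟨σ2, r3, f1, f2⟩ := runs_clearRegs 2 k σ1
  have agree : ∀ j < k + 2, σ2 j = initStore (enc x) (enc r) j := by
    intro j hj
    unfold initStore
    split_ifs with h0 h1
    · rw [h0, f2 0 (by omega), e0]
    · rw [h1, f2 1 (by omega), e1]
    · exact f1 j (by omega) (by omega)
  obtain ⟨r', hr'⟩ := eq_ofFn_of_length hr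
  obtain ⟨t, ht, τ, hex⟩ := ha (enc x) hx r'
  rw [← enc_ofFn_bits, ← hr'] at hex
  obtain ⟨τ', hex', g1, g2⟩ := hex.local_of_regBound_le (k := k + 2) (by omega) σ2 agree
  obtain ⟨ρ, r5, hρ0, hρ⟩ := hrun τ'
  refine ⟨ρ, (r1.seq (r2.seq (r3.seq (hex'.runs.seq r5)))).mono ?_, ?_, fun j hj => ?_⟩
  · have : polyBound a (enc x).size ≤ polyBound a (sz (x, r)) := by
      rw [← eval_polyBoundPoly, ← eval_polyBoundPoly]
      refine eval_mono _ ?_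
      rw [sz_pair]; unfold sz; omega
    omega
  · rw [hρ0, g1 0 (by omega)]
    have : RandomLocal.accepts D x r = decide (τ 0 = .ofBool true) := by
      unfold RandomLocal.accepts
      rw [decide_eq_decide]
      exact ⟨fun ⟨t', σ', h, h'⟩ => (hex.deterministic h).2 ▸ h', fun h => ⟨t, τ, hex, h⟩⟩
    simp only [this]
    by_cases h : τ 0 = .ofBool true <;> simp [h] <;> rfl
  · rw [hρ j (by omega), g2 j hj, f2 j (by omega), hσ1, Function.update_of_ne (by omega),
      Function.update_of_ne (by omega)]

theorem PT.sz_list {l : γ → List α} (hl : PT l) (h : PT (fun x : α => sz x)) :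
    PT (fun x => sz (l x)) := by
  obtain ⟨P, hP⟩ := hl.size_le
  refine (PT.foldl (init := fun _ => 1) (body := fun _ b a => b + sz a + 1) hl (by fun_prop)
    (PT.nat_succ (PT.nat_add (by fun_prop) (h.comp (f := fun p : γ × ℕ × α => p.2.2)
      (by fun_prop)))) (P + P + 2) fun x b a ha => ?_).of_eq fun x => ?_
  · have h1 := (sz_mem_le ha).trans (hP x)
    simp only [eval_add, eval_ofNat]
    rw [sz_nat, sz_nat]; omega
  · have : ∀ (l : List α) c, l.foldl (fun b a => b + sz a + 1) c + 1 = c + sz l := by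
      intro l
      induction l with
      | nil => intro c; rw [sz_nil]; rfl
      | cons a l ih => intro c; rw [List.foldl_cons, ih, sz_cons]; omega
    have := this (l x) 1
    omega

theorem PT.sz_nat : PT (fun x : ℕ => sz x) :=
  PT.of_eq (f := fun x => 2 * x + 1) (by fun_prop) fun x => (RandomLocal.sz_nat x).symm

theorem PT.sz_bool : PT (fun x : Bool => sz x) :=
  PT.of_eq (f := fun x => if x then 3 else 1) (by fun_prop) fun x => by cases x <;> rfl

theorem PT.sz_decInst {f : γ → DecInst} (hf : PT f) : PT (fun x => sz (f x)) := by
  have h1 : PT (fun x => sz (f x).1) := PT.sz_nat.comp hf.fst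
  have h2 : PT (fun x => sz (f x).2.1) :=
    PT.sz_list hf.snd.fst (PT.sz_list PT.id PT.sz_nat)
  have h3 : PT (fun x => sz (f x).2.2) := PT.sz_list hf.snd.snd PT.sz_bool
  exact PT.of_eq (f := fun x => sz (f x).1 + (sz (f x).2.1 + sz (f x).2.2 + 1) + 1)
    (by fun_prop) fun x => rfl

/-- The test whether a value is a decision instance with locality `d`. -/
def validInst (d : ℕ) (x : DecInst) : Bool :=
  decide (x.2.1.length = x.2.2.length) &&
    x.2.1.all fun e => decide (e.length = d) && e.all fun v => decide (v < x.1)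

theorem enc_mem_decisionInstances {d : ℕ} {x : DecInst} (h : validInst d x = true) :
    enc x ∈ decisionInstances d := by
  obtain ⟨n, E, Y⟩ := x
  simp only [validInst, Bool.and_eq_true, decide_eq_true_eq, List.all_eq_true] at h
  obtain ⟨h1, h2⟩ := h
  obtain ⟨y, hy⟩ := eq_ofFn_of_length (l := Y) h1.symm
  refine ⟨n, E.length, fun i k => ⟨(E[i]).getD k 0, ?_⟩, y, ?_⟩
  · obtain ⟨h3, h4⟩ := h2 E[i] (by simp)
    rw [List.getD_eq_getElem _ _ (by omega)]
    exact h4 _ (by simp)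
  · change Data.cons _ (Data.cons _ _) = Data.cons _ (Data.cons _ _)
    congr 2
    · change Data.ofList (E.map enc) = Data.ofList _
      congr 1
      refine List.ext_getElem (by simp) fun i hi hi' => ?_
      rw [List.getElem_map, List.getElem_ofFn]
      change Data.ofList _ = Data.ofList _
      congr 1
      have h3 := (h2 (E[i]'(by simpa using hi)) (by simp)).1
      refine List.ext_getElem (by simpa using h3) fun j hj hj' => ?_
      rw [List.getElem_map, List.getElem_ofFn]
      simp at hj
      simp [hj]; rfl
    · rw [hy]; exact enc_ofFn_bits y

/-- `accepts`, guarded by a test that the input and the number of coins are as they should be,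
because nothing is known about the running time of `D` otherwise. -/
noncomputable def run (d : ℕ) (D : RandAlg) (x : DecInst) (r : List Bool) : Bool :=
  if validInst d x && decide (r.length = polyBound D.coinExp (sz x)) then accepts D x r else false

theorem PT.run {d : ℕ} {D : RandAlg} (hD : D.IsPolyTimeOn (decisionInstances d))
    {f : γ → DecInst} {r : γ → List Bool} (hf : PT f) (hr : PT r) :
    PT (fun x => run d D (f x) (r x)) := by
  suffices h : PT (fun p : DecInst × List Bool => RandomLocal.run d D p.1 p.2) from
    h.comp (hf.prodMk hr)
  have hs : PT (fun p : DecInst × List Bool => sz p.1) := PT.sz_decInst (by fun_prop)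
  refine PTOn.ite (b := fun p : DecInst × List Bool => validInst d p.1 &&
    decide (p.2.length = polyBound D.coinExp (sz p.1))) ?_ ((PTOn.accepts hD).mono ?_)
    ((PT.const false).on _)
  · unfold validInst polyBound
    fun_prop
  · rintro ⟨x, r⟩ ⟨_, h⟩
    simp only [Bool.and_eq_true, decide_eq_true_eq] at h
    exact ⟨enc_mem_decisionInstances h.1, h.2⟩

end

section
variable {α β γ δ : Type} [Enc α] [Enc β] [Enc γ] [Enc δ]

/-! ### The search algorithm -/

/-- A labelled hyperedge: the list of its vertices, and the output bit. -/
abbrev Sample : Type := List ℕ × Bool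

/-- The relabelling of one vertex. The vertex `w` carries a secret bit, `u` is an independent
uniform vertex used as a source of randomness, `c` and `c'` are coins. The result is a flag that
tells whether the vertex is kept, and its new label. Labels below `i` receive a random vertex of
the window `[t, t + 2 h)`, the label `i` receives `a` or `b`, labels above `i` stay. Each label
arises for exactly `2 h` of the choices of `w`, `u` and the coins, hence the labels of the kept
vertices are uniform. -/
def relabel (t h i a b w u : ℕ) (c c' : Bool) : Bool × ℕ :=
  if c then
    if c' then (decide (u < h) && decide (w = b), i) else (decide (u < h) && decide (w = a), i)
  else
    if c' then (decide (u < 2 * h) && decide (i < w), w)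
    else (decide (t ≤ w) && decide (w < t + 2 * h) && decide (u < i), u)

/-- The relabelling of the first `d` vertices of a hyperedge; it is kept if all of them are. -/
def relabelEdge (t h i a b : ℕ) : ℕ → List ℕ → List ℕ → List Bool → Bool × List ℕ
  | 0, _, _, _ => (true, [])
  | d + 1, S, U, c =>
    ((relabel t h i a b (S.headD 0) (U.headD 0) (c.headD false) (c.tail.headD false)).1 &&
        (relabelEdge t h i a b d S.tail U.tail c.tail.tail).1,
      (relabel t h i a b (S.headD 0) (U.headD 0) (c.headD false) (c.tail.headD false)).2 ::
        (relabelEdge t h i a b d S.tail U.tail c.tail.tail).2)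

/-- The relabelling of a sample; `z` is a pair of samples, of which the second one serves as a
source of random vertices. -/
def relabelSample (d t h i a b : ℕ) (z : List Sample) (c : List Bool) : Bool × Sample :=
  ((relabelEdge t h i a b d (z.headD ([], false)).1 (z.tail.headD ([], false)).1 c).1,
    (relabelEdge t h i a b d (z.headD ([], false)).1 (z.tail.headD ([], false)).1 c).2,
    (z.headD ([], false)).2)

/-- `g` is applied to `k` consecutive blocks, of length `p` in `x` and of length `q` in `y`. -/
def blocks {α β γ : Type} (p q k : ℕ) (g : List α → List β → γ) (x : List α) (y : List β) :
    List γ :=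
  (List.range k).map fun j => g ((x.drop (p * j)).take p) ((y.drop (q * j)).take q)

/-- The relabelled samples that are kept, out of `R` pairs of samples. -/
def keptSamples (d t h i a b R : ℕ) (z : List Sample) (c : List Bool) : List Sample :=
  ((blocks 2 (2 * d) R (relabelSample d t h i a b) z c).filter fun y => y.1).map fun y => y.2

/-- The decision instance with `n` vertices and the given samples. -/
def toInst (n : ℕ) (l : List Sample) : DecInst := (n, l.map (fun y => y.1), l.map (fun y => y.2))

/-- One run of `D`, on the first `m` of the kept samples, with coins from the first `k` ones. -/
noncomputable def groupTest (d : ℕ) (D : RandAlg) (t h i a b n m R k : ℕ) (z : List Sample)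
    (c : List Bool) : Bool :=
  if decide (m ≤ (keptSamples d t h i a b R z (c.drop k)).length) then
    run d D (toInst n ((keptSamples d t h i a b R z (c.drop k)).take m))
      ((c.take k).take (polyBound D.coinExp
        (sz (toInst n ((keptSamples d t h i a b R z (c.drop k)).take m)))))
  else false

/-- The number of runs of `D` with answer "1", among `B` runs on disjoint groups of samples. -/
noncomputable def count (d : ℕ) (D : RandAlg) (t h i a b n m R k B : ℕ) (z : List Sample)
    (c : List Bool) : ℕ :=
  ((blocks (2 * R) (k + 2 * d * R) B (groupTest d D t h i a b n m R k) z c).filter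
    fun y => y).length

/-- A bound for the size of decision instances with `n` vertices and `m` hyperedges. -/
def instBound (d n m : ℕ) : ℕ :=
  (2 * n + 1) + ((m * (d * (2 * n + 2) + 2) + 1) + (m * 4 + 1) + 1) + 1

/-- A number of coins that suffices for a run of `D`. -/
def runCoins (d : ℕ) (D : RandAlg) (n m : ℕ) : ℕ := polyBound D.coinExp (instBound d n m)

/-- The number of pairs of samples in a group. If `n ≤ 2 q h`, then a pair is kept with probability
at least `(4 q)⁻ᵈ`, so that at least `8 m` kept samples are expected. -/
def groupSize (d q m : ℕ) : ℕ := 8 * m * (4 * q) ^ d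

/-- Two counts out of `B` differ significantly. -/
def farApart (d X n N q B x y : ℕ) : Bool :=
  decide (B * (4 * q) ^ d < ((x - y) + (y - x)) * (X * N * n))

/-- The counts for the parameters `q, h, t, i` show that the secret bits of the vertices `0` and
`a` are different. If they are equal, then all three counts have the same mean. If they are
different, then the pair `(0, a)` simulates a coin for `i`, and one of `(0, 0)` and `(a, a)`
simulates the secret bit of `i`. -/
noncomputable def showsDifferent (d : ℕ) (D : RandAlg) (X n m N q h t i a : ℕ)
    (z : List Sample) (c : List Bool) : Bool :=
  farApart d X n N q (z.length / (2 * groupSize d q m))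
    (count d D t h i 0 0 n m (groupSize d q m) (runCoins d D n m)
      (z.length / (2 * groupSize d q m)) z c)
    (count d D t h i 0 a n m (groupSize d q m) (runCoins d D n m)
      (z.length / (2 * groupSize d q m)) z c) ||
  farApart d X n N q (z.length / (2 * groupSize d q m))
    (count d D t h i a a n m (groupSize d q m) (runCoins d D n m)
      (z.length / (2 * groupSize d q m)) z c)
    (count d D t h i 0 a n m (groupSize d q m) (runCoins d D n m)
      (z.length / (2 * groupSize d q m)) z c)

/-- The window `[t, t + 2 h)` consists of vertices, and `q` bounds the ratio between `n` and its
length. -/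
def admissible (n q h t : ℕ) : Bool :=
  decide (1 ≤ h) && decide (t + 2 * h ≤ n) && decide (n ≤ 2 * q * h)

/-- Some counts show that the secret bits of the vertices `0` and `a` are different. -/
noncomputable def different (d : ℕ) (D : RandAlg) (X n m N a : ℕ) (z : List Sample)
    (c : List Bool) : Bool :=
  (List.range (n + 1)).any fun q => (List.range (n + 1)).any fun h =>
    (List.range (n + 1)).any fun t => (List.range n).any fun i =>
      admissible n q h t && showsDifferent d D X n m N q h t i a z c

/-- The search algorithm: the first coin is a guess for the secret bit of vertex `0`. -/
noncomputable def search (d : ℕ) (D : RandAlg) (X n m N : ℕ) (z : List Sample) (c : List Bool) :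
    List Bool :=
  (List.range n).map fun a => xor (c.headD false) (different d D X n m N a z c.tail)

/-- The list of samples of a search instance. -/
def toSamples (E : List (List ℕ)) (Y : List Bool) : List Sample :=
  (List.range E.length).map fun j => (E.getD j [], Y.getD j false)

@[fun_prop]
theorem PT.relabel {t h i a b w u : γ → ℕ} {c c' : γ → Bool} (ht : PT t) (hh : PT h) (hi : PT i)
    (ha : PT a) (hb : PT b) (hw : PT w) (hu : PT u) (hc : PT c) (hc' : PT c') :
    PT (fun x => relabel (t x) (h x) (i x) (a x) (b x) (w x) (u x) (c x) (c' x)) := by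
  unfold RandomLocal.relabel
  fun_prop

@[fun_prop]
theorem PT.relabelEdge (d : ℕ) {t h i a b : γ → ℕ} {S U : γ → List ℕ} {c : γ → List Bool}
    (ht : PT t) (hh : PT h) (hi : PT i) (ha : PT a) (hb : PT b) (hS : PT S) (hU : PT U)
    (hc : PT c) :
    PT (fun x => relabelEdge (t x) (h x) (i x) (a x) (b x) d (S x) (U x) (c x)) := by
  induction d generalizing S U c with
  | zero => exact PT.const _
  | succ d ih =>
    have := ih hS.list_tail hU.list_tail hc.list_tail.list_tail
    simp only [RandomLocal.relabelEdge]
    exact ((PT.relabel ht hh hi ha hb (by fun_prop) (by fun_prop) (by fun_prop)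
      (by fun_prop)).fst.and this.fst).prodMk (PT.list_cons (PT.relabel ht hh hi ha hb
        (by fun_prop) (by fun_prop) (by fun_prop) (by fun_prop)).snd this.snd)

@[fun_prop]
theorem PT.blocks {p q k : γ → ℕ} {g : γ → List α → List β → δ} {x : γ → List α}
    {y : γ → List β} (hp : PT p) (hq : PT q) (hk : PT k)
    (hg : PT (fun r : γ × List α × List β => g r.1 r.2.1 r.2.2)) (hx : PT x) (hy : PT y) :
    PT (fun s => blocks (p s) (q s) (k s) (g s) (x s) (y s)) := by
  unfold RandomLocal.blocks
  refine PT.map (by fun_prop) (hg.comp (f := fun r : γ × ℕ => (r.1,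
    ((x r.1).drop (p r.1 * r.2)).take (p r.1), ((y r.1).drop (q r.1 * r.2)).take (q r.1))) ?_)
  fun_prop

@[fun_prop]
theorem PT.relabelSample (d : ℕ) {t h i a b : γ → ℕ} {z : γ → List Sample} {c : γ → List Bool}
    (ht : PT t) (hh : PT h) (hi : PT i) (ha : PT a) (hb : PT b) (hz : PT z) (hc : PT c) :
    PT (fun x => relabelSample d (t x) (h x) (i x) (a x) (b x) (z x) (c x)) := by
  unfold RandomLocal.relabelSample
  fun_prop

@[fun_prop]
theorem PT.keptSamples (d : ℕ) {t h i a b R : γ → ℕ} {z : γ → List Sample} {c : γ → List Bool}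
    (ht : PT t) (hh : PT h) (hi : PT i) (ha : PT a) (hb : PT b) (hR : PT R) (hz : PT z)
    (hc : PT c) :
    PT (fun x => keptSamples d (t x) (h x) (i x) (a x) (b x) (R x) (z x) (c x)) := by
  unfold RandomLocal.keptSamples
  fun_prop

@[fun_prop]
theorem PT.toInst {n : γ → ℕ} {l : γ → List Sample} (hn : PT n) (hl : PT l) :
    PT (fun x => toInst (n x) (l x)) := by
  unfold RandomLocal.toInst
  fun_prop

@[fun_prop]
theorem PT.polyBound (e : ℕ) {f : γ → ℕ} (hf : PT f) : PT (fun x => polyBound e (f x)) := by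
  unfold RandomLocal.polyBound
  fun_prop

@[fun_prop]
theorem PT.farApart (d X : ℕ) {n N q B x y : γ → ℕ} (hn : PT n) (hN : PT N) (hq : PT q)
    (hB : PT B) (hx : PT x) (hy : PT y) :
    PT (fun s => farApart d X (n s) (N s) (q s) (B s) (x s) (y s)) := by
  unfold RandomLocal.farApart
  fun_prop

section
variable {d : ℕ} {D : RandAlg} (hD : D.IsPolyTimeOn (decisionInstances d))
include hD

theorem PT.groupTest {t h i a b n m R k : γ → ℕ} {z : γ → List Sample} {c : γ → List Bool}
    (ht : PT t) (hh : PT h) (hi : PT i) (ha : PT a) (hb : PT b) (hn : PT n) (hm : PT m)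
    (hR : PT R) (hk : PT k) (hz : PT z) (hc : PT c) :
    PT (fun x => groupTest d D (t x) (h x) (i x) (a x) (b x) (n x) (m x) (R x) (k x) (z x)
      (c x)) := by
  unfold RandomLocal.groupTest
  refine PT.ite (by fun_prop) (PT.run hD (by fun_prop) ?_) (by fun_prop)
  have := PT.sz_decInst (f := fun x => RandomLocal.toInst (n x) ((RandomLocal.keptSamples d (t x)
    (h x) (i x) (a x) (b x) (R x) (z x) ((c x).drop (k x))).take (m x))) (by fun_prop)
  fun_prop

theorem PT.count {t h i a b n m R k B : γ → ℕ} {z : γ → List Sample} {c : γ → List Bool}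
    (ht : PT t) (hh : PT h) (hi : PT i) (ha : PT a) (hb : PT b) (hn : PT n) (hm : PT m)
    (hR : PT R) (hk : PT k) (hB : PT B) (hz : PT z) (hc : PT c) :
    PT (fun x => count d D (t x) (h x) (i x) (a x) (b x) (n x) (m x) (R x) (k x) (B x) (z x)
      (c x)) := by
  unfold RandomLocal.count
  have := PT.groupTest hD (ht.comp PT.fst') (hh.comp PT.fst') (hi.comp PT.fst') (ha.comp PT.fst')
    (hb.comp PT.fst') (hn.comp PT.fst') (hm.comp PT.fst') (hR.comp PT.fst') (hk.comp PT.fst')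
    (z := fun r : γ × List Sample × List Bool => r.2.1) (c := fun r => r.2.2)
    (by fun_prop) (by fun_prop)
  exact (PT.filter (PT.blocks (by fun_prop) (by fun_prop) hB this hz hc) (by fun_prop)).length

theorem PT.showsDifferent (X : ℕ) {n m N q h t i a : γ → ℕ} {z : γ → List Sample}
    {c : γ → List Bool} (hn : PT n) (hm : PT m) (hN : PT N) (hq : PT q) (hh : PT h) (ht : PT t)
    (hi : PT i) (ha : PT a) (hz : PT z) (hc : PT c) :
    PT (fun x => showsDifferent d D X (n x) (m x) (N x) (q x) (h x) (t x) (i x) (a x) (z x)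
      (c x)) := by
  have hR : PT (fun x => groupSize d (q x) (m x)) := by unfold groupSize; fun_prop
  have hk : PT (fun x => runCoins d D (n x) (m x)) := by unfold runCoins instBound; fun_prop
  have hB : PT (fun x => (z x).length / (2 * groupSize d (q x) (m x))) := by fun_prop
  have h0 : PT (fun _ : γ => 0) := by fun_prop
  unfold RandomLocal.showsDifferent
  have c1 := PT.count hD ht hh hi h0 h0 hn hm hR hk hB hz hc
  have c2 := PT.count hD ht hh hi h0 ha hn hm hR hk hB hz hc
  have c3 := PT.count hD ht hh hi ha ha hn hm hR hk hB hz hc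
  exact (PT.farApart d X hn hN hq hB c1 c2).or (PT.farApart d X hn hN hq hB c3 c2)

theorem PT.different (X : ℕ) {n m N a : γ → ℕ} {z : γ → List Sample}
    {c : γ → List Bool} (hn : PT n) (hm : PT m) (hN : PT N) (ha : PT a) (hz : PT z) (hc : PT c) :
    PT (fun x => different d D X (n x) (m x) (N x) (a x) (z x) (c x)) := by
  have hp : PT (fun r : (((γ × ℕ) × ℕ) × ℕ) × ℕ => r.1.1.1.1) := by fun_prop
  have := PT.showsDifferent hD X (hn.comp hp) (hm.comp hp) (hN.comp hp) (q := fun r => r.1.1.1.2)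
    (h := fun r => r.1.1.2) (t := fun r => r.1.2) (i := fun r => r.2) (by fun_prop) (by fun_prop)
    (by fun_prop) (by fun_prop) (ha.comp hp) (hz.comp hp) (hc.comp hp)
  unfold RandomLocal.different RandomLocal.admissible
  fun_prop

theorem PT.search (X : ℕ) {n m N : γ → ℕ} {z : γ → List Sample}
    {c : γ → List Bool} (hn : PT n) (hm : PT m) (hN : PT N) (hz : PT z) (hc : PT c) :
    PT (fun x => search d D X (n x) (m x) (N x) (z x) (c x)) := by
  unfold RandomLocal.search
  have := PT.different hD X (hn.comp (PT.fst' (β := ℕ))) (hm.comp PT.fst') (hN.comp PT.fst')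
    PT.snd' (hz.comp PT.fst') (hc.list_tail.comp PT.fst')
  fun_prop

end

@[fun_prop]
theorem PT.toSamples {E : γ → List (List ℕ)} {Y : γ → List Bool} (hE : PT E) (hY : PT Y) :
    PT (fun x => toSamples (E x) (Y x)) := by
  unfold RandomLocal.toSamples
  fun_prop

/-- Search instances as typed values. -/
abbrev SearchInst : Type := ℕ × ℕ × ℕ × List (List ℕ) × List Bool

theorem encodeGraph_eq {n m d : ℕ} (G : Hypergraph n m d) :
    encodeGraph G = enc (List.ofFn (fun i => List.ofFn fun k => (G i k : ℕ))) := by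
  change Data.ofList _ = Data.ofList _
  rw [List.map_ofFn]
  congr 2
  funext i
  change Data.ofList _ = Data.ofList _
  rw [List.map_ofFn]
  rfl

theorem enc_searchInput {n M d : ℕ} (m N : ℕ) (G : Hypergraph n M d) (y : Fin M → Bool) :
    searchInput m N G y =
      enc (n, m, N, List.ofFn (fun i => List.ofFn fun k => (G i k : ℕ)), List.ofFn y) := by
  change Data.cons _ (Data.cons _ (Data.cons _ (Data.cons _ _))) = Data.cons _ (Data.cons _
    (Data.cons _ (Data.cons _ _)))
  rw [encodeGraph_eq, ← enc_ofFn_bits]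
  rfl

/-- A polynomial-time function of the input and the coins is computed by a randomized algorithm,
for every choice of the number of coins. -/
theorem exists_randAlg {f : SearchInst × List Bool → List Bool} (hf : PT f) (e : ℕ) :
    ∃ A : RandAlg, A.coinExp = e ∧ (∀ d, A.IsPolyTimeOn (searchInstances d)) ∧
      ∀ (x : SearchInst) (r : Fin (A.numCoins (enc x)) → Bool) (v : Data),
        A.Outputs (enc x) r v ↔ enc (f (x, List.ofFn r)) = v := by
  obtain ⟨c, k, P, hk, h⟩ := hf
  have key : ∀ (x : SearchInst) (r : List Bool), ∃ τ : Store,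
      Runs (.seq (.setCons 0 0 1) c) (initStore (enc x) (enc r)) (P.eval (sz (x, r)) + 2) τ ∧
        τ 0 = enc (f (x, r)) := by
    intro x r
    obtain ⟨τ, h1, h2, _⟩ := (h (x, r) trivial).2 (Function.update (initStore (enc x) (enc r)) 0
      (.cons (initStore (enc x) (enc r) 0) (initStore (enc x) (enc r) 1)))
      (by rw [Function.update_self]; rfl)
    exact ⟨τ, ((Exec.setCons _ 0 0 1).runs.seq h1).mono (by omega), h2⟩
  refine ⟨⟨.seq (.setCons 0 0 1) c, e⟩, rfl, fun d => ?_, fun x r v => ?_⟩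
  · obtain ⟨a, ha⟩ := exists_eval_le_polyBound
      (P.comp (X + (polyBoundPoly e * 4 + 1) + 1) + 2)
    refine ⟨a, ?_⟩
    rintro _ ⟨n, m, N, M, G, y, rfl⟩
    rw [enc_searchInput]
    generalize (n, m, N, List.ofFn (fun i => List.ofFn fun k => (G i k : ℕ)), List.ofFn y) =
      x
    intro r
    obtain ⟨τ, ⟨t, ht, hr⟩, _⟩ := key x (List.ofFn r)
    rw [enc_ofFn_bits] at hr
    refine ⟨t, ht.trans (le_trans ?_ (ha _)), τ, hr⟩
    simp only [eval_add, eval_comp, eval_X, eval_mul, eval_polyBoundPoly, eval_ofNat, eval_one]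
    gcongr ?_ + 2
    refine eval_mono _ ?_
    rw [sz_pair]
    have : sz (List.ofFn r) ≤ _ := sz_le_of_forall_le fun a _ => sz_bool_le a
    rw [List.length_ofFn] at this
    change sz (List.ofFn r) ≤ polyBound e (enc x).size * (3 + 1) + 1 at this
    unfold sz at this ⊢
    omega
  · obtain ⟨τ, ⟨t, ht, hr⟩, h2⟩ := key x (List.ofFn r)
    rw [← h2]
    rw [enc_ofFn_bits] at hr
    exact ⟨fun ⟨t', σ, h, h'⟩ => (hr.deterministic h).2 ▸ h', fun h' => ⟨t, τ, hr, h'⟩⟩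

end

/-! ### Finite distributions -/

/-- Probability distributions given by finitely many weighted outcomes (which may coincide). -/
structure FinDist (α : Type) : Type 1 where
  /-- The index type of the outcomes. -/
  idx : Type
  [fin : Fintype idx]
  /-- The weights. -/
  w : idx → ℝ
  /-- The outcomes. -/
  out : idx → α
  nonneg : ∀ i, 0 ≤ w i
  sum_eq_one : ∑ i, w i = 1

attribute [instance] FinDist.fin

namespace FinDist
variable {α β γ : Type}

/-- The expectation of `φ`. -/
noncomputable def E (μ : FinDist α) (φ : α → ℝ) : ℝ := ∑ i, μ.w i * φ (μ.out i)

/-- All outcomes satisfy `p`. -/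
def Supp (μ : FinDist α) (p : α → Prop) : Prop := ∀ i, p (μ.out i)

theorem E_add (μ : FinDist α) (φ ψ : α → ℝ) : μ.E (fun x => φ x + ψ x) = μ.E φ + μ.E ψ := by
  simp [E, mul_add, Finset.sum_add_distrib]

theorem E_sub (μ : FinDist α) (φ ψ : α → ℝ) : μ.E (fun x => φ x - ψ x) = μ.E φ - μ.E ψ := by
  simp [E, mul_sub, Finset.sum_sub_distrib]

theorem E_const_mul (μ : FinDist α) (c : ℝ) (φ : α → ℝ) :
    μ.E (fun x => c * φ x) = c * μ.E φ := by
  simp only [E, Finset.mul_sum]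
  exact Finset.sum_congr rfl fun i _ => by ring

theorem E_const (μ : FinDist α) (c : ℝ) : μ.E (fun _ => c) = c := by
  simp [E, ← Finset.sum_mul, μ.sum_eq_one]

theorem E_congr {μ : FinDist α} {p : α → Prop} (hp : μ.Supp p) {φ ψ : α → ℝ}
    (h : ∀ x, p x → φ x = ψ x) : μ.E φ = μ.E ψ :=
  Finset.sum_congr rfl fun i _ => by rw [h _ (hp i)]

theorem E_mono_of_supp {μ : FinDist α} {p : α → Prop} (hp : μ.Supp p) {φ ψ : α → ℝ}
    (h : ∀ x, p x → φ x ≤ ψ x) : μ.E φ ≤ μ.E ψ :=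
  Finset.sum_le_sum fun i _ => mul_le_mul_of_nonneg_left (h _ (hp i)) (μ.nonneg i)

theorem E_mono (μ : FinDist α) {φ ψ : α → ℝ} (h : ∀ x, φ x ≤ ψ x) : μ.E φ ≤ μ.E ψ :=
  Finset.sum_le_sum fun i _ => mul_le_mul_of_nonneg_left (h _) (μ.nonneg i)

theorem E_nonneg (μ : FinDist α) {φ : α → ℝ} (h : ∀ x, 0 ≤ φ x) : 0 ≤ μ.E φ :=
  Finset.sum_nonneg fun i _ => mul_nonneg (μ.nonneg i) (h _)

theorem E_le_one (μ : FinDist α) {φ : α → ℝ} (h : ∀ x, φ x ≤ 1) : μ.E φ ≤ 1 :=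
  (μ.E_mono h).trans (μ.E_const 1).le

theorem E_sum {ι : Type} (μ : FinDist α) (s : Finset ι) (φ : ι → α → ℝ) :
    μ.E (fun x => ∑ i ∈ s, φ i x) = ∑ i ∈ s, μ.E (φ i) := by
  simp only [E, Finset.mul_sum]
  exact Finset.sum_comm

theorem E_comm (μ : FinDist α) (ν : FinDist β) (φ : α → β → ℝ) :
    μ.E (fun x => ν.E (φ x)) = ν.E (fun y => μ.E (fun x => φ x y)) := by
  simp only [E, Finset.mul_sum]
  rw [Finset.sum_comm]
  exact Finset.sum_congr rfl fun i _ => Finset.sum_congr rfl fun j _ => by ring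

/-- The distribution with one outcome. -/
def pure (x : α) : FinDist α := ⟨Unit, fun _ => 1, fun _ => x, fun _ => zero_le_one, by simp⟩

theorem E_pure (x : α) (φ : α → ℝ) : (pure x).E φ = φ x := by
  change ∑ _ : Unit, (1 : ℝ) * φ x = φ x
  simp

/-- Two-step experiments. -/
def bind (μ : FinDist α) (g : α → FinDist β) : FinDist β where
  idx := Σ i : μ.idx, (g (μ.out i)).idx
  w i := μ.w i.1 * (g (μ.out i.1)).w i.2
  out i := (g (μ.out i.1)).out i.2
  nonneg i := mul_nonneg (μ.nonneg _) ((g _).nonneg _)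
  sum_eq_one := by
    rw [Fintype.sum_sigma]
    simp [← Finset.mul_sum, sum_eq_one]

theorem E_bind (μ : FinDist α) (g : α → FinDist β) (φ : β → ℝ) :
    (μ.bind g).E φ = μ.E fun x => (g x).E φ := by
  unfold E
  rw [show (∑ i, (μ.bind g).w i * φ ((μ.bind g).out i)) =
    ∑ i : (Σ i : μ.idx, (g (μ.out i)).idx), (μ.w i.1 * (g (μ.out i.1)).w i.2) *
      φ ((g (μ.out i.1)).out i.2) from rfl, Fintype.sum_sigma]
  simp only [Finset.mul_sum, mul_assoc]

/-- The distribution of a function of the outcome. -/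
def map (f : α → β) (μ : FinDist α) : FinDist β :=
  ⟨μ.idx, μ.w, fun i => f (μ.out i), μ.nonneg, μ.sum_eq_one⟩

theorem E_map (f : α → β) (μ : FinDist α) (φ : β → ℝ) :
    (μ.map f).E φ = μ.E fun x => φ (f x) := rfl

theorem Supp.bind {μ : FinDist α} {g : α → FinDist β} {p : α → Prop} {q : β → Prop}
    (hμ : μ.Supp p) (hg : ∀ x, p x → (g x).Supp q) : (μ.bind g).Supp q :=
  fun i => hg _ (hμ i.1) i.2

theorem Supp.map {μ : FinDist α} {f : α → β} {p : α → Prop} {q : β → Prop}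
    (hμ : μ.Supp p) (hf : ∀ x, p x → q (f x)) : (μ.map f).Supp q :=
  fun i => hf _ (hμ i)

/-- `k` independent outcomes. -/
def iid (μ : FinDist α) : ℕ → FinDist (List α)
  | 0 => pure []
  | k + 1 => μ.bind fun x => (iid μ k).map fun l => x :: l

theorem E_iid_zero (μ : FinDist α) (φ : List α → ℝ) : (μ.iid 0).E φ = φ [] := E_pure _ _

theorem E_iid_succ (μ : FinDist α) (k : ℕ) (φ : List α → ℝ) :
    (μ.iid (k + 1)).E φ = μ.E fun x => (μ.iid k).E fun l => φ (x :: l) := by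
  rw [iid, E_bind]; rfl

theorem E_iid_one (μ : FinDist α) (φ : List α → ℝ) : (μ.iid 1).E φ = μ.E fun x => φ [x] := by
  rw [E_iid_succ]; simp only [E_iid_zero]

theorem E_iid_add (μ : FinDist α) (j k : ℕ) (φ : List α → ℝ) :
    (μ.iid (j + k)).E φ = (μ.iid j).E fun l => (μ.iid k).E fun l' => φ (l ++ l') := by
  induction j generalizing φ with
  | zero => rw [E_iid_zero, Nat.zero_add]; rfl
  | succ j ih =>
    rw [show j + 1 + k = j + k + 1 by omega, E_iid_succ, E_iid_succ]
    congr 1; funext x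
    exact ih _

theorem supp_iid {μ : FinDist α} {p : α → Prop} (hμ : μ.Supp p) (k : ℕ) :
    (μ.iid k).Supp fun l => l.length = k ∧ ∀ x ∈ l, p x := by
  induction k with
  | zero => exact fun _ => ⟨rfl, by simp [iid, pure]⟩
  | succ k ih =>
    refine Supp.bind hμ fun x hx => Supp.map ih fun l ⟨h1, h2⟩ => ⟨by simp [h1], ?_⟩
    intro y hy
    rcases List.mem_cons.1 hy with rfl | hy
    · exact hx
    · exact h2 y hy

theorem supp_true (μ : FinDist α) : μ.Supp fun _ => True := fun _ => trivial

theorem length_iid (μ : FinDist α) (k : ℕ) : (μ.iid k).Supp fun l => l.length = k :=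
  fun i => (supp_iid μ.supp_true k i).1

theorem iid_E_congr {μ ν : FinDist α} (h : ∀ φ, μ.E φ = ν.E φ) (k : ℕ) (φ : List α → ℝ) :
    (μ.iid k).E φ = (ν.iid k).E φ := by
  induction k generalizing φ with
  | zero => rw [E_iid_zero, E_iid_zero]
  | succ k ih =>
    rw [E_iid_succ, E_iid_succ, h]
    congr 1; funext x
    exact ih _

theorem E_iid_map (μ : FinDist α) (f : α → β) (k : ℕ) (φ : List β → ℝ) :
    ((μ.map f).iid k).E φ = (μ.iid k).E fun l => φ (l.map f) := by
  induction k generalizing φ with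
  | zero => rw [E_iid_zero, E_iid_zero]; rfl
  | succ k ih =>
    rw [E_iid_succ, E_iid_succ, E_map]
    congr 1; funext x
    exact ih _

/-- A function that looks only at the first `k` outcomes. -/
theorem E_iid_take (μ : FinDist α) {k j : ℕ} (h : k ≤ j) (φ : List α → ℝ) :
    (μ.iid j).E (fun l => φ (l.take k)) = (μ.iid k).E φ := by
  obtain ⟨i, rfl⟩ := Nat.exists_eq_add_of_le h
  rw [E_iid_add]
  refine E_congr (μ.length_iid k) fun l hl => ?_
  subst hl
  simp [E_const]

/-- The uniform distribution on a type. -/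
noncomputable def unif (α : Type) [Fintype α] [Nonempty α] : FinDist α where
  idx := α
  w _ := (Fintype.card α : ℝ)⁻¹
  out := fun x => x
  nonneg _ := by positivity
  sum_eq_one := by simp

theorem E_unif [Fintype α] [Nonempty α] (φ : α → ℝ) : (unif α).E φ = 𝔼 x, φ x := by
  rw [Fintype.expect_eq_sum_div_card, div_eq_inv_mul, Finset.mul_sum]; rfl

/-- The uniform distribution on vectors is the distribution of independent entries. -/
theorem E_iid_unif [Fintype α] [Nonempty α] (k : ℕ) (φ : List α → ℝ) :
    ((unif α).iid k).E φ = 𝔼 f : Fin k → α, φ (List.ofFn f) := by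
  induction k generalizing φ with
  | zero => rw [E_iid_zero]; simp
  | succ k ih =>
    rw [E_iid_succ, E_unif]
    simp only [ih]
    rw [← Finset.expect_product' (s := Finset.univ) (t := Finset.univ)
      (f := fun (x : α) (f : Fin k → α) => φ (x :: List.ofFn f))]
    refine Fintype.expect_equiv (Fin.consEquiv fun _ => α) _ _ fun p => ?_
    simp [Fin.consEquiv, List.ofFn_succ]

/-- `Bern(p)`. -/
def bern (p : ℝ) (h0 : 0 ≤ p) (h1 : p ≤ 1) : FinDist Bool where
  idx := Bool
  w b := if b then p else 1 - p
  out := fun b => b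
  nonneg b := by cases b <;> simp [h0, h1]
  sum_eq_one := by simp

theorem E_bern (p : ℝ) (h0 : 0 ≤ p) (h1 : p ≤ 1) (φ : Bool → ℝ) :
    (bern p h0 h1).E φ = p * φ true + (1 - p) * φ false := by
  change ∑ b : Bool, (if b then p else 1 - p) * φ b = _
  simp

/-- A fair coin. -/
noncomputable def coin : FinDist Bool := unif Bool

theorem E_coin (φ : Bool → ℝ) : coin.E φ = (φ true + φ false) / 2 := by
  rw [coin, E_unif, Fintype.expect_eq_sum_div_card]; simp

/-- The distribution of a block of a function of `p` outcomes of `μ` and `q` outcomes of `ν`. -/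
def blockDist (μ : FinDist α) (ν : FinDist β) (p q : ℕ) (g : List α → List β → γ) : FinDist γ :=
  (μ.iid p).bind fun a => (ν.iid q).map fun b => g a b

theorem E_blockDist (μ : FinDist α) (ν : FinDist β) (p q : ℕ) (g : List α → List β → γ)
    (φ : γ → ℝ) : (blockDist μ ν p q g).E φ =
      (μ.iid p).E fun a => (ν.iid q).E fun b => φ (g a b) := E_bind _ _ _

theorem blocks_succ (p q k : ℕ) (g : List α → List β → γ) (a x : List α) (b y : List β)
    (ha : a.length = p) (hb : b.length = q) :
    blocks p q (k + 1) g (a ++ x) (b ++ y) = g a b :: blocks p q k g x y := by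
  subst ha hb
  unfold blocks
  rw [List.range_succ_eq_map, List.map_cons, List.map_map]
  congr 1
  · simp
  · refine List.map_congr_left fun j _ => ?_
    simp [Nat.mul_add, Nat.add_comm, ← List.drop_drop]

/-- Functions of disjoint blocks are independent. -/
theorem E_blocks (μ : FinDist α) (ν : FinDist β) (p q k e e' : ℕ) (g : List α → List β → γ)
    (φ : List γ → ℝ) :
    (μ.iid (p * k + e)).E (fun x => (ν.iid (q * k + e')).E fun y => φ (blocks p q k g x y)) =
      ((blockDist μ ν p q g).iid k).E φ := by
  induction k generalizing φ with
  | zero => simp [blocks, E_const, E_iid_zero]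
  | succ k ih =>
    rw [show p * (k + 1) + e = p + (p * k + e) by ring,
      show q * (k + 1) + e' = q + (q * k + e') by ring, E_iid_add μ p, E_iid_succ, E_blockDist]
    refine E_congr (μ.length_iid p) fun a ha => ?_
    simp only [E_iid_add ν q]
    rw [E_comm]
    refine E_congr (ν.length_iid q) fun b hb => ?_
    simp only [blocks_succ p q k g a _ b _ ha hb]
    exact ih fun l => φ (g a b :: l)

/-- The probability that at least `m` out of `R` independent trials with success probability `a`
succeed. -/
def passProb (a : ℝ) : ℕ → ℕ → ℝ
  | _, 0 => 1
  | 0, _ + 1 => 0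
  | R + 1, m + 1 => (1 - a) * passProb a R (m + 1) + a * passProb a R m

/-- Exponential Markov inequality for the number of successes. -/
theorem one_sub_passProb_le {a : ℝ} (h0 : 0 ≤ a) (h1 : a ≤ 1) (R m : ℕ) :
    1 - passProb a R m ≤ 2 ^ m * (1 - a / 2) ^ R := by
  induction R generalizing m with
  | zero =>
    cases m with
    | zero => simp [passProb]
    | succ m => simp [passProb]; exact one_le_pow₀ (by norm_num)
  | succ R ih =>
    cases m with
    | zero => simp [passProb]; exact pow_nonneg (by linarith) _
    | succ m =>
      have i1 := mul_le_mul_of_nonneg_left (ih (m + 1)) (sub_nonneg.2 h1)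
      have i2 := mul_le_mul_of_nonneg_left (ih m) h0
      rw [passProb]
      calc _ = (1 - a) * (1 - passProb a R (m + 1)) + a * (1 - passProb a R m) := by ring
        _ ≤ _ := add_le_add i1 i2
        _ = _ := by ring

theorem half_le_passProb {a : ℝ} (h0 : 0 ≤ a) (h1 : a ≤ 1) {R m : ℕ} (hm : 1 ≤ m)
    (h : 8 * m ≤ a * R) : 1 / 2 ≤ passProb a R m := by
  have h2 := one_sub_passProb_le h0 h1 R m
  have h3 : (1 - a / 2) ^ R ≤ Real.exp (-4) ^ m := by
    calc (1 - a / 2) ^ R ≤ Real.exp (-(a / 2)) ^ R :=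
          pow_le_pow_left₀ (by linarith) (Real.one_sub_le_exp_neg _) _
      _ = Real.exp (-(a * R) / 2) := by rw [← Real.exp_nat_mul]; ring_nf
      _ ≤ Real.exp (m * (-4)) := Real.exp_le_exp.2 (by linarith)
      _ = _ := by rw [Real.exp_nat_mul]
  have h4 : Real.exp (-4) ≤ 1 / 4 := by
    have h5 : (4 : ℝ) ≤ Real.exp 4 := by have := Real.add_one_le_exp (4 : ℝ); linarith
    rw [Real.exp_neg, inv_eq_one_div]
    exact one_div_le_one_div_of_le (by norm_num) h5
  have h6 : (2 : ℝ) ^ m * Real.exp (-4) ^ m ≤ 1 / 2 := by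
    rw [← mul_pow]
    have h7 : 2 * Real.exp (-4) ≤ 1 / 2 := by linarith
    have h8 : 0 ≤ 2 * Real.exp (-4) := by positivity
    calc (2 * Real.exp (-4)) ^ m ≤ (1 / 2) ^ m := pow_le_pow_left₀ h8 h7 m
      _ ≤ (1 / 2) ^ 1 := pow_le_pow_of_le_one (by norm_num) (by norm_num) hm
      _ = 1 / 2 := by norm_num
  have h9 : (2 : ℝ) ^ m * (1 - a / 2) ^ R ≤ 2 ^ m * Real.exp (-4) ^ m :=
    mul_le_mul_of_nonneg_left h3 (by positivity)
  linarith

/-- Rejection sampling: if the kept outcomes of `κ` are distributed like `ν`, then the first `m`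
kept outcomes out of `R` are independent samples of `ν`. -/
theorem E_filter_take (κ : FinDist (Bool × β)) (ν : FinDist β) (a : ℝ)
    (h : ∀ φ : β → ℝ, κ.E (fun r => if r.1 then φ r.2 else 0) = a * ν.E φ) (R m : ℕ)
    (φ : List β → ℝ) :
    (κ.iid R).E (fun l => if m ≤ ((l.filter fun y => y.1).map fun y => y.2).length then
        φ (((l.filter fun y => y.1).map fun y => y.2).take m) else 0) =
      passProb a R m * (ν.iid m).E φ := by
  induction R generalizing m φ with
  | zero => cases m <;> simp [E_iid_zero, passProb]
  | succ R ih =>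
    cases m with
    | zero => simp [passProb, E_iid_zero, E_const]
    | succ m =>
      rw [E_iid_succ]
      set c := (κ.iid R).E (fun l =>
        if m + 1 ≤ ((l.filter fun y => y.1).map fun y => y.2).length then
          φ (((l.filter fun y => y.1).map fun y => y.2).take (m + 1)) else 0) with hc
      have key : ∀ r : Bool × β, ((κ.iid R).E fun l =>
          if m + 1 ≤ (((r :: l).filter fun y => y.1).map fun y => y.2).length then
            φ ((((r :: l).filter fun y => y.1).map fun y => y.2).take (m + 1)) else 0) =
          (if r.1 then passProb a R m * (ν.iid m).E (fun l => φ (r.2 :: l)) else 0) +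
            (c - if r.1 then c else 0) := by
        rintro ⟨b, z⟩
        cases b with
        | false => simp [hc]
        | true =>
          simp only [List.filter_cons, if_true, List.map_cons, List.length_cons,
            Nat.add_le_add_iff_right, List.take_succ_cons, sub_self, add_zero]
          exact ih m fun l => φ (z :: l)
      simp only [key]
      rw [E_add, E_sub, E_const, h (fun _ => c), E_const,
        h fun z => passProb a R m * (ν.iid m).E fun l => φ (z :: l), E_const_mul, hc, ih,
        passProb, E_iid_succ]
      ring

/-! ### Chernoff bound -/

theorem exp_le_one_add_add_sq {x : ℝ} (h : |x| ≤ 1) : Real.exp x ≤ 1 + x + x ^ 2 := by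
  have := Real.abs_exp_sub_one_sub_id_le h
  linarith [le_abs_self (Real.exp x - 1 - x)]

theorem E_exp_le (κ : FinDist Bool) {p t : ℝ} (hp : p = κ.E fun b => if b then 1 else 0)
    (ht : |t| ≤ 1) :
    κ.E (fun b => Real.exp (t * ((if b then 1 else 0) - p))) ≤ Real.exp (t ^ 2) := by
  have p0 : 0 ≤ p := hp ▸ κ.E_nonneg fun b => by split <;> norm_num
  have p1 : p ≤ 1 := hp ▸ κ.E_le_one fun b => by split <;> norm_num
  have h : ∀ b : Bool, Real.exp (t * ((if b then 1 else 0) - p)) ≤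
      (1 + t ^ 2) + t * ((if b then 1 else 0) - p) := by
    intro b
    have hb : |(if b then (1 : ℝ) else 0) - p| ≤ 1 := by
      rw [abs_le]; split <;> constructor <;> linarith
    have hx : |t * ((if b then 1 else 0) - p)| ≤ 1 := by
      rw [abs_mul]; exact mul_le_one₀ ht (abs_nonneg _) hb
    have h1 := exp_le_one_add_add_sq hx
    have h2 : (t * ((if b then 1 else 0) - p)) ^ 2 ≤ t ^ 2 := by
      rw [mul_pow]
      have : ((if b then (1 : ℝ) else 0) - p) ^ 2 ≤ 1 := by
        rw [sq_le_one_iff_abs_le_one]; exact hb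
      nlinarith [sq_nonneg t]
    linarith
  refine (κ.E_mono h).trans ?_
  rw [E_add, E_const, E_const_mul, E_sub, E_const, ← hp, sub_self, mul_zero, add_zero, add_comm]
  exact Real.add_one_le_exp _

theorem E_iid_exp_le (κ : FinDist Bool) {p t : ℝ} (hp : p = κ.E fun b => if b then 1 else 0)
    (ht : |t| ≤ 1) (B : ℕ) :
    (κ.iid B).E (fun l => Real.exp (t * ((l.filter fun y => y).length - B * p))) ≤
      Real.exp (B * t ^ 2) := by
  induction B with
  | zero => rw [E_iid_zero]; simp
  | succ B ih =>
    rw [E_iid_succ]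
    have key : ∀ b : Bool, ((κ.iid B).E fun l =>
        Real.exp (t * (((b :: l).filter fun y => y).length - (B + 1 : ℕ) * p))) =
        ((κ.iid B).E fun l => Real.exp (t * ((l.filter fun y => y).length - B * p))) *
          Real.exp (t * ((if b then 1 else 0) - p)) := by
      intro b
      rw [mul_comm ((κ.iid B).E _) (Real.exp _), ← E_const_mul]
      congr 1; funext l
      rw [← Real.exp_add]
      congr 1
      cases b <;> simp <;> ring
    simp only [key]
    rw [E_const_mul]
    calc _ ≤ Real.exp (B * t ^ 2) * Real.exp (t ^ 2) :=
          mul_le_mul ih (E_exp_le κ hp ht) (κ.E_nonneg fun _ => (Real.exp_pos _).le)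
            (Real.exp_pos _).le
      _ = _ := by rw [← Real.exp_add]; push_cast; ring_nf

open Classical in
/-- Two-sided Chernoff bound. For `θ > 2` the deviation is impossible. -/
theorem chernoff (κ : FinDist Bool) {p θ : ℝ} (hp : p = κ.E fun b => if b then 1 else 0)
    (hθ : 0 ≤ θ) (B : ℕ) :
    (κ.iid B).E (fun l => if B * θ < |((l.filter fun y => y).length : ℝ) - B * p| then 1 else 0) ≤
      2 * Real.exp (-(B * θ ^ 2 / 4)) := by
  have p0 : 0 ≤ p := hp ▸ κ.E_nonneg fun b => by split <;> norm_num
  have p1 : p ≤ 1 := hp ▸ κ.E_le_one fun b => by split <;> norm_num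
  have hB : (0 : ℝ) ≤ B := Nat.cast_nonneg B
  rcases le_or_gt θ 2 with h2 | h2
  · have ht : |θ / 2| ≤ 1 := by rw [abs_of_nonneg (by linarith)]; linarith
    have ht' : |-(θ / 2)| ≤ 1 := by rwa [abs_neg]
    have hle : ∀ l : List Bool,
        (if B * θ < |((l.filter fun y => y).length : ℝ) - B * p| then (1 : ℝ) else 0) ≤
        Real.exp (-(B * θ ^ 2 / 2)) *
          (Real.exp (θ / 2 * ((l.filter fun y => y).length - B * p)) +
          Real.exp (-(θ / 2) * ((l.filter fun y => y).length - B * p))) := by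
      intro l
      split_ifs with h
      · rw [mul_add, ← Real.exp_add, ← Real.exp_add]
        rcases lt_abs.1 h with h | h
        · have : 1 ≤ Real.exp (-(B * θ ^ 2 / 2) +
              θ / 2 * (((l.filter fun y => y).length : ℝ) - B * p)) :=
            Real.one_le_exp (by nlinarith)
          linarith [Real.exp_pos (-(B * θ ^ 2 / 2) +
            -(θ / 2) * (((l.filter fun y => y).length : ℝ) - B * p))]
        · have : 1 ≤ Real.exp (-(B * θ ^ 2 / 2) +
              -(θ / 2) * (((l.filter fun y => y).length : ℝ) - B * p)) :=
            Real.one_le_exp (by nlinarith)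
          linarith [Real.exp_pos (-(B * θ ^ 2 / 2) +
            θ / 2 * (((l.filter fun y => y).length : ℝ) - B * p))]
      · positivity
    refine (E_mono _ hle).trans ?_
    rw [E_const_mul, E_add]
    have e1 := E_iid_exp_le κ hp ht B
    have e2 := E_iid_exp_le κ hp ht' B
    rw [neg_sq] at e2
    calc _ ≤ Real.exp (-(B * θ ^ 2 / 2)) * (Real.exp (B * (θ / 2) ^ 2) +
            Real.exp (B * (θ / 2) ^ 2)) :=
          mul_le_mul_of_nonneg_left (add_le_add e1 e2) (Real.exp_pos _).le
      _ = 2 * (Real.exp (-(B * θ ^ 2 / 2)) * Real.exp (B * (θ / 2) ^ 2)) := by ring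
      _ = _ := by rw [← Real.exp_add]; ring_nf
  · have : (κ.iid B).E (fun l => if B * θ < |((l.filter fun y => y).length : ℝ) - B * p|
        then (1 : ℝ) else 0) = (κ.iid B).E fun _ => 0 := by
      refine E_congr (κ.length_iid B) fun l hl => if_neg (not_lt.2 ?_)
      have h1 : ((l.filter fun y => y).length : ℝ) ≤ B := by
        rw [← hl]; exact_mod_cast List.length_filter_le _ _
      have h3 : (0 : ℝ) ≤ (l.filter fun y => y).length := Nat.cast_nonneg _
      rw [abs_le]
      constructor <;> nlinarith
    rw [this, E_const]
    positivity

end FinDist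

/-! ### Random instances -/

open FinDist

/-- A uniform vertex. -/
noncomputable def vert (n : ℕ) [NeZero n] : FinDist ℕ := (unif (Fin n)).map Fin.val

theorem E_vert {n : ℕ} [NeZero n] (φ : ℕ → ℝ) :
    (vert n).E φ = (∑ v ∈ Finset.range n, φ v) / n := by
  rw [vert, E_map, E_unif, Fintype.expect_eq_sum_div_card, Fintype.card_fin,
    Finset.sum_range]

theorem supp_vert (n : ℕ) [NeZero n] : (vert n).Supp fun v => v < n := fun i => i.2

/-- A uniform vertex `v`, together with a random bit with distribution `x v`. -/
noncomputable def vertBit (n : ℕ) [NeZero n] (x : ℕ → FinDist Bool) : FinDist (ℕ × Bool) :=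
  (vert n).bind fun v => (x v).map fun b => (v, b)

theorem E_vertBit {n : ℕ} [NeZero n] (x : ℕ → FinDist Bool) (φ : ℕ × Bool → ℝ) :
    (vertBit n x).E φ = (vert n).E fun v => (x v).E fun b => φ (v, b) := E_bind _ _ _

/-- A predicate as a function of lists. -/
def predList {d : ℕ} (P : (Fin d → Bool) → Bool) (l : List Bool) : Bool :=
  P fun k => l.getD k false

/-- A sample: a uniform hyperedge, and the noisy value of `P` on independent random bits for its
vertices, where the bit for each occurrence of the vertex `v` has distribution `x v`. -/
noncomputable def sampleDist (n : ℕ) [NeZero n] {d : ℕ} (P : (Fin d → Bool) → Bool)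
    (ν : FinDist Bool) (x : ℕ → FinDist Bool) : FinDist Sample :=
  ((vertBit n x).iid d).bind fun l =>
    ν.map fun e => (l.map Prod.fst, xor (predList P (l.map Prod.snd)) e)

theorem E_sampleDist {n : ℕ} [NeZero n] {d : ℕ} (P : (Fin d → Bool) → Bool)
    (ν : FinDist Bool) (x : ℕ → FinDist Bool) (φ : Sample → ℝ) :
    (sampleDist n P ν x).E φ = ((vertBit n x).iid d).E fun l => ν.E fun e =>
      φ (l.map Prod.fst, xor (predList P (l.map Prod.snd)) e) := E_bind _ _ _

theorem supp_sampleDist (n : ℕ) [NeZero n] {d : ℕ} (P : (Fin d → Bool) → Bool)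
    (ν : FinDist Bool) (x : ℕ → FinDist Bool) :
    (sampleDist n P ν x).Supp fun z => z.1.length = d ∧ ∀ v ∈ z.1, v < n := by
  have h : (vertBit n x).Supp fun p => p.1 < n :=
    Supp.bind (supp_vert n) fun v hv => Supp.map (supp_true _) fun _ _ => hv
  refine Supp.bind (supp_iid h d) fun l ⟨h1, h2⟩ => Supp.map (supp_true ν) fun e _ => ⟨?_, ?_⟩
  · simp [h1]
  · intro v hv
    obtain ⟨p, hp, rfl⟩ := List.mem_map.1 hv
    exact h2 p hp

/-- The samples with a fixed secret `s`. -/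
noncomputable abbrev secretDist (n : ℕ) [NeZero n] {d : ℕ} (P : (Fin d → Bool) → Bool)
    (ν : FinDist Bool) (s : ℕ → Bool) : FinDist Sample :=
  sampleDist n P ν fun v => pure (s v)

theorem E_iid_vertBit_pure {n : ℕ} [NeZero n] (s : ℕ → Bool) (k : ℕ)
    (φ : List (ℕ × Bool) → ℝ) :
    ((vertBit n fun v => pure (s v)).iid k).E φ =
      ((vert n).iid k).E fun l => φ (l.map fun v => (v, s v)) := by
  rw [← E_iid_map]
  refine iid_E_congr (fun ψ => ?_) k φ
  rw [E_vertBit, E_map]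
  congr 1; funext v
  rw [E_pure]

theorem E_secretDist {n : ℕ} [NeZero n] {d : ℕ} (P : (Fin d → Bool) → Bool)
    (ν : FinDist Bool) (s : ℕ → Bool) (φ : Sample → ℝ) :
    (secretDist n P ν s).E φ = ((vert n).iid d).E fun S => ν.E fun e =>
      φ (S, xor (predList P (S.map s)) e) := by
  rw [E_sampleDist, E_iid_vertBit_pure]
  congr 1; funext S
  simp [List.map_map, Function.comp_def]

/-! ### Relabelled samples -/

/-- The bit of a random vertex of the window `[t, t + 2 h)`. -/
noncomputable def windowDist (s : ℕ → Bool) (t h : ℕ) : FinDist Bool :=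
  if hh : h = 0 then coin else
    haveI : NeZero (2 * h) := ⟨by omega⟩
    (vert (2 * h)).map fun j => s (t + j)

theorem E_windowDist (s : ℕ → Bool) (t : ℕ) {h : ℕ} (hh : h ≠ 0) (φ : Bool → ℝ) :
    (windowDist s t h).E φ = (∑ j ∈ Finset.range (2 * h), φ (s (t + j))) / (2 * h) := by
  have : NeZero (2 * h) := ⟨by omega⟩
  rw [windowDist, dif_neg hh, E_map, E_vert]; push_cast; rfl

/-- The bit of `a` or `b`, with equal probabilities. -/
noncomputable def pairDist (s : ℕ → Bool) (a b : ℕ) : FinDist Bool :=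
  coin.map fun c => if c then s b else s a

theorem E_pairDist (s : ℕ → Bool) (a b : ℕ) (φ : Bool → ℝ) :
    (pairDist s a b).E φ = (φ (s a) + φ (s b)) / 2 := by
  rw [pairDist, E_map, E_coin]; simp [add_comm]

/-- The bits that the vertices have after relabelling: `x` below `i`, `y` at `i`, and the secret
above `i`. -/
noncomputable def hybrid (s : ℕ → Bool) (i : ℕ) (x y : FinDist Bool) (v : ℕ) : FinDist Bool :=
  if v < i then x else if v = i then y else pure (s v)

/-- A relabelled vertex is kept with probability `h / (2 n)`; if it is kept, then its new label is
uniform, and the secret bit of the original vertex is distributed as in the hybrid. -/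
theorem E_relabel {n : ℕ} [NeZero n] (s : ℕ → Bool) {t h i a b : ℕ} (hh : 1 ≤ h)
    (ht : t + 2 * h ≤ n) (hi : i < n) (ha : a < n) (hb : b < n) (φ : ℕ → Bool → ℝ) :
    (vert n).E (fun w => (vert n).E fun u => coin.E fun c => coin.E fun c' =>
      if (relabel t h i a b w u c c').1 then φ (relabel t h i a b w u c c').2 (s w) else 0) =
    h / (2 * n) * (vertBit n (hybrid s i (windowDist s t h) (pairDist s a b))).E
      fun p => φ p.1 p.2 := by
  have hn : (n : ℝ) ≠ 0 := by exact_mod_cast NeZero.ne n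
  have hh0 : (h : ℝ) ≠ 0 := by exact_mod_cast (by omega : h ≠ 0)
  -- the labels below `i`, above `i`, and equal to `i`
  have e1 : ∑ w ∈ Finset.range n, ∑ u ∈ Finset.range n,
      (if (t ≤ w ∧ w < t + 2 * h) ∧ u < i then φ u (s w) else 0) =
      2 * h * ∑ u ∈ Finset.range i, (windowDist s t h).E (φ u) := by
    simp only [E_windowDist s t (by omega : h ≠ 0)]
    rw [Finset.sum_comm, ← Finset.sum_subset (Finset.range_subset_range.2 hi.le), Finset.mul_sum]
    · refine Finset.sum_congr rfl fun u hu => ?_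
      rw [Finset.mem_range] at hu
      simp only [hu, and_true]
      rw [← Finset.sum_filter, mul_div_cancel₀ _ (by positivity)]
      have : (Finset.range n).filter (fun w => t ≤ w ∧ w < t + 2 * h) =
          (Finset.range (2 * h)).map (addLeftEmbedding t) := by
        ext w
        simp only [Finset.mem_filter, Finset.mem_range, Finset.mem_map, addLeftEmbedding_apply]
        exact ⟨fun h => ⟨w - t, by omega, by omega⟩, fun ⟨j, h1, h2⟩ => by omega⟩
      rw [this, Finset.sum_map]
      rfl
    · intro u _ hu
      rw [Finset.mem_range] at hu
      simp [hu]
  have cnt : ∀ k ≤ n, ∀ c : ℝ, ∑ u ∈ Finset.range n, (if u < k then c else 0) = k * c := by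
    intro k hk c
    rw [← Finset.sum_filter, Finset.sum_const, nsmul_eq_mul]
    congr 2
    rw [show (Finset.range n).filter (fun u => u < k) = Finset.range k by
      ext; simp; omega, Finset.card_range]
  have e2 : ∑ w ∈ Finset.range n, ∑ u ∈ Finset.range n,
      (if u < 2 * h ∧ i < w then φ w (s w) else 0) =
      2 * h * ∑ w ∈ Finset.Ioo i n, φ w (s w) := by
    rw [Finset.mul_sum, show Finset.Ioo i n = (Finset.range n).filter fun w => i < w by
      ext; simp; omega, Finset.sum_filter]
    refine Finset.sum_congr rfl fun w _ => ?_
    by_cases hw : i < w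
    · simp only [hw, and_true, if_true]
      rw [cnt (2 * h) (by omega)]; push_cast; rfl
    · simp [hw]
  have e3 : ∀ a < n, ∑ w ∈ Finset.range n, ∑ u ∈ Finset.range n,
      (if u < h ∧ w = a then φ i (s w) else 0) = h * φ i (s a) := by
    intro a ha
    rw [Finset.sum_eq_single a]
    · simp only [and_true]
      exact cnt h (by omega) _
    · intro w _ hw; simp [hw]
    · intro ha'; simp [ha] at ha'
  have split : ∑ v ∈ Finset.range n,
      (hybrid s i (windowDist s t h) (pairDist s a b) v).E (φ v) =
      ∑ u ∈ Finset.range i, (windowDist s t h).E (φ u) + (φ i (s a) + φ i (s b)) / 2 +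
        ∑ w ∈ Finset.Ioo i n, φ w (s w) := by
    rw [Finset.range_eq_Ico, ← Finset.sum_Ico_consecutive _ (Nat.zero_le i) hi.le,
      Finset.sum_eq_sum_Ico_succ_bot hi, ← add_assoc, ← Finset.range_eq_Ico]
    congr 1
    · congr 1
      · refine Finset.sum_congr rfl fun v hv => ?_
        rw [hybrid, if_pos (Finset.mem_range.1 hv)]
      · rw [hybrid, if_neg (by omega), if_pos rfl, E_pairDist]
    · rw [show Finset.Ico (i + 1) n = Finset.Ioo i n by ext; simp]
      refine Finset.sum_congr rfl fun v hv => ?_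
      rw [Finset.mem_Ioo] at hv
      rw [hybrid, if_neg (by omega), if_neg (by omega), E_pure]
  rw [E_vertBit, E_vert, E_vert, split]
  simp only [E_vert, E_coin, relabel, Bool.and_eq_true, decide_eq_true_eq, if_true,
    Bool.false_eq_true, if_false]
  simp only [← Finset.sum_div, Finset.sum_add_distrib]
  rw [e1, e2, e3 a ha, e3 b hb]
  field_simp
  ring

theorem E_relabelEdge {n : ℕ} [NeZero n] (s : ℕ → Bool) {t h i a b : ℕ} (hh : 1 ≤ h)
    (ht : t + 2 * h ≤ n) (hi : i < n) (ha : a < n) (hb : b < n) (d : ℕ)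
    (φ : List ℕ → List Bool → ℝ) :
    ((vert n).iid d).E (fun S => ((vert n).iid d).E fun U => (coin.iid (2 * d)).E fun c =>
      if (relabelEdge t h i a b d S U c).1 then φ (relabelEdge t h i a b d S U c).2 (S.map s)
      else 0) =
    (h / (2 * n)) ^ d *
      ((vertBit n (hybrid s i (windowDist s t h) (pairDist s a b))).iid d).E
        fun l => φ (l.map Prod.fst) (l.map Prod.snd) := by
  induction d generalizing φ with
  | zero => simp [E_iid_zero, relabelEdge]
  | succ d ih =>
    have e : ∀ (S U : List ℕ) (c : List Bool) (w u : ℕ) (c1 c2 : Bool),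
        (if (relabelEdge t h i a b (d + 1) (w :: S) (u :: U) (c1 :: c2 :: c)).1 then
          φ (relabelEdge t h i a b (d + 1) (w :: S) (u :: U) (c1 :: c2 :: c)).2
            ((w :: S).map s) else 0) =
        if (relabel t h i a b w u c1 c2).1 then
          (if (relabelEdge t h i a b d S U c).1 then
            φ ((relabel t h i a b w u c1 c2).2 :: (relabelEdge t h i a b d S U c).2)
              (s w :: S.map s) else 0) else 0 := by
      intro S U c w u c1 c2
      simp only [relabelEdge, List.headD_cons, List.tail_cons, Bool.and_eq_true, List.map_cons]
      by_cases h1 : (relabel t h i a b w u c1 c2).1 = true <;> simp [h1]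
    simp only [show 2 * (d + 1) = 2 * d + 1 + 1 by ring, E_iid_succ, e]
    -- the expectations are reordered, vertex by vertex
    have r1 : ∀ G : List ℕ → ℕ → List ℕ → Bool → Bool → List Bool → ℝ,
        (((vert n).iid d).E fun S => (vert n).E fun u => ((vert n).iid d).E fun U =>
          coin.E fun c1 => coin.E fun c2 => (coin.iid (2 * d)).E fun c => G S u U c1 c2 c) =
        (vert n).E fun u => coin.E fun c1 => coin.E fun c2 => ((vert n).iid d).E fun S =>
          ((vert n).iid d).E fun U => (coin.iid (2 * d)).E fun c => G S u U c1 c2 c := by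
      intro G
      rw [E_comm]
      congr 1; funext u
      have : ∀ S, (((vert n).iid d).E fun U => coin.E fun c1 => coin.E fun c2 =>
          (coin.iid (2 * d)).E fun c => G S u U c1 c2 c) = coin.E fun c1 => coin.E fun c2 =>
          ((vert n).iid d).E fun U => (coin.iid (2 * d)).E fun c => G S u U c1 c2 c := by
        intro S
        rw [E_comm]
        congr 1; funext c1
        rw [E_comm]
      simp only [this]
      rw [E_comm]
      congr 1; funext c1
      rw [E_comm]
    simp only [r1]
    have inner : ∀ (w u : ℕ) (c1 c2 : Bool), (((vert n).iid d).E fun S =>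
          ((vert n).iid d).E fun U => (coin.iid (2 * d)).E fun c =>
          if (relabel t h i a b w u c1 c2).1 then
          (if (relabelEdge t h i a b d S U c).1 then
            φ ((relabel t h i a b w u c1 c2).2 :: (relabelEdge t h i a b d S U c).2)
              (s w :: S.map s) else 0) else 0) =
        if (relabel t h i a b w u c1 c2).1 then (h / (2 * n) : ℝ) ^ d *
          ((vertBit n (hybrid s i (windowDist s t h) (pairDist s a b))).iid d).E
            (fun l => φ ((relabel t h i a b w u c1 c2).2 :: l.map Prod.fst)
              (s w :: l.map Prod.snd)) else 0 := by
      intro w u c1 c2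
      split_ifs with h1
      · exact ih fun vs bs => φ ((relabel t h i a b w u c1 c2).2 :: vs) (s w :: bs)
      · simp [E_const]
    simp only [inner]
    rw [E_relabel s hh ht hi ha hb (fun v b => (h / (2 * n) : ℝ) ^ d *
      ((vertBit n (hybrid s i (windowDist s t h) (pairDist s _ _))).iid d).E
        (fun l => φ (v :: l.map Prod.fst) (b :: l.map Prod.snd))), E_const_mul, pow_succ]
    simp only [List.map_cons]
    ring

/-- A relabelled sample, if it is kept, is a sample for the bits of the hybrid. -/
theorem E_relabelSample {n : ℕ} [NeZero n] {d : ℕ} (P : (Fin d → Bool) → Bool) (ν : FinDist Bool)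
    (s : ℕ → Bool) {t h i a b : ℕ} (hh : 1 ≤ h)
    (ht : t + 2 * h ≤ n) (hi : i < n) (ha : a < n) (hb : b < n) (φ : Sample → ℝ) :
    (blockDist (secretDist n P ν s) coin 2 (2 * d) (relabelSample d t h i a b)).E
      (fun r => if r.1 then φ r.2 else 0) =
    (h / (2 * n)) ^ d *
      (sampleDist n P ν (hybrid s i (windowDist s t h) (pairDist s a b))).E φ := by
  rw [E_blockDist, E_iid_succ]
  simp only [E_iid_one]
  rw [E_secretDist]
  simp only [E_secretDist, relabelSample, List.headD_cons, List.tail_cons]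
  rw [E_comm, E_sampleDist, E_comm ((vertBit n _).iid d) ν, ← E_const_mul]
  congr 1; funext e
  refine Eq.trans ?_ (E_relabelEdge s hh ht hi ha hb d fun vs bs =>
    φ (vs, xor (predList P bs) e))
  congr 1; funext S; congr 1; funext U
  refine Eq.trans ?_ (E_const ν _)
  rfl

/-! ### The counts and their means -/

/-- The probability that `D` answers "1" on `m` samples. -/
noncomputable def acc (D : RandAlg) (n : ℕ) [NeZero n] {d : ℕ} (P : (Fin d → Bool) → Bool)
    (ν : FinDist Bool) (m : ℕ) (x : ℕ → FinDist Bool) : ℝ :=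
  ((sampleDist n P ν x).iid m).E fun l => D.outputProb (enc (toInst n l)) (.ofBool true)

theorem outputProb_nonneg (D : RandAlg) (x v : Data) : 0 ≤ D.outputProb x v :=
  Finset.expect_nonneg fun _ _ => by split <;> norm_num

theorem outputProb_le_one (D : RandAlg) (x v : Data) : D.outputProb x v ≤ 1 :=
  Finset.expect_le Finset.univ_nonempty fun _ _ => by split <;> norm_num

theorem acc_nonneg (D : RandAlg) (n : ℕ) [NeZero n] {d : ℕ} (P : (Fin d → Bool) → Bool)
    (ν : FinDist Bool) (m : ℕ) (x : ℕ → FinDist Bool) : 0 ≤ acc D n P ν m x :=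
  E_nonneg _ fun _ => outputProb_nonneg ..

theorem acc_le_one (D : RandAlg) (n : ℕ) [NeZero n] {d : ℕ} (P : (Fin d → Bool) → Bool)
    (ν : FinDist Bool) (m : ℕ) (x : ℕ → FinDist Bool) : acc D n P ν m x ≤ 1 :=
  E_le_one _ fun _ => outputProb_le_one ..

theorem sampleDist_congr {n : ℕ} [NeZero n] {d : ℕ} (P : (Fin d → Bool) → Bool)
    (ν : FinDist Bool) {x y : ℕ → FinDist Bool} (h : ∀ v < n, ∀ φ, (x v).E φ = (y v).E φ)
    (φ : Sample → ℝ) : (sampleDist n P ν x).E φ = (sampleDist n P ν y).E φ := by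
  rw [E_sampleDist, E_sampleDist]
  refine iid_E_congr (fun ψ => ?_) _ _
  rw [E_vertBit, E_vertBit]
  exact E_congr (supp_vert n) fun v hv => h v hv _

theorem acc_congr (D : RandAlg) {n : ℕ} [NeZero n] {d : ℕ} (P : (Fin d → Bool) → Bool)
    (ν : FinDist Bool) (m : ℕ) {x y : ℕ → FinDist Bool} (h : ∀ v < n, ∀ φ, (x v).E φ = (y v).E φ) :
    acc D n P ν m x = acc D n P ν m y :=
  iid_E_congr (sampleDist_congr P ν h) _ _

theorem outputProb_eq (D : RandAlg) (x : DecInst) :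
    D.outputProb (enc x) (.ofBool true) =
      (coin.iid (polyBound D.coinExp (sz x))).E fun r => if accepts D x r then 1 else 0 := by
  change _ = (coin.iid (D.numCoins (enc x))).E _
  rw [coin, E_iid_unif, RandAlg.outputProb]
  refine Finset.expect_congr rfl fun r _ => ?_
  have h : D.Outputs (enc x) r (.ofBool true) ↔ accepts D x (List.ofFn r) = true := by
    unfold accepts RandAlg.Outputs
    rw [← enc_ofFn_bits]
    exact (@decide_eq_true_iff _ (Classical.propDecidable _)).symm
  by_cases hr : accepts D x (List.ofFn r) = true
  · rw [if_pos hr, if_pos (h.2 hr)]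
  · rw [if_neg hr, if_neg fun h' => hr (h.1 h')]

theorem sz_toInst_le {n m d : ℕ} {l : List Sample} (hl : l.length = m)
    (h : ∀ z ∈ l, z.1.length = d ∧ ∀ v ∈ z.1, v < n) : sz (toInst n l) ≤ instBound d n m := by
  have h1 : ∀ e ∈ l.map (fun y : Sample => y.1), sz e ≤ d * (2 * n + 2) + 1 := by
    intro e he
    obtain ⟨z, hz, rfl⟩ := List.mem_map.1 he
    have := sz_le_of_forall_le (l := z.1) (B := 2 * n + 1) fun v hv => by
      have := (h z hz).2 v hv
      rw [sz_nat]; omega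
    rwa [(h z hz).1] at this
  have h2 : sz (l.map fun y : Sample => y.1) ≤
      (l.map fun y : Sample => y.1).length * (d * (2 * n + 2) + 2) + 1 := sz_le_of_forall_le h1
  have h3 := sz_le_of_forall_le (l := l.map (fun y : Sample => y.2)) (B := 3)
    fun b _ => sz_bool_le b
  rw [List.length_map, hl] at h2 h3
  unfold toInst instBound
  rw [sz_pair, sz_pair, sz_nat]
  omega

theorem polyBound_mono (a : ℕ) {x y : ℕ} (h : x ≤ y) : polyBound a x ≤ polyBound a y := by
  rw [← eval_polyBoundPoly, ← eval_polyBoundPoly]; exact eval_mono _ h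

theorem validInst_toInst {n d : ℕ} {l : List Sample}
    (h : ∀ z ∈ l, z.1.length = d ∧ ∀ v ∈ z.1, v < n) : validInst d (toInst n l) = true := by
  simp only [validInst, toInst, List.length_map, decide_true, Bool.true_and, List.all_eq_true,
    List.mem_map, Bool.and_eq_true, decide_eq_true_eq]
  rintro e ⟨z, hz, rfl⟩
  exact ⟨(h z hz).1, fun v hv => decide_eq_true ((h z hz).2 v hv)⟩

/-- A run of `D` on samples needs only an initial segment of the coins. -/
theorem E_run (D : RandAlg) {n m d : ℕ} {l : List Sample} (hl : l.length = m)
    (h : ∀ z ∈ l, z.1.length = d ∧ ∀ v ∈ z.1, v < n) :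
    (coin.iid (runCoins d D n m)).E (fun c =>
      if run d D (toInst n l) (c.take (polyBound D.coinExp (sz (toInst n l)))) then 1 else 0) =
    D.outputProb (enc (toInst n l)) (.ofBool true) := by
  unfold runCoins
  rw [E_iid_take coin (polyBound_mono _ (sz_toInst_le hl h))
    (fun c => if run d D (toInst n l) c then 1 else 0), outputProb_eq]
  refine E_congr (coin.length_iid _) fun c hc => ?_
  simp [run, validInst_toInst h, hc]

/-- The mean of one group test: the probability that enough samples are kept, times the
probability that `D` answers "1" on samples of the hybrid. -/
theorem E_groupTest (D : RandAlg) {n : ℕ} [NeZero n] {d : ℕ} (P : (Fin d → Bool) → Bool)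
    (ν : FinDist Bool) (s : ℕ → Bool) {t h i a b : ℕ} (hh : 1 ≤ h) (ht : t + 2 * h ≤ n)
    (hi : i < n) (ha : a < n) (hb : b < n) (R m : ℕ) :
    (blockDist (secretDist n P ν s) coin (2 * R) (runCoins d D n m + 2 * d * R)
      (groupTest d D t h i a b n m R (runCoins d D n m))).E (fun y => if y then 1 else 0) =
    passProb ((h / (2 * n)) ^ d) R m *
      acc D n P ν m (hybrid s i (windowDist s t h) (pairDist s a b)) := by
  set k := runCoins d D n m with hk
  rw [E_blockDist]
  have e : ∀ z : List Sample, ((coin.iid (k + 2 * d * R)).E fun c =>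
      if groupTest d D t h i a b n m R k z c then (1 : ℝ) else 0) =
      (coin.iid k).E fun c => (coin.iid (2 * d * R)).E fun c' =>
        if m ≤ (keptSamples d t h i a b R z c').length then
          (if run d D (toInst n ((keptSamples d t h i a b R z c').take m)) (c.take
            (polyBound D.coinExp (sz (toInst n ((keptSamples d t h i a b R z c').take m)))))
            then 1 else 0) else 0 := by
    intro z
    rw [E_iid_add]
    refine E_congr (coin.length_iid k) fun c hc => ?_
    congr 1; funext c'
    unfold groupTest
    rw [List.drop_left' hc, List.take_left' hc]
    by_cases h1 : m ≤ (keptSamples d t h i a b R z c').length <;> simp [h1]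
  simp only [e]
  rw [E_comm]
  have e2 : ∀ c : List Bool, (((secretDist n P ν s).iid (2 * R)).E fun z =>
      (coin.iid (2 * d * R)).E fun c' =>
        if m ≤ (keptSamples d t h i a b R z c').length then
          (if run d D (toInst n ((keptSamples d t h i a b R z c').take m)) (c.take
            (polyBound D.coinExp (sz (toInst n ((keptSamples d t h i a b R z c').take m)))))
            then 1 else 0) else 0) = passProb ((h / (2 * n)) ^ d) R m *
      ((sampleDist n P ν (hybrid s i (windowDist s t h) (pairDist s a b))).iid m).E fun l =>
        if run d D (toInst n l) (c.take (polyBound D.coinExp (sz (toInst n l)))) then 1 else 0 := by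
    intro c
    have := E_blocks (secretDist n P ν s) coin 2 (2 * d) R 0 0 (relabelSample d t h i a b)
      (fun l => if m ≤ ((l.filter fun y => y.1).map fun y => y.2).length then
        (if run d D (toInst n (((l.filter fun y => y.1).map fun y => y.2).take m)) (c.take
          (polyBound D.coinExp (sz (toInst n (((l.filter fun y => y.1).map
            fun y => y.2).take m))))) then (1 : ℝ) else 0) else 0)
    refine this.trans ?_
    exact E_filter_take _ _ _ (E_relabelSample P ν s hh ht hi ha hb) R m (fun l =>
      if run d D (toInst n l) (c.take (polyBound D.coinExp (sz (toInst n l)))) then 1 else 0)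
  simp only [e2]
  rw [E_const_mul, E_comm]
  congr 1
  refine E_congr (supp_iid (supp_sampleDist n P ν _) m) fun l hl => ?_
  exact E_run D hl.1 hl.2

open Classical in
/-- The counts are close to their means. -/
theorem E_count_far_le (D : RandAlg) {n : ℕ} [NeZero n] {d : ℕ} (P : (Fin d → Bool) → Bool)
    (ν : FinDist Bool) (s : ℕ → Bool) {t h i a b : ℕ} (hh : 1 ≤ h) (ht : t + 2 * h ≤ n)
    (hi : i < n) (ha : a < n) (hb : b < n) (R m B M T : ℕ) (hM : 2 * R * B ≤ M)
    (hT : (runCoins d D n m + 2 * d * R) * B ≤ T) {θ : ℝ} (hθ : 0 ≤ θ) :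
    ((secretDist n P ν s).iid M).E (fun z => (coin.iid T).E fun c =>
      if B * θ < |(count d D t h i a b n m R (runCoins d D n m) B z c : ℝ) -
        B * (passProb ((h / (2 * n)) ^ d) R m *
          acc D n P ν m (hybrid s i (windowDist s t h) (pairDist s a b)))| then 1 else 0) ≤
    2 * Real.exp (-(B * θ ^ 2 / 4)) := by
  obtain ⟨e, rfl⟩ := Nat.exists_eq_add_of_le hM
  obtain ⟨e', rfl⟩ := Nat.exists_eq_add_of_le hT
  have := E_blocks (secretDist n P ν s) coin (2 * R) (runCoins d D n m + 2 * d * R) B e e'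
    (groupTest d D t h i a b n m R (runCoins d D n m))
    (fun l => if B * θ < |((l.filter fun y => y).length : ℝ) -
        B * (passProb ((h / (2 * n)) ^ d) R m *
          acc D n P ν m (hybrid s i (windowDist s t h) (pairDist s a b)))| then 1 else 0)
  refine (le_of_eq this).trans (chernoff _ ?_ hθ B)
  exact (E_groupTest D P ν s hh ht hi ha hb R m).symm

/-! ### Correctness of the output -/

/-- The threshold for the difference of two frequencies. With `q = 2 k`, the gap between two
consecutive hybrids is at least four times the threshold for the secrets that are to be found. -/
noncomputable def threshold (d X n N q : ℕ) : ℝ := (4 * q) ^ d / (X * N * n)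

theorem threshold_nonneg (d X n N q : ℕ) : 0 ≤ threshold d X n N q := by
  unfold threshold; positivity

theorem farApart_iff {d X n N q B x y : ℕ} (hX : 0 < X) (hn : 0 < n) (hN : 0 < N) :
    farApart d X n N q B x y = true ↔ B * threshold d X n N q < |(x : ℝ) - y| := by
  have h1 : (((x - y) + (y - x) : ℕ) : ℝ) = |(x : ℝ) - y| := by
    rcases le_total x y with h | h
    · rw [Nat.sub_eq_zero_of_le h, Nat.zero_add, Nat.cast_sub h, abs_sub_comm,
        abs_of_nonneg (sub_nonneg.2 (by exact_mod_cast h))]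
    · rw [Nat.sub_eq_zero_of_le h, Nat.add_zero, Nat.cast_sub h,
        abs_of_nonneg (sub_nonneg.2 (by exact_mod_cast h))]
  have hpos : (0 : ℝ) < X * N * n := by positivity
  rw [farApart, decide_eq_true_eq, ← Nat.cast_lt (α := ℝ), Nat.cast_mul, Nat.cast_mul, h1,
    threshold, ← mul_div_assoc, div_lt_iff₀ hpos]
  push_cast
  rfl

theorem different_zero (d : ℕ) (D : RandAlg) (X n m N : ℕ) (z : List Sample) (c : List Bool) :
    different d D X n m N 0 z c = false := by
  simp [different, showsDifferent, farApart]

/-- The mean of a group test. -/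
noncomputable def groupMean (D : RandAlg) (n : ℕ) [NeZero n] {d : ℕ} (P : (Fin d → Bool) → Bool)
    (ν : FinDist Bool) (s : ℕ → Bool) (m q h t i a b : ℕ) : ℝ :=
  passProb ((h / (2 * n)) ^ d) (groupSize d q m) m *
    acc D n P ν m (hybrid s i (windowDist s t h) (pairDist s a b))

/-- The count for the parameters is within a quarter of the threshold. -/
def Accurate (D : RandAlg) (n : ℕ) [NeZero n] {d : ℕ} (P : (Fin d → Bool) → Bool)
    (ν : FinDist Bool) (s : ℕ → Bool) (X m N : ℕ) (z : List Sample) (c : List Bool)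
    (q h t i a b : ℕ) : Prop :=
  |(count d D t h i a b n m (groupSize d q m) (runCoins d D n m)
      (z.length / (2 * groupSize d q m)) z c : ℝ) -
    (z.length / (2 * groupSize d q m) : ℕ) * groupMean D n P ν s m q h t i a b| ≤
    (z.length / (2 * groupSize d q m) : ℕ) * (threshold d X n N q / 4)

theorem hybrid_congr {n : ℕ} (s : ℕ → Bool) (i : ℕ) {x x' y y' : FinDist Bool}
    (hx : ∀ φ, x.E φ = x'.E φ) (hy : ∀ φ, y.E φ = y'.E φ) (v : ℕ) (_ : v < n) (φ : Bool → ℝ) :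
    (hybrid s i x y v).E φ = (hybrid s i x' y' v).E φ := by
  unfold hybrid
  split_ifs
  · exact hx φ
  · exact hy φ
  · rfl

theorem half_le_passProb_groupSize {d n q h m : ℕ} (hn : 0 < n) (hm : 1 ≤ m)
    (hh : 2 * h ≤ n) (hq : n ≤ 2 * q * h) :
    1 / 2 ≤ passProb (((h : ℝ) / (2 * n)) ^ d) (groupSize d q m) m := by
  have hn' : (0 : ℝ) < n := by exact_mod_cast hn
  have hh' : 2 * (h : ℝ) ≤ n := by exact_mod_cast hh
  refine half_le_passProb (by positivity) (pow_le_one₀ (by positivity) ?_) hm ?_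
  · rw [div_le_one (by positivity)]; linarith [(Nat.cast_nonneg h : (0 : ℝ) ≤ h)]
  · have h1 : (1 : ℝ) ≤ (h : ℝ) / (2 * n) * (4 * q) := by
      rw [div_mul_eq_mul_div, le_div_iff₀ (by positivity)]
      have : (n : ℝ) ≤ 2 * q * h := by exact_mod_cast hq
      linarith
    have h2 : (1 : ℝ) ≤ ((h : ℝ) / (2 * n)) ^ d * (4 * q) ^ d := by
      rw [← mul_pow]; exact one_le_pow₀ h1
    unfold groupSize
    push_cast
    have hm0 : (0 : ℝ) ≤ 8 * m := by positivity
    calc (8 * m : ℝ) = 8 * m * 1 := by ring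
      _ ≤ 8 * m * (((h : ℝ) / (2 * n)) ^ d * (4 * q) ^ d) := mul_le_mul_of_nonneg_left h2 hm0
      _ = _ := by ring

section
variable {D : RandAlg} {n : ℕ} [NeZero n] {d : ℕ} {P : (Fin d → Bool) → Bool}
  {ν : FinDist Bool} {s : ℕ → Bool} {X m N : ℕ} {z : List Sample} {c : List Bool}

/-- Vertices with equal bits are not declared to be different. -/
theorem different_eq_false (hX : 0 < X) (hN : 0 < N)
    (hacc : ∀ q ≤ n, ∀ h ≤ n, ∀ t ≤ n, ∀ i < n, ∀ a < n, ∀ b < n, admissible n q h t = true →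
      Accurate D n P ν s X m N z c q h t i a b) {a : ℕ} (ha : a < n) (has : s a = s 0) :
    different d D X n m N a z c = false := by
  have hn : 0 < n := Nat.pos_of_ne_zero (NeZero.ne n)
  rw [← Bool.not_eq_true]
  intro hd
  simp only [different, List.any_eq_true, List.mem_range, Bool.and_eq_true, showsDifferent,
    Bool.or_eq_true, farApart_iff hX hn hN] at hd
  obtain ⟨q, hq, h, hh, t, ht, i, hi, hadm, hfar⟩ := hd
  have hA := fun a b ha hb => hacc q (by omega) h (by omega) t (by omega) i hi a ha b hb hadm
  have hmean : ∀ a b, s a = s 0 → s b = s 0 →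
      groupMean D n P ν s m q h t i a b = groupMean D n P ν s m q h t i 0 0 := by
    intro a b ha hb
    unfold groupMean
    rw [acc_congr D P ν m (x := hybrid s i (windowDist s t h) (pairDist s a b))
      (y := hybrid s i (windowDist s t h) (pairDist s 0 0))
      (hybrid_congr s i (fun _ => rfl) fun φ => by rw [E_pairDist, E_pairDist, ha, hb])]
  have h1 := hA 0 0 hn hn
  have h2 := hA 0 a hn ha
  have h3 := hA a a ha ha
  unfold Accurate at h1 h2 h3
  rw [hmean _ _ rfl has] at h2
  rw [hmean _ _ has has] at h3
  have hpos : 0 ≤ ((z.length / (2 * groupSize d q m) : ℕ) : ℝ) * threshold d X n N q :=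
    mul_nonneg (Nat.cast_nonneg _) (threshold_nonneg ..)
  rw [abs_le] at h1 h2 h3
  rcases hfar with hf | hf <;> rcases lt_abs.1 hf with hf | hf <;> linarith

/-- Vertices with different bits are declared to be different, if the counts are accurate and some
hybrids are distinguished by `D`. -/
theorem different_eq_true (hX : 0 < X) (hN : 0 < N) (hm : 1 ≤ m)
    (hacc : ∀ q ≤ n, ∀ h ≤ n, ∀ t ≤ n, ∀ i < n, ∀ a < n, ∀ b < n, admissible n q h t = true →
      Accurate D n P ν s X m N z c q h t i a b) {q h t i : ℕ} (hq : q ≤ n)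
    (hadm : admissible n q h t = true) (hwin : ∀ φ, (windowDist s t h).E φ = coin.E φ)
    (hi : i < n) (hB : 1 ≤ z.length / (2 * groupSize d q m))
    (hgap : 4 * threshold d X n N q ≤
      |acc D n P ν m (hybrid s i coin (pure (s i))) - acc D n P ν m (hybrid s i coin coin)|)
    {a : ℕ} (ha : a < n) (has : s a ≠ s 0) :
    different d D X n m N a z c = true := by
  have hn : 0 < n := Nat.pos_of_ne_zero (NeZero.ne n)
  have hadm' := hadm
  simp only [admissible, Bool.and_eq_true, decide_eq_true_eq] at hadm'
  obtain ⟨⟨h1, h2⟩, h3⟩ := hadm'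
  have hpass := half_le_passProb_groupSize (d := d) (m := m) hn hm (by omega) h3
  have hq0 : 0 < q := by
    rcases Nat.eq_zero_or_pos q with rfl | h
    · omega
    · exact h
  have hθ : 0 < threshold d X n N q := by unfold threshold; positivity
  -- one of the vertices `0` and `a` has the same bit as `i`
  obtain ⟨e, he, hes, hfar⟩ : ∃ e < n, s e = s i ∧
      ∀ B : ℕ, B = z.length / (2 * groupSize d q m) → farApart d X n N q B
        (count d D t h i e e n m (groupSize d q m) (runCoins d D n m) B z c)
        (count d D t h i 0 a n m (groupSize d q m) (runCoins d D n m) B z c) = true →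
      showsDifferent d D X n m N q h t i a z c = true := by
    by_cases h0 : s 0 = s i
    · exact ⟨0, hn, h0, fun B hB h => by subst hB; simp [showsDifferent, h]⟩
    · refine ⟨a, ha, ?_, fun B hB h => by subst hB; simp [showsDifferent, h]⟩
      revert has h0
      cases s a <;> cases s 0 <;> cases s i <;> simp
  have m1 : groupMean D n P ν s m q h t i e e = passProb ((h / (2 * n)) ^ d) (groupSize d q m) m *
      acc D n P ν m (hybrid s i coin (pure (s i))) := by
    unfold groupMean
    rw [acc_congr D P ν m (x := hybrid s i (windowDist s t h) (pairDist s e e))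
      (y := hybrid s i coin (pure (s i))) (hybrid_congr s i hwin fun φ => by
        rw [E_pairDist, E_pure, hes]; ring)]
  have m2 : groupMean D n P ν s m q h t i 0 a = passProb ((h / (2 * n)) ^ d) (groupSize d q m) m *
      acc D n P ν m (hybrid s i coin coin) := by
    unfold groupMean
    rw [acc_congr D P ν m (x := hybrid s i (windowDist s t h) (pairDist s 0 a))
      (y := hybrid s i coin coin) (hybrid_congr s i hwin fun φ => by
        rw [E_pairDist, E_coin]
        revert has
        cases s a <;> cases s 0 <;> simp [add_comm])]
  simp only [different, List.any_eq_true, List.mem_range, Bool.and_eq_true]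
  refine ⟨q, by omega, h, by omega, t, by omega, i, hi, hadm, hfar _ rfl ?_⟩
  rw [farApart_iff hX hn hN]
  have a1 := hacc q hq h (by omega) t (by omega) i hi e he e he hadm
  have a2 := hacc q hq h (by omega) t (by omega) i hi 0 hn a ha hadm
  unfold Accurate at a1 a2
  rw [m1] at a1
  rw [m2] at a2
  generalize (count d D t h i e e n m (groupSize d q m) (runCoins d D n m)
    (z.length / (2 * groupSize d q m)) z c : ℝ) = x at *
  generalize (count d D t h i 0 a n m (groupSize d q m) (runCoins d D n m)
    (z.length / (2 * groupSize d q m)) z c : ℝ) = y at *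
  generalize acc D n P ν m (hybrid s i coin (pure (s i))) = u at *
  generalize acc D n P ν m (hybrid s i coin coin) = v at *
  generalize passProb (((h : ℝ) / (2 * n)) ^ d) (groupSize d q m) m = π at *
  generalize threshold d X n N q = θ at *
  have hB' : (1 : ℝ) ≤ (z.length / (2 * groupSize d q m) : ℕ) := by exact_mod_cast hB
  generalize ((z.length / (2 * groupSize d q m) : ℕ) : ℝ) = B at *
  have g1 : 2 * θ ≤ |π * u - π * v| := by
    rw [← mul_sub, abs_mul, abs_of_nonneg (by linarith)]
    nlinarith [abs_nonneg (u - v)]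
  have g2 : B * (2 * θ) ≤ |B * (π * u) - B * (π * v)| := by
    rw [← mul_sub, abs_mul, abs_of_nonneg (by linarith)]
    exact mul_le_mul_of_nonneg_left g1 (by linarith)
  have g3 : |B * (π * u) - B * (π * v)| ≤ |x - B * (π * u)| + |x - y| + |y - B * (π * v)| := by
    have := abs_add_three (B * (π * u) - x) (x - y) (y - B * (π * v))
    rw [abs_sub_comm (B * (π * u)) x] at this
    rwa [show B * (π * u) - x + (x - y) + (y - B * (π * v)) = B * (π * u) - B * (π * v) by
      ring] at this
  have g4 : 0 < B * θ := by positivity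
  linarith

end

open Classical in
/-- The algorithm succeeds with constant probability on a secret for which the hybrids are
distinguished. -/
theorem quarter_le_E_search (D : RandAlg) {n : ℕ} [NeZero n] {d : ℕ}
    (P : (Fin d → Bool) → Bool) (ν : FinDist Bool) (s : ℕ → Bool) {X m N M T : ℕ} (hX : 0 < X)
    (hN : 0 < N) (hm : 1 ≤ m)
    (hT : ∀ q ≤ n, (runCoins d D n m + 2 * d * groupSize d q m) * (M / (2 * groupSize d q m)) ≤ T)
    (herr : ∀ q ≤ n, 1 ≤ M / (2 * groupSize d q m) → 2 * ((n : ℝ) + 1) ^ 6 * Real.exp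
      (-((M / (2 * groupSize d q m) : ℕ) * (threshold d X n N q / 4) ^ 2 / 4)) ≤ 1 / 2)
    (hs : (∀ a < n, s a = s 0) ∨ ∃ q ≤ n, ∃ h t i, admissible n q h t = true ∧
      (∀ φ, (windowDist s t h).E φ = coin.E φ) ∧ i < n ∧ 1 ≤ M / (2 * groupSize d q m) ∧
      4 * threshold d X n N q ≤ |acc D n P ν m (hybrid s i coin (pure (s i))) -
        acc D n P ν m (hybrid s i coin coin)|) :
    1 / 4 ≤ ((secretDist n P ν s).iid M).E fun z => (coin.iid (1 + T)).E fun c =>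
      if search d D X n m N z c = (List.range n).map s then 1 else 0 := by
  set good : List Sample → List Bool → Prop := fun z c =>
    ∀ q ≤ n, ∀ h ≤ n, ∀ t ≤ n, ∀ i < n, ∀ a < n, ∀ b < n, admissible n q h t = true →
      Accurate D n P ν s X m N z c q h t i a b with hgood
  -- if the counts are accurate and the guess is right, then the output is right
  have hcorrect : ∀ z c, z.length = M → good z c →
      search d D X n m N z (s 0 :: c) = (List.range n).map s := by
    intro z c hz hg
    unfold search
    refine List.map_congr_left fun a ha => ?_
    rw [List.mem_range] at ha
    rw [List.headD_cons, List.tail_cons]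
    by_cases has : s a = s 0
    · rw [different_eq_false hX hN hg ha has, has, Bool.xor_false]
    · rcases hs with hs | ⟨q, hq, h, t, i, hadm, hwin, hi, hB, hgap⟩
      · exact absurd (hs a ha) has
      · rw [different_eq_true hX hN hm hg hq hadm hwin hi (hz ▸ hB) hgap ha has, Bool.xor_true]
        revert has
        cases s a <;> cases s 0 <;> simp
  -- the union bound
  set I : Finset (ℕ × ℕ × ℕ × ℕ × ℕ × ℕ) := Finset.range (n + 1) ×ˢ Finset.range (n + 1) ×ˢ
    Finset.range (n + 1) ×ˢ Finset.range (n + 1) ×ˢ Finset.range (n + 1) ×ˢ Finset.range (n + 1)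
    with hI
  have hcard : (I.card : ℝ) = ((n : ℝ) + 1) ^ 6 := by
    simp only [hI, Finset.card_product, Finset.card_range]; push_cast; ring
  set bad : ℕ × ℕ × ℕ × ℕ × ℕ × ℕ → List Sample → List Bool → ℝ := fun p z c =>
    if p.2.2.2.1 < n ∧ p.2.2.2.2.1 < n ∧ p.2.2.2.2.2 < n ∧
      admissible n p.1 p.2.1 p.2.2.1 = true ∧
      ¬ Accurate D n P ν s X m N z c p.1 p.2.1 p.2.2.1 p.2.2.2.1 p.2.2.2.2.1 p.2.2.2.2.2
      then 1 else 0 with hbad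
  have hbad0 : ∀ p z c, 0 ≤ bad p z c := fun p z c => by
    simp only [hbad]; split <;> norm_num
  have hunion : ∀ z c, 1 - ∑ p ∈ I, bad p z c ≤ if good z c then 1 else 0 := by
    intro z c
    split_ifs with hg
    · have := Finset.sum_nonneg fun p (_ : p ∈ I) => hbad0 p z c
      linarith
    · simp only [hgood, not_forall] at hg
      obtain ⟨q, hq, h, hh, t, ht, i, hi, a, ha, b, hb, hadm, hna⟩ := hg
      have hmem : (q, h, t, i, a, b) ∈ I := by
        simp only [hI, Finset.mem_product, Finset.mem_range]; omega
      have h1 := Finset.single_le_sum (f := fun p => bad p z c) (fun p _ => hbad0 p z c) hmem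
      have h2 : bad (q, h, t, i, a, b) z c = 1 := if_pos ⟨hi, ha, hb, hadm, hna⟩
      rw [h2] at h1
      linarith
  have herr1 : ∀ p ∈ I, ((secretDist n P ν s).iid M).E (fun z => (coin.iid T).E (bad p z)) ≤
      1 / (2 * ((n : ℝ) + 1) ^ 6) := by
    rintro ⟨q, h, t, i, a, b⟩ hp
    simp only [hI, Finset.mem_product, Finset.mem_range] at hp
    by_cases hc : i < n ∧ a < n ∧ b < n ∧ admissible n q h t = true
    swap
    · have : ∀ z c, bad (q, h, t, i, a, b) z c = 0 := fun z c =>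
        if_neg fun h => hc ⟨h.1, h.2.1, h.2.2.1, h.2.2.2.1⟩
      simp only [funext (this _), E_const]
      positivity
    obtain ⟨hi, ha, hb, hadm⟩ := hc
    have hadm' := hadm
    simp only [admissible, Bool.and_eq_true, decide_eq_true_eq] at hadm'
    obtain ⟨⟨h1, h2⟩, h3⟩ := hadm'
    have key := E_count_far_le D P ν s h1 h2 hi ha hb (groupSize d q m) m
      (M / (2 * groupSize d q m)) M T (Nat.mul_div_le _ _) (hT q (by omega))
      (θ := threshold d X n N q / 4) (by have := threshold_nonneg d X n N q; linarith)
    have hle : ((secretDist n P ν s).iid M).E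
        (fun z => (coin.iid T).E (bad (q, h, t, i, a, b) z)) ≤ 2 * Real.exp
          (-((M / (2 * groupSize d q m) : ℕ) * (threshold d X n N q / 4) ^ 2 / 4)) := by
      refine le_trans (E_mono_of_supp (length_iid _ M) fun z hz => E_mono _ fun c => ?_) key
      simp only [hbad]
      split_ifs with g1 g2
      · exact le_rfl
      · exfalso
        refine g1.2.2.2.2 ?_
        unfold Accurate groupMean
        rw [hz]
        exact not_lt.1 g2
      · exact zero_le_one
      · exact le_rfl
    by_cases hB : 1 ≤ M / (2 * groupSize d q m)
    · refine hle.trans ?_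
      have h6 : (0 : ℝ) < ((n : ℝ) + 1) ^ 6 := by positivity
      have := herr q (by omega) hB
      rw [le_div_iff₀ (by positivity)]
      linarith
    · -- without any group, all counts are zero
      have hB0 : M / (2 * groupSize d q m) = 0 := Nat.lt_one_iff.1 (not_le.1 hB)
      have : ((secretDist n P ν s).iid M).E
          (fun z => (coin.iid T).E (bad (q, h, t, i, a, b) z)) =
          ((secretDist n P ν s).iid M).E fun z => (coin.iid T).E fun _ => 0 := by
        refine E_congr (length_iid _ M) fun z hz => ?_
        congr 1; funext c
        refine if_neg fun g1 => g1.2.2.2.2 ?_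
        unfold Accurate count
        rw [hz, hB0]
        simp [blocks]
      rw [this]
      simp only [E_const]
      positivity
  have hsum : ((secretDist n P ν s).iid M).E (fun z => (coin.iid T).E fun c =>
      ∑ p ∈ I, bad p z c) ≤ 1 / 2 := by
    simp only [E_sum]
    refine (Finset.sum_le_sum herr1).trans ?_
    rw [Finset.sum_const, nsmul_eq_mul, hcard]
    have h6 : (0 : ℝ) < ((n : ℝ) + 1) ^ 6 := by positivity
    rw [le_div_iff₀ (by norm_num)]
    field_simp
    exact le_rfl
  have hprob : 1 / 2 ≤ ((secretDist n P ν s).iid M).E (fun z => (coin.iid T).E fun c =>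
      if good z c then 1 else 0) := by
    have := E_mono ((secretDist n P ν s).iid M) fun z => E_mono (coin.iid T) fun c => hunion z c
    simp only [E_sub, E_const] at this
    linarith
  calc (1 / 4 : ℝ) ≤ 1 / 2 * ((secretDist n P ν s).iid M).E (fun z => (coin.iid T).E fun c =>
        if good z c then 1 else 0) := by linarith
    _ ≤ _ := by
      rw [← E_const_mul]
      refine E_mono_of_supp (length_iid _ M) fun z hz => ?_
      rw [E_iid_add, E_iid_one, E_coin, ← E_const_mul]
      have h1 : ∀ b, 0 ≤ (coin.iid T).E fun c =>
          if search d D X n m N z ([b] ++ c) = (List.range n).map s then (1 : ℝ) else 0 :=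
        fun b => E_nonneg _ fun c => by split <;> norm_num
      have h2 : (coin.iid T).E (fun c => if good z c then (1 : ℝ) else 0) ≤
          (coin.iid T).E fun c =>
            if search d D X n m N z ([s 0] ++ c) = (List.range n).map s then 1 else 0 := by
        refine E_mono _ fun c => ?_
        by_cases hg : good z c
        · rw [if_pos hg, if_pos (by simpa using hcorrect z c hz hg)]
        · rw [if_neg hg]; split <;> norm_num
      rw [E_const_mul]
      cases hs0 : s 0 <;> rw [hs0] at h2 <;> linarith [h1 true, h1 false]

/-! ### The two distributions of the decision problem -/

theorem FinDist.E_iid_zip {α β γ : Type} (μ : FinDist α) (ν : FinDist β) (g : α → β → γ) (k : ℕ)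
    (φ : List γ → ℝ) : ((μ.bind fun a => ν.map (g a)).iid k).E φ =
      (μ.iid k).E fun l => (ν.iid k).E fun l' => φ (List.zipWith g l l') := by
  induction k generalizing φ with
  | zero => simp only [E_iid_zero, List.zipWith_nil_left]
  | succ k ih =>
    simp only [E_iid_succ, E_bind, E_map, ih, List.zipWith_cons_cons]
    congr 1; funext a
    rw [E_comm]

theorem FinDist.E_iid_bern {p : ℝ} (h0 : 0 ≤ p) (h1 : p ≤ 1) (k : ℕ) (φ : List Bool → ℝ) :
    ((bern p h0 h1).iid k).E φ =
      ∑ e : Fin k → Bool, bernWeight p e * φ (List.ofFn e) := by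
  induction k generalizing φ with
  | zero => simp [E_iid_zero, bernWeight]
  | succ k ih =>
    rw [E_iid_succ, ← (Fin.consEquiv fun _ => Bool).sum_comp, Fintype.sum_prod_type]
    change ∑ b : Bool, (if b then p else 1 - p) * _ = _
    refine Finset.sum_congr rfl fun b _ => ?_
    change _ * ((bern p h0 h1).iid k).E (fun l => φ (b :: l)) = _
    rw [ih, Finset.mul_sum]
    refine Finset.sum_congr rfl fun e _ => ?_
    rw [← mul_assoc]
    simp [Fin.consEquiv, bernWeight, Fin.prod_univ_succ, List.ofFn_succ]

/-- A bit string as a function on all natural numbers. -/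
def bitsOf {n : ℕ} (s : Fin n → Bool) (v : ℕ) : Bool := if h : v < n then s ⟨v, h⟩ else false

theorem bitsOf_val {n : ℕ} (s : Fin n → Bool) (v : Fin n) : bitsOf s v = s v := by
  simp [bitsOf]

/-- The samples of a hypergraph with output bits `y`. -/
def samplesOf {n m d : ℕ} (G : Hypergraph n m d) (y : Fin m → Bool) : List Sample :=
  List.ofFn fun i => (List.ofFn fun k => (G i k : ℕ), y i)

theorem predList_ofFn {d : ℕ} (P : (Fin d → Bool) → Bool) (f : Fin d → Bool) :
    predList P (List.ofFn f) = P f := by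
  unfold predList
  congr 1; funext k
  simp

theorem E_iid_vert {n : ℕ} [NeZero n] (d : ℕ) (φ : List ℕ → ℝ) :
    ((vert n).iid d).E φ = (unif (Fin d → Fin n)).E fun S => φ (List.ofFn fun k => (S k : ℕ)) := by
  rw [vert, E_iid_map, E_iid_unif, E_unif]
  simp only [List.map_ofFn]
  rfl

theorem zipWith_ofFn {α β γ : Type} (g : α → β → γ) {k : ℕ} (f : Fin k → α) (e : Fin k → β) :
    List.zipWith g (List.ofFn f) (List.ofFn e) = List.ofFn fun i => g (f i) (e i) := by
  apply List.ext_getElem <;> simp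

/-- Independent samples with noise or labels from a Bernoulli distribution, in terms of uniform
hypergraphs. -/
theorem E_iid_samples {n d : ℕ} [NeZero n] {p : ℝ} (h0 : 0 ≤ p) (h1 : p ≤ 1)
    (μ : FinDist Sample) (g : (Fin d → Fin n) → Bool → Bool)
    (hμ : ∀ φ : Sample → ℝ, μ.E φ = (unif (Fin d → Fin n)).E fun S => (bern p h0 h1).E fun e =>
      φ (List.ofFn fun k => (S k : ℕ), g S e)) (m : ℕ) (φ : List Sample → ℝ) :
    (μ.iid m).E φ = 𝔼 G : Hypergraph n m d, ∑ e : Fin m → Bool,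
      bernWeight p e * φ (samplesOf G fun i => g (G i) (e i)) := by
  rw [iid_E_congr (ν := (unif (Fin d → Fin n)).bind fun S => (bern p h0 h1).map fun e =>
    (List.ofFn fun k => (S k : ℕ), g S e)) (fun ψ => by rw [hμ, E_bind]; rfl), E_iid_zip,
    E_iid_unif]
  refine Finset.expect_congr rfl fun G _ => ?_
  rw [E_iid_bern]
  refine Finset.sum_congr rfl fun e _ => ?_
  rw [zipWith_ofFn]
  rfl

theorem E_iid_secretDist {n d : ℕ} [NeZero n] (P : (Fin d → Bool) → Bool) {δ : ℝ} (h0 : 0 ≤ δ)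
    (h1 : δ ≤ 1) (s : Fin n → Bool) (m : ℕ) (φ : List Sample → ℝ) :
    ((secretDist n P (bern δ h0 h1) (bitsOf s)).iid m).E φ =
      𝔼 G : Hypergraph n m d, ∑ e : Fin m → Bool,
        bernWeight δ e * φ (samplesOf G (noisyFun P G s e)) := by
  refine E_iid_samples h0 h1 _ (fun S e => xor (P fun k => s (S k)) e) (fun ψ => ?_) m φ
  rw [E_secretDist, E_iid_vert]
  congr 1; funext S; congr 1; funext e
  rw [List.map_ofFn, predList_ofFn]
  rw [show (bitsOf s ∘ fun k => (S k : ℕ)) = fun k => s (S k) from funext fun k => bitsOf_val s _]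

theorem noisyBias_mem {d : ℕ} (P : (Fin d → Bool) → Bool) {δ : ℝ} (h0 : 0 ≤ δ) (h1 : δ ≤ 1) :
    0 ≤ noisyBias P δ ∧ noisyBias P δ ≤ 1 :=
  ⟨Finset.expect_nonneg fun _ _ => by split <;> linarith,
    Finset.expect_le Finset.univ_nonempty fun _ _ => by split <;> linarith⟩

/-- If all bits are fair coins, then the label of a sample is independent of the hyperedge. -/
theorem E_sampleDist_coin {n d : ℕ} [NeZero n] (P : (Fin d → Bool) → Bool) {δ : ℝ} (h0 : 0 ≤ δ)
    (h1 : δ ≤ 1) (φ : Sample → ℝ) :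
    (sampleDist n P (bern δ h0 h1) fun _ => coin).E φ = ((vert n).iid d).E fun S =>
      (bern (noisyBias P δ) (noisyBias_mem P h0 h1).1 (noisyBias_mem P h0 h1).2).E fun b =>
        φ (S, b) := by
  rw [E_sampleDist, vertBit, E_iid_zip]
  refine E_congr (length_iid _ d) fun S hS => ?_
  have : (coin.iid d).E (fun l => (bern δ h0 h1).E fun e =>
      φ ((List.zipWith Prod.mk S l).map Prod.fst,
        xor (predList P ((List.zipWith Prod.mk S l).map Prod.snd)) e)) =
      (coin.iid d).E fun l => (bern δ h0 h1).E fun e => φ (S, xor (predList P l) e) := by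
    refine E_congr (length_iid _ d) fun l hl => ?_
    rw [← List.zip, List.map_fst_zip (by omega), List.map_snd_zip (by omega)]
  refine this.trans ?_
  rw [coin, E_iid_unif, E_bern, noisyBias]
  simp only [predList_ofFn, E_bern]
  have : ∀ f : Fin d → Bool, δ * φ (S, xor (P f) true) + (1 - δ) * φ (S, xor (P f) false) =
      φ (S, false) + (if P f then 1 - δ else δ) * (φ (S, true) - φ (S, false)) := by
    intro f
    cases P f <;> simp <;> ring
  simp only [this, Finset.expect_add_distrib, ← Finset.expect_mul]
  rw [Finset.expect_const Finset.univ_nonempty]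
  ring

theorem decisionInput_eq {n m d : ℕ} (G : Hypergraph n m d) (y : Fin m → Bool) :
    decisionInput G y = enc (toInst n (samplesOf G y)) := by
  unfold toInst samplesOf
  rw [List.map_ofFn, List.map_ofFn]
  change Data.cons _ (Data.cons _ _) = Data.cons _ (Data.cons _ _)
  rw [encodeGraph_eq, ← enc_ofFn_bits]
  rfl

/-- The advantage is the mean, over the secret, of the difference of the extreme hybrids. -/
theorem decisionAdvantage_eq {n d : ℕ} [NeZero n] (P : (Fin d → Bool) → Bool) {δ : ℝ}
    (h0 : 0 ≤ δ) (h1 : δ ≤ 1) (D : RandAlg) (m : ℕ) :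
    decisionAdvantage P δ D n m = 𝔼 s : Fin n → Bool,
      (acc D n P (bern δ h0 h1) m (fun v => pure (bitsOf s v)) -
        acc D n P (bern δ h0 h1) m fun _ => coin) := by
  have hr : acc D n P (bern δ h0 h1) m (fun _ => coin) = 𝔼 G : Hypergraph n m d,
      ∑ b : Fin m → Bool, bernWeight (noisyBias P δ) b *
        D.outputProb (decisionInput G b) (.ofBool true) := by
    unfold acc
    rw [E_iid_samples (noisyBias_mem P h0 h1).1 (noisyBias_mem P h0 h1).2 _ (fun _ b => b)
      fun φ => by rw [E_sampleDist_coin, E_iid_vert]]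
    simp only [decisionInput_eq]
  have hs : ∀ s : Fin n → Bool, acc D n P (bern δ h0 h1) m (fun v => pure (bitsOf s v)) =
      𝔼 G : Hypergraph n m d, ∑ e : Fin m → Bool, bernWeight δ e *
        D.outputProb (decisionInput G (noisyFun P G s e)) (.ofBool true) := by
    intro s
    unfold acc
    rw [E_iid_secretDist]
    simp only [decisionInput_eq]
  rw [Finset.expect_sub_distrib, Finset.expect_const Finset.univ_nonempty, hr, decisionAdvantage,
    Finset.expect_comm]
  simp only [hs]

/-- The hybrid argument: two consecutive hybrids differ by a fraction `1 / n` of the difference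
of the extreme ones. -/
theorem exists_hybrid_gap (D : RandAlg) {n : ℕ} [NeZero n] {d : ℕ} (P : (Fin d → Bool) → Bool)
    (ν : FinDist Bool) (m : ℕ) (s : ℕ → Bool) :
    ∃ i < n, (acc D n P ν m (fun v => pure (s v)) - acc D n P ν m fun _ => coin) / n ≤
      |acc D n P ν m (hybrid s i coin (pure (s i))) - acc D n P ν m (hybrid s i coin coin)| := by
  have hn : (0 : ℝ) < n := by exact_mod_cast Nat.pos_of_ne_zero (NeZero.ne n)
  set H : ℕ → ℝ := fun i => acc D n P ν m fun v => if v < i then coin else pure (s v) with hH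
  have e1 : ∀ i, acc D n P ν m (hybrid s i coin (pure (s i))) = H i := fun i =>
    acc_congr D P ν m fun v _ φ => by
      unfold hybrid
      by_cases h1 : v < i
      · simp [h1]
      · by_cases h2 : v = i <;> simp [h1, h2]
  have e2 : ∀ i, acc D n P ν m (hybrid s i coin coin) = H (i + 1) := fun i =>
    acc_congr D P ν m fun v _ φ => by
      unfold hybrid
      by_cases h1 : v < i
      · simp [h1, Nat.lt_succ_of_lt h1]
      · by_cases h2 : v = i
        · simp [h2]
        · rw [if_neg h1, if_neg h2, if_neg (by omega)]
  have e3 : acc D n P ν m (fun v => pure (s v)) = H 0 := by simp [hH]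
  have e4 : (acc D n P ν m fun _ => coin) = H n := acc_congr D P ν m fun v hv φ => by simp [hv]
  by_contra! hcon
  simp only [e1, e2, e3, e4] at hcon
  have h1 : ∑ i ∈ Finset.range n, (H i - H (i + 1)) < ∑ i ∈ Finset.range n, (H 0 - H n) / n :=
    Finset.sum_lt_sum_of_nonempty (Finset.nonempty_range_iff.2 (NeZero.ne n)) fun i hi =>
      (le_abs_self _).trans_lt (hcon i (Finset.mem_range.1 hi))
  rw [Finset.sum_range_sub', Finset.sum_const, Finset.card_range, nsmul_eq_mul,
    mul_div_cancel₀ _ hn.ne'] at h1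
  exact lt_irrefl _ h1

/-! ### Balanced windows -/

/-- Bits as signs. -/
def sign (b : Bool) : ℤ := if b then 1 else -1

/-- The difference between the numbers of ones and zeros of `s` in the window `[t, t + L)`. -/
def imbalance (s : ℕ → Bool) (t L : ℕ) : ℤ := ∑ u ∈ Finset.range L, sign (s (t + u))

theorem even_imbalance (s : ℕ → Bool) (t h : ℕ) : Even (imbalance s t (2 * h)) := by
  have e : ∀ b, sign b = 1 - 2 * (if b then 0 else 1) := by decide
  unfold imbalance
  simp only [e, Finset.sum_sub_distrib, ← Finset.mul_sum]
  rw [Finset.sum_const, Finset.card_range, nsmul_eq_mul, mul_one]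
  push_cast
  exact (even_two_mul _).sub (even_two_mul _)

theorem imbalance_succ (s : ℕ → Bool) (t L : ℕ) :
    imbalance s (t + 1) L = imbalance s t L + sign (s (t + L)) - sign (s t) := by
  have h1 := Finset.sum_range_succ (fun u => sign (s (t + u))) L
  have h2 := Finset.sum_range_succ' (fun u => sign (s (t + u))) L
  unfold imbalance
  simp only [Nat.add_right_comm t 1, add_assoc] at *
  rw [h1] at h2
  simp only [add_zero] at h2
  linarith

theorem windowDist_E_eq_coin {s : ℕ → Bool} {t h : ℕ} (hh : 1 ≤ h)
    (hb : imbalance s t (2 * h) = 0) (φ : Bool → ℝ) : (windowDist s t h).E φ = coin.E φ := by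
  have hh' : (0 : ℝ) < h := by exact_mod_cast hh
  have e : ∀ b, φ b = (φ true + φ false) / 2 + (φ true - φ false) / 2 * (sign b : ℝ) := by
    intro b; cases b <;> simp [sign] <;> ring
  rw [E_windowDist s t (by omega), E_coin]
  have h1 : ∑ j ∈ Finset.range (2 * h), φ (s (t + j)) = 2 * h * ((φ true + φ false) / 2) := by
    rw [Finset.sum_congr rfl fun j _ => e (s (t + j)), Finset.sum_add_distrib, ← Finset.mul_sum,
      Finset.sum_const, Finset.card_range, nsmul_eq_mul]
    have : ∑ j ∈ Finset.range (2 * h), (sign (s (t + j)) : ℝ) = 0 := by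
      have := congrArg (Int.cast : ℤ → ℝ) hb
      simpa [imbalance] using this
    rw [this]; push_cast; ring
  rw [h1]
  field_simp

/-- No window of length `2 ⌊n / (2 k)⌋` is balanced. -/
def Unbalanced (n k : ℕ) (s : ℕ → Bool) : Prop :=
  ∀ t, t + 2 * (n / (2 * k)) ≤ n → imbalance s t (2 * (n / (2 * k))) ≠ 0

/-- Discrete intermediate value theorem: without balanced windows, all windows are unbalanced in
the same direction. -/
theorem Unbalanced.same_sign {n k : ℕ} {s : ℕ → Bool} (hs : Unbalanced n k s) :
    (∀ t, t + 2 * (n / (2 * k)) ≤ n → imbalance s t (2 * (n / (2 * k))) < 0) ∨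
      ∀ t, t + 2 * (n / (2 * k)) ≤ n → 0 < imbalance s t (2 * (n / (2 * k))) := by
  unfold Unbalanced at hs
  generalize n / (2 * k) = h at *
  have sb : ∀ b, -1 ≤ sign b ∧ sign b ≤ 1 := by decide
  have step : ∀ t, |imbalance s (t + 1) (2 * h) - imbalance s t (2 * h)| ≤ 2 := by
    intro t
    rw [imbalance_succ, abs_le]
    have := sb (s (t + 2 * h)); have := sb (s t)
    constructor <;> linarith
  by_cases h0 : 2 * h ≤ n
  swap
  · exact Or.inl fun t ht => by omega
  rcases lt_or_gt_of_ne (hs 0 (by omega)) with hneg | hpos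
  · left
    intro t
    induction t with
    | zero => exact fun _ => hneg
    | succ t ih =>
      intro ht
      have h1 := ih (by omega)
      have h2 := hs (t + 1) ht
      have h3 := abs_le.1 (step t)
      obtain ⟨a, ha⟩ := even_imbalance s t h
      obtain ⟨b, hb⟩ := even_imbalance s (t + 1) h
      omega
  · right
    intro t
    induction t with
    | zero => exact fun _ => hpos
    | succ t ih =>
      intro ht
      have h1 := ih (by omega)
      have h2 := hs (t + 1) ht
      have h3 := abs_le.1 (step t)
      obtain ⟨a, ha⟩ := even_imbalance s t h
      obtain ⟨b, hb⟩ := even_imbalance s (t + 1) h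
      omega

/-- A nonconstant string has a balanced window of length 2. -/
theorem Unbalanced.const {n : ℕ} {s : ℕ → Bool} (hs : Unbalanced n (n / 2) s) (hn : 2 ≤ n) :
    ∀ a < n, s a = s 0 := by
  have h1 : n / (2 * (n / 2)) = 1 := by
    rw [Nat.div_eq_iff (by omega)]; omega
  intro a
  induction a with
  | zero => exact fun _ => rfl
  | succ a ih =>
    intro ha
    have := hs a (by rw [h1]; omega)
    rw [h1] at this
    rw [← ih (by omega)]
    simp only [imbalance, Finset.sum_range_succ, Finset.sum_range_zero] at this
    revert this
    simp only [add_zero, zero_add]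
    cases s a <;> cases s (a + 1) <;> simp [sign]

/-- The string `s`, with the bits flipped in those blocks of length `L` that `T` selects. -/
def flipBlocks {n k : ℕ} (L : ℕ) (s : Fin n → Bool) (T : Fin k → Bool) (v : Fin n) : Bool :=
  xor (s v) (bitsOf T (v / L))

theorem imbalance_flipBlocks {n k L : ℕ} (hL : 0 < L) (hk : L * k ≤ n) (s : Fin n → Bool)
    (T : Fin k → Bool) (j : Fin k) :
    imbalance (bitsOf (flipBlocks L s T)) (L * j) L =
      -sign (T j) * imbalance (bitsOf s) (L * j) L := by
  unfold imbalance
  rw [Finset.mul_sum]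
  refine Finset.sum_congr rfl fun u hu => ?_
  rw [Finset.mem_range] at hu
  have hv : L * j + u < n := by
    have : L * (j + 1) ≤ L * k := Nat.mul_le_mul_left L j.2
    rw [Nat.mul_add] at this
    omega
  have e := bitsOf_val (flipBlocks L s T) ⟨_, hv⟩
  have e' := bitsOf_val s ⟨_, hv⟩
  have ed : (L * j + u) / L = j := by
    rw [Nat.mul_add_div hL, Nat.div_eq_of_lt hu, add_zero]
  simp only [flipBlocks, ed, bitsOf_val T j] at e
  simp only at e'
  rw [e, e']
  cases s ⟨L * j + u, hv⟩ <;> cases T j <;> decide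

open Classical in
/-- At most a fraction `2⁻ᵏ` of all strings has `k` disjoint blocks that are unbalanced in the same
direction. -/
theorem card_same_sign_le {n k L : ℕ} (hL : 0 < L) (hk : L * k ≤ n) (σ : ℤ) :
    (Finset.univ.filter fun s : Fin n → Bool =>
      ∀ j : Fin k, 0 < σ * imbalance (bitsOf s) (L * j) L).card * 2 ^ k ≤ 2 ^ n := by
  set A := Finset.univ.filter fun s : Fin n → Bool =>
      ∀ j : Fin k, 0 < σ * imbalance (bitsOf s) (L * j) L with hA
  have h1 : (A ×ˢ (Finset.univ : Finset (Fin k → Bool))).card ≤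
      (Finset.univ : Finset (Fin n → Bool)).card := by
    refine Finset.card_le_card_of_injOn (fun p => flipBlocks L p.1 p.2)
      (fun _ _ => Finset.mem_univ _) ?_
    rintro ⟨s, T⟩ hs ⟨s', T'⟩ hs' heq
    simp only [Finset.coe_product, Set.mem_prod, Finset.mem_coe, hA, Finset.mem_filter,
      Finset.mem_univ, true_and] at hs hs'
    simp only at heq
    -- the flipped blocks are the ones that are unbalanced in the other direction
    have hT : T = T' := by
      funext j
      have e1 := imbalance_flipBlocks hL hk s T j
      have e2 := imbalance_flipBlocks hL hk s' T' j
      rw [heq, e2] at e1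
      have p1 := hs.1 j
      have p2 := hs'.1 j
      by_contra hne
      have : imbalance (bitsOf s') (L * j) L = -imbalance (bitsOf s) (L * j) L := by
        revert e1 hne
        cases T j <;> cases T' j <;> simp only [sign, if_true, if_false, Bool.false_eq_true,
          ne_eq, not_true_eq_false, false_implies, implies_true] <;> intros <;> linarith
      rw [this, mul_neg] at p2
      linarith
    subst hT
    refine Prod.ext (funext fun v => ?_) rfl
    have := congrFun heq v
    simpa [flipBlocks] using this
  rw [Finset.card_product] at h1
  simpa using h1

open Classical in
/-- For random strings it is unlikely that there is no balanced window of a given length. -/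
theorem expect_unbalanced_le {n k : ℕ} (hk : 2 * k ≤ n) :
    (𝔼 s : Fin n → Bool, if k = 0 ∨ Unbalanced n k (bitsOf s) then (1 : ℝ) else 0) ≤
      2 * (1 / 2) ^ k := by
  rcases Nat.eq_zero_or_pos k with rfl | hk0
  · simp
  have hh : 1 ≤ n / (2 * k) := (Nat.one_le_div_iff (by omega)).2 hk
  set L := 2 * (n / (2 * k)) with hL
  have hLk : L * k ≤ n := by
    have := Nat.mul_div_le n (2 * k)
    calc L * k = 2 * k * (n / (2 * k)) := by rw [hL]; ring
      _ ≤ n := this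
  have hblock : ∀ j : Fin k, L * j + L ≤ n := fun j => by
    have : L * (j + 1) ≤ L * k := Nat.mul_le_mul_left L j.2
    rw [Nat.mul_add] at this
    omega
  have hle : ∀ s : Fin n → Bool,
      (if k = 0 ∨ Unbalanced n k (bitsOf s) then (1 : ℝ) else 0) ≤
      (if ∀ j : Fin k, 0 < (1 : ℤ) * imbalance (bitsOf s) (L * j) L then 1 else 0) +
        if ∀ j : Fin k, 0 < (-1 : ℤ) * imbalance (bitsOf s) (L * j) L then 1 else 0 := by
    intro s
    have n0 : ∀ σ : ℤ, (0 : ℝ) ≤ if ∀ j : Fin k, 0 < σ * imbalance (bitsOf s) (L * j) L then 1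
      else 0 := fun σ => by split <;> norm_num
    have n1 : ∀ σ : ℤ, (∀ j : Fin k, 0 < σ * imbalance (bitsOf s) (L * j) L) →
        (if ∀ j : Fin k, 0 < σ * imbalance (bitsOf s) (L * j) L then (1 : ℝ) else 0) = 1 :=
      fun σ h => if_pos h
    by_cases hs : Unbalanced n k (bitsOf s)
    · rw [if_pos (Or.inr hs)]
      rcases hs.same_sign with h | h
      · linarith [n0 1, n1 (-1) fun j => by linarith [h _ (hblock j)]]
      · linarith [n0 (-1), n1 1 fun j => by linarith [h _ (hblock j)]]
    · rw [if_neg (by simp [hs]; omega)]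
      linarith [n0 1, n0 (-1)]
  have hcard : ∀ σ : ℤ, (𝔼 s : Fin n → Bool,
      if ∀ j : Fin k, 0 < σ * imbalance (bitsOf s) (L * j) L then (1 : ℝ) else 0) ≤
      (1 / 2) ^ k := by
    intro σ
    have := card_same_sign_le (by omega) hLk σ
    rw [Fintype.expect_eq_sum_div_card, Finset.sum_boole, Fintype.card_fun, Fintype.card_bool,
      Fintype.card_fin, div_le_iff₀ (by positivity), one_div, inv_pow, inv_mul_eq_div,
      le_div_iff₀ (by positivity)]
    exact_mod_cast this
  refine (Finset.expect_le_expect fun s _ => hle s).trans ?_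
  rw [Finset.expect_add_distrib]
  linarith [hcard 1, hcard (-1)]

/-! ### Averaging over the secret -/

/-- Polynomial losses are dominated by the exponentially small fractions of strings without balanced
windows. -/
theorem exists_weight (d : ℕ) : ∃ W : ℕ, 0 < W ∧ ∀ k : ℕ,
    ∑ j ∈ Finset.range k, (8 * ((j : ℝ) + 1)) ^ d * (2 * (1 / 2) ^ j) ≤ W := by
  have h := summable_pow_mul_geometric_of_norm_lt_one d
    (show ‖(1 / 2 : ℝ)‖ < 1 by rw [Real.norm_of_nonneg] <;> norm_num)
  have h1 : Summable fun j : ℕ => (8 * ((j : ℝ) + 1)) ^ d * (2 * (1 / 2) ^ j) := by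
    have h2 := ((summable_nat_add_iff 1).2 h).mul_left (8 ^ d * 4 : ℝ)
    refine h2.congr fun j => ?_
    rw [mul_pow, pow_succ (1 / 2 : ℝ)]
    push_cast
    ring
  refine ⟨⌈∑' j : ℕ, (8 * ((j : ℝ) + 1)) ^ d * (2 * (1 / 2) ^ j)⌉₊ + 1, Nat.succ_pos _,
    fun k => ?_⟩
  refine (h1.sum_le_tsum _ fun j _ => by positivity).trans ((Nat.le_ceil _).trans ?_)
  push_cast
  linarith

/-- The gap between the extreme hybrids for the secret `s`. -/
noncomputable def gap (D : RandAlg) (n : ℕ) [NeZero n] {d : ℕ} (P : (Fin d → Bool) → Bool)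
    (ν : FinDist Bool) (m : ℕ) (s : ℕ → Bool) : ℝ :=
  acc D n P ν m (fun v => pure (s v)) - acc D n P ν m fun _ => coin

/-- The secrets that the search algorithm finds: the constant ones, and those for which the gap
between the extreme hybrids is large compared to the cost of simulating fair coins by a balanced
window. -/
def Findable (D : RandAlg) (n : ℕ) [NeZero n] {d : ℕ} (P : (Fin d → Bool) → Bool)
    (ν : FinDist Bool) (m W : ℕ) (ε : ℝ) (s : ℕ → Bool) : Prop :=
  (∀ a < n, s a = s 0) ∨ ∃ k : ℕ, 1 ≤ k ∧ 2 * k ≤ n ∧ ¬ Unbalanced n k s ∧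
    ε * (8 * k) ^ d ≤ 2 * W * gap D n P ν m s

section
variable {D : RandAlg} {n : ℕ} [NeZero n] {d : ℕ} {P : (Fin d → Bool) → Bool} {ν : FinDist Bool}
  {m W : ℕ} {ε : ℝ}

theorem gap_le_one (s : ℕ → Bool) : gap D n P ν m s ≤ 1 := by
  unfold gap
  linarith [acc_le_one D n P ν m fun v => pure (s v), acc_nonneg D n P ν m fun _ => coin]

open Classical in
/-- A secret that is not findable has a small gap or no long balanced window. -/
theorem gap_le (hn : 2 ≤ n) (hε : 0 < ε) (hW : 0 < W) (s : ℕ → Bool) :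
    gap D n P ν m s ≤ (if Findable D n P ν m W ε s then 1 else 0) +
      ∑ j ∈ Finset.range (n / 2), ε / (2 * W) * ((8 * ((j : ℝ) + 1)) ^ d *
        if j = 0 ∨ Unbalanced n j s then 1 else 0) := by
  have hW' : (0 : ℝ) < W := by exact_mod_cast hW
  have h0 : ∀ j ∈ Finset.range (n / 2), 0 ≤ ε / (2 * W) * ((8 * ((j : ℝ) + 1)) ^ d *
      if j = 0 ∨ Unbalanced n j s then (1 : ℝ) else 0) := fun j _ => by
    have : (0 : ℝ) ≤ if j = 0 ∨ Unbalanced n j s then (1 : ℝ) else 0 := by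
      split <;> norm_num
    positivity
  by_cases hs : Findable D n P ν m W ε s
  · rw [if_pos hs]
    linarith [gap_le_one (D := D) (n := n) (P := P) (ν := ν) (m := m) s, Finset.sum_nonneg h0]
  · have hex : ∃ k, 1 ≤ k ∧ ¬ Unbalanced n k s :=
      ⟨n / 2, by omega, fun h => hs (Or.inl (h.const hn))⟩
    -- the least `k` for which there is a balanced window
    obtain ⟨hk1, hk2⟩ := Nat.find_spec hex
    have hkn : Nat.find hex ≤ n / 2 :=
      Nat.find_min' hex ⟨by omega, fun h => hs (Or.inl (h.const hn))⟩
    obtain ⟨j, hj⟩ := Nat.exists_eq_add_of_le hk1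
    have hprev : j = 0 ∨ Unbalanced n j s := by
      by_contra! hcon
      exact Nat.find_min hex (m := j) (by omega) ⟨by omega, hcon.2⟩
    rw [hj] at hk2 hkn
    have hgap : 2 * W * gap D n P ν m s < ε * (8 * ((1 + j : ℕ) : ℝ)) ^ d := by
      by_contra! hcon
      exact hs (Or.inr ⟨1 + j, by omega, by omega, hk2, hcon⟩)
    have hle := Finset.single_le_sum h0 (Finset.mem_range.2 (show j < n / 2 by omega))
    rw [if_pos hprev, mul_one] at hle
    rw [if_neg hs, zero_add]
    refine le_trans ?_ hle
    rw [div_mul_eq_mul_div, le_div_iff₀ (by positivity)]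
    push_cast at hgap
    rw [add_comm (j : ℝ) 1]
    linarith

open Classical in
/-- Secrets without long balanced windows are so rare that findable ones have to contribute half
of the advantage. -/
theorem half_le_expect_findable (hn : 2 ≤ n) (hε : 0 < ε) (hW : 0 < W)
    (hWsum : ∀ k : ℕ, ∑ j ∈ Finset.range k, (8 * ((j : ℝ) + 1)) ^ d * (2 * (1 / 2) ^ j) ≤ W)
    (hadv : ε ≤ 𝔼 s : Fin n → Bool, gap D n P ν m (bitsOf s)) :
    ε / 2 ≤ 𝔼 s : Fin n → Bool, if Findable D n P ν m W ε (bitsOf s) then (1 : ℝ) else 0 := by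
  have hW' : (0 : ℝ) < W := by exact_mod_cast hW
  have h1 := Finset.expect_le_expect (s := Finset.univ) fun (s : Fin n → Bool) _ =>
    gap_le (D := D) (P := P) (ν := ν) (m := m) hn hε hW (bitsOf s)
  rw [Finset.expect_add_distrib, Finset.expect_sum_comm] at h1
  have h2 : ∑ j ∈ Finset.range (n / 2), (𝔼 s : Fin n → Bool, ε / (2 * W) *
      ((8 * ((j : ℝ) + 1)) ^ d * if j = 0 ∨ Unbalanced n j (bitsOf s) then 1 else 0)) ≤
      ∑ j ∈ Finset.range (n / 2), ε / (2 * W) *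
        ((8 * ((j : ℝ) + 1)) ^ d * (2 * (1 / 2) ^ j)) := by
    refine Finset.sum_le_sum fun j hj => ?_
    rw [Finset.mem_range] at hj
    rw [← Finset.mul_expect, ← Finset.mul_expect]
    have := expect_unbalanced_le (n := n) (k := j) (by omega)
    gcongr
  rw [← Finset.mul_sum] at h2
  have h3 : ε / (2 * W) * ∑ j ∈ Finset.range (n / 2),
      (8 * ((j : ℝ) + 1)) ^ d * (2 * (1 / 2) ^ j) ≤ ε / 2 := by
    refine (mul_le_mul_of_nonneg_left (hWsum _) (by positivity)).trans (le_of_eq ?_)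
    field_simp
  linarith

end

/-! ### The number of samples -/

theorem half_le_log {n : ℕ} {ε : ℝ} (hn : 2 ≤ n) (hε : 0 < ε) (hε1 : ε ≤ 1) :
    1 / 2 ≤ Real.log (n / ε) ∧ Real.log n ≤ Real.log (n / ε) := by
  have hn' : (2 : ℝ) ≤ n := by exact_mod_cast hn
  have h1 : (n : ℝ) ≤ n / ε := by
    rw [le_div_iff₀ hε]; nlinarith
  have h2 : Real.log 2 ≤ Real.log n := Real.log_le_log (by norm_num) hn'
  have h3 : Real.log n ≤ Real.log (n / ε) := Real.log_le_log (by linarith) h1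
  have := Real.log_two_gt_d9
  exact ⟨by linarith, h3⟩

/-- There are enough groups of samples for the parameter `q = 2 k` of a findable secret. -/
theorem one_le_groups {n m d W : ℕ} {ε : ℝ} (hn : 2 ≤ n) (hm : 1 ≤ m) (hε : 0 < ε) (hε1 : ε ≤ 1)
    (hW : 0 < W) {k : ℕ} (hk1 : 1 ≤ k) (hk : ε * (8 * k) ^ d ≤ 2 * W) {C : ℝ} (hC : 2 ^ 20 * W ≤ C) :
    1 ≤ ⌊C * m * (n / ε) ^ 2 * Real.log (n / ε) ^ 3⌋₊ / (2 * groupSize d (2 * k) m) := by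
  have hR : 0 < 2 * groupSize d (2 * k) m := by unfold groupSize; positivity
  rw [Nat.one_le_div_iff hR]
  refine Nat.le_floor ?_
  have hL := (half_le_log hn hε hε1).1
  have hL3 : 1 / 8 ≤ Real.log (n / ε) ^ 3 := by
    have := pow_le_pow_left₀ (by norm_num) hL 3
    linarith
  have hn' : (2 : ℝ) ≤ n := by exact_mod_cast hn
  have hW' : (1 : ℝ) ≤ W := by exact_mod_cast hW
  have hq : 4 / ε ≤ (n / ε) ^ 2 := by
    rw [div_pow, div_le_div_iff₀ hε (by positivity)]
    have h1 : ε ^ 2 ≤ ε := by nlinarith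
    have h2 : (4 : ℝ) ≤ n ^ 2 := by nlinarith
    nlinarith
  have h1 : (8 * (k : ℝ)) ^ d ≤ 2 * W / ε := by
    rw [le_div_iff₀ hε]; linarith
  have hm' : (0 : ℝ) ≤ m := Nat.cast_nonneg m
  have hC0 : 0 ≤ C := le_trans (by positivity) hC
  unfold groupSize
  push_cast
  calc (2 * (8 * m * (4 * (2 * k)) ^ d) : ℝ) = 16 * m * (8 * k) ^ d := by
        rw [show (4 * (2 * k) : ℝ) = 8 * k by ring]; ring
    _ ≤ 16 * m * (2 * W / ε) := by gcongr
    _ ≤ 2 ^ 20 * W * m * (4 / ε) * (1 / 8) := by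
        have : 0 ≤ m * (W / ε) := by positivity
        calc (16 * m * (2 * W / ε) : ℝ) = 32 * (m * (W / ε)) := by ring
          _ ≤ 2 ^ 19 * (m * (W / ε)) := by nlinarith
          _ = _ := by ring
    _ ≤ _ := by gcongr

/-- The union bound over all counts. -/
theorem union_bound_le {n m d : ℕ} {ε : ℝ} (hn : 2 ≤ n) (hm : 1 ≤ m) (hε : 0 < ε)
    (hε1 : ε ≤ 1) {X q : ℕ} (hX : 0 < X) {C : ℝ} (hC : 2 ^ 20 * (X : ℝ) ^ 2 ≤ C) {B : ℕ}
    (hB : B = ⌊C * m * (n / ε) ^ 2 * Real.log (n / ε) ^ 3⌋₊ / (2 * groupSize d q m))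
    (hB1 : 1 ≤ B) :
    2 * ((n : ℝ) + 1) ^ 6 * Real.exp (-(B * (threshold d X n ⌈1 / ε⌉₊ q / 4) ^ 2 / 4)) ≤
      1 / 2 := by
  obtain ⟨hL, hLn⟩ := half_le_log hn hε hε1
  set L := Real.log (n / ε) with hLdef
  set y := C * m * (n / ε) ^ 2 * L ^ 3 with hy
  set R := groupSize d q m with hR
  have hn' : (2 : ℝ) ≤ n := by exact_mod_cast hn
  have hm' : (1 : ℝ) ≤ m := by exact_mod_cast hm
  have hX' : (1 : ℝ) ≤ X := by exact_mod_cast hX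
  have hB1' : (1 : ℝ) ≤ B := by exact_mod_cast hB1
  have hR0 : 0 < R := by
    rcases Nat.eq_zero_or_pos R with h | h
    · rw [h] at hB; simp at hB; omega
    · exact h
  have hρ : (1 : ℝ) ≤ (4 * q) ^ d := by
    have : 0 < (4 * q) ^ d := by
      rcases Nat.eq_zero_or_pos ((4 * q) ^ d) with h | h
      · rw [hR, groupSize, h] at hR0; simp at hR0
      · exact h
    exact_mod_cast this
  have hyB : y ≤ 4 * R * B := by
    have h1 := Nat.lt_floor_add_one y
    have h2 : ⌊y⌋₊ < 2 * R * (B + 1) := by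
      rw [hB]; exact Nat.lt_mul_div_succ _ (by omega)
    have h3 : (⌊y⌋₊ : ℝ) + 1 ≤ 2 * R * (B + 1) := by exact_mod_cast h2
    have : (0 : ℝ) ≤ R := Nat.cast_nonneg R
    nlinarith
  have hRc : (R : ℝ) = 8 * m * (4 * q) ^ d := by rw [hR, groupSize]; push_cast; rfl
  unfold threshold
  generalize ((4 : ℝ) * q) ^ d = ρ at hρ hRc ⊢
  have hN : (⌈1 / ε⌉₊ : ℝ) ≤ 2 / ε := by
    have h1 := (Nat.ceil_lt_add_one (show 0 ≤ 1 / ε by positivity)).le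
    have h2 : 1 ≤ 1 / ε := by rwa [le_div_iff₀ hε, one_mul]
    calc (⌈1 / ε⌉₊ : ℝ) ≤ 1 / ε + 1 / ε := by linarith
      _ = 2 / ε := by ring
  have hN0 : (0 : ℝ) < ⌈1 / ε⌉₊ := by exact_mod_cast Nat.ceil_pos.2 (by positivity)
  have hu : (X : ℝ) * ⌈1 / ε⌉₊ * n ≤ 2 * X * (n / ε) := by
    calc (X : ℝ) * ⌈1 / ε⌉₊ * n ≤ X * (2 / ε) * n := by gcongr
      _ = _ := by ring
  have hu0 : 0 < (X : ℝ) * ⌈1 / ε⌉₊ * n := by positivity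
  generalize (X : ℝ) * ⌈1 / ε⌉₊ * n = u at hu hu0 ⊢
  have hu2 : u ^ 2 ≤ 4 * X ^ 2 * (n / ε) ^ 2 := by
    calc u ^ 2 ≤ (2 * X * (n / ε)) ^ 2 := pow_le_pow_left₀ hu0.le hu 2
      _ = _ := by ring
  have hL3 : L / 4 ≤ L ^ 3 := by
    have : (1 / 2 : ℝ) ^ 2 ≤ L ^ 2 := pow_le_pow_left₀ (by norm_num) hL 2
    nlinarith
  have hL0 : 0 ≤ L ^ 3 := by linarith
  have h1 : 2 ^ 13 * (u ^ 2 * L ^ 3) ≤ ρ * B := by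
    have h2 : 2 ^ 20 * X ^ 2 * ((n / ε) ^ 2 * L ^ 3) ≤ 32 * (ρ * B) := by
      have h3 : m * (C * ((n / ε) ^ 2 * L ^ 3)) ≤ m * (32 * (ρ * B)) := by
        rw [hy, hRc] at hyB; linarith
      exact (mul_le_mul_of_nonneg_right hC (by positivity)).trans
        (le_of_mul_le_mul_left h3 (by linarith))
    have h4 := mul_le_mul_of_nonneg_right hu2 hL0
    linarith
  -- the exponent `14` suffices because `4 (n + 1) ^ 6 ≤ n ^ 14` for `n ≥ 2`
  have key : 14 * Real.log n ≤ B * (ρ / u / 4) ^ 2 / 4 := by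
    have h5 : B * (ρ / u / 4) ^ 2 / 4 = ρ * B * ρ / (64 * u ^ 2) := by
      field_simp; norm_num
    rw [h5, le_div_iff₀ (by positivity)]
    have h6 : 14 * Real.log n ≤ 128 * L ^ 3 := by linarith
    calc 14 * Real.log n * (64 * u ^ 2) ≤ 128 * L ^ 3 * (64 * u ^ 2) := by gcongr
      _ = 2 ^ 13 * (u ^ 2 * L ^ 3) := by ring
      _ ≤ ρ * B := h1
      _ ≤ ρ * B * ρ := le_mul_of_one_le_right (by positivity) hρ
  have hexp : Real.exp (-(B * (ρ / u / 4) ^ 2 / 4)) ≤ ((n : ℝ) ^ 14)⁻¹ := by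
    calc Real.exp (-(B * (ρ / u / 4) ^ 2 / 4)) ≤ Real.exp (-(14 * Real.log n)) :=
          Real.exp_le_exp.2 (by linarith)
      _ = ((n : ℝ) ^ 14)⁻¹ := by
          rw [Real.exp_neg, show (14 : ℝ) = (14 : ℕ) by norm_num, Real.exp_nat_mul,
            Real.exp_log (by linarith)]
  have hpow : 4 * ((n : ℝ) + 1) ^ 6 ≤ n ^ 14 := by
    calc 4 * ((n : ℝ) + 1) ^ 6 ≤ (n : ℝ) ^ 2 * ((n : ℝ) ^ 2) ^ 6 := by
          gcongr
          · nlinarith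
          · nlinarith
      _ = (n : ℝ) ^ 14 := by ring
  calc 2 * ((n : ℝ) + 1) ^ 6 * Real.exp (-(B * (ρ / u / 4) ^ 2 / 4)) ≤
        2 * ((n : ℝ) + 1) ^ 6 * ((n : ℝ) ^ 14)⁻¹ := by gcongr
    _ ≤ 1 / 2 := by
      rw [← div_eq_mul_inv, div_le_iff₀ (by positivity)]
      linarith

/-! ### Success of the search algorithm -/

section
variable {D : RandAlg} {n : ℕ} [NeZero n] {d : ℕ} {P : (Fin d → Bool) → Bool} {ν : FinDist Bool}
  {m W : ℕ} {ε : ℝ}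

theorem gap_zero (s : ℕ → Bool) : gap D n P ν 0 s = 0 := by
  unfold gap acc
  rw [E_iid_zero, E_iid_zero, sub_self]

theorem groupSize_mono (d : ℕ) {q q' : ℕ} (m : ℕ) (h : q ≤ q') :
    groupSize d q m ≤ groupSize d q' m := by
  unfold groupSize; gcongr

open Classical in
/-- With one vertex, the guess alone decides. -/
theorem quarter_le_E_search_one (hn : n = 1) (s : ℕ → Bool) (X N M T : ℕ) :
    1 / 4 ≤ ((secretDist n P ν s).iid M).E fun z => (coin.iid (1 + T)).E fun c =>
      if search d D X n m N z c = (List.range n).map s then (1 : ℝ) else 0 := by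
  have h1 : ∀ (z : List Sample) (b : Bool) (c : List Bool),
      search d D X n m N z (b :: c) = (List.range n).map s ↔ b = s 0 := by
    intro z b c
    subst hn
    simp [search, List.range_succ, different_zero]
  have h2 : ∀ z : List Sample, ((coin.iid (1 + T)).E fun c =>
      if search d D X n m N z c = (List.range n).map s then (1 : ℝ) else 0) = 1 / 2 := by
    intro z
    rw [E_iid_add, E_iid_one, E_coin]
    simp only [List.singleton_append, h1, E_const]
    cases s 0 <;> norm_num
  simp only [h2, E_const]
  norm_num

open Classical in
/-- Findable secrets are found with constant probability. The constant `8 W` makes the threshold a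
quarter of the gap between two consecutive hybrids. -/
theorem quarter_le_of_findable {C : ℝ} {M T : ℕ} (hn : 2 ≤ n) (hm : 1 ≤ m) (hε : 0 < ε)
    (hε1 : ε ≤ 1) (hW : 0 < W) (hC : 2 ^ 26 * (W : ℝ) ^ 2 ≤ C)
    (hM : M = ⌊C * m * (n / ε) ^ 2 * Real.log (n / ε) ^ 3⌋₊)
    (hT : (runCoins d D n m + 2 * d * groupSize d n m) * M ≤ T) {s : ℕ → Bool}
    (hs : Findable D n P ν m W ε s) :
    1 / 4 ≤ ((secretDist n P ν s).iid M).E fun z => (coin.iid (1 + T)).E fun c =>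
      if search d D (8 * W) n m ⌈1 / ε⌉₊ z c = (List.range n).map s then 1 else 0 := by
  have hW' : (1 : ℝ) ≤ W := by exact_mod_cast hW
  have hn' : (0 : ℝ) < n := by exact_mod_cast (by omega : 0 < n)
  have hN0 : 0 < ⌈1 / ε⌉₊ := Nat.ceil_pos.2 (by positivity)
  refine quarter_le_E_search D (n := n) P ν s (by omega) hN0 hm (fun q hq => ?_)
    (fun q hq hB => ?_) ?_
  · refine le_trans ?_ hT
    gcongr
    · exact groupSize_mono d m hq
    · exact Nat.div_le_self _ _
  · exact union_bound_le hn hm hε hε1 (by omega) (C := C) (by push_cast; linarith)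
      (by rw [hM]) hB
  · rcases hs with hs | ⟨k, hk1, hk2, hbal, hgap⟩
    · exact Or.inl hs
    · right
      have hh : 1 ≤ n / (2 * k) := (Nat.one_le_div_iff (by omega)).2 hk2
      unfold Unbalanced at hbal
      push Not at hbal
      obtain ⟨t, ht, hbal⟩ := hbal
      obtain ⟨i, hi, hgi⟩ := exists_hybrid_gap D (n := n) P ν m s
      refine ⟨2 * k, hk2, n / (2 * k), t, i, ?_, windowDist_E_eq_coin hh hbal, hi, ?_, ?_⟩
      · have h1 := Nat.lt_mul_div_succ n (show 0 < 2 * k by omega)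
        simp only [admissible, Bool.and_eq_true, decide_eq_true_eq]
        refine ⟨⟨hh, ht⟩, h1.le.trans ?_⟩
        calc 2 * k * (n / (2 * k) + 1) ≤ 2 * k * (n / (2 * k) + n / (2 * k)) := by gcongr
          _ = _ := by ring
      · rw [hM]
        refine one_le_groups hn hm hε hε1 hW hk1 ?_ (by nlinarith)
        have := gap_le_one (D := D) (n := n) (P := P) (ν := ν) (m := m) s
        nlinarith
      · refine le_trans ?_ hgi
        have hN : 1 ≤ ε * ⌈1 / ε⌉₊ := by
          have := Nat.le_ceil (1 / ε)
          rwa [div_le_iff₀ hε, mul_comm] at this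
        have hN0' : (0 : ℝ) < ⌈1 / ε⌉₊ := by exact_mod_cast hN0
        change _ ≤ gap D n P ν m s / n
        unfold threshold
        push_cast
        rw [show (4 * (2 * k) : ℝ) = 8 * k by ring, ← mul_div_assoc,
          div_le_div_iff₀ (by positivity) hn']
        have hp : (0 : ℝ) ≤ (8 * k) ^ d := by positivity
        have h1 : (8 * (k : ℝ)) ^ d ≤ 2 * W * gap D n P ν m s * ⌈1 / ε⌉₊ := by
          calc (8 * (k : ℝ)) ^ d ≤ (8 * k) ^ d * (ε * ⌈1 / ε⌉₊) := le_mul_of_one_le_right hp hN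
            _ = ε * (8 * k) ^ d * ⌈1 / ε⌉₊ := by ring
            _ ≤ _ := by gcongr
        nlinarith

open Classical in
/-- The search algorithm succeeds with probability proportional to the advantage. -/
theorem le_expect_search {C : ℝ} {M T : ℕ} (hε : 0 < ε) (hW : 0 < W)
    (hWsum : ∀ k : ℕ, ∑ j ∈ Finset.range k, (8 * ((j : ℝ) + 1)) ^ d * (2 * (1 / 2) ^ j) ≤ W)
    (hC : 2 ^ 26 * (W : ℝ) ^ 2 ≤ C)
    (hM : M = ⌊C * m * (n / ε) ^ 2 * Real.log (n / ε) ^ 3⌋₊)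
    (hT : (runCoins d D n m + 2 * d * groupSize d n m) * M ≤ T)
    (hadv : ε ≤ 𝔼 s : Fin n → Bool, gap D n P ν m (bitsOf s)) :
    1 / 8 * ε ≤ 𝔼 s : Fin n → Bool, ((secretDist n P ν (bitsOf s)).iid M).E fun z =>
      (coin.iid (1 + T)).E fun c => if search d D (8 * W) n m ⌈1 / ε⌉₊ z c =
        (List.range n).map (bitsOf s) then 1 else 0 := by
  have hε1 : ε ≤ 1 := hadv.trans
    (Finset.expect_le Finset.univ_nonempty fun s _ => gap_le_one (bitsOf s))
  have hm : 1 ≤ m := by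
    rcases Nat.eq_zero_or_pos m with rfl | h
    · simp only [gap_zero, Finset.expect_const_zero] at hadv
      linarith
    · exact h
  by_cases hn : 2 ≤ n
  · have h1 := half_le_expect_findable hn hε hW hWsum hadv
    calc 1 / 8 * ε ≤ 1 / 4 * 𝔼 s : Fin n → Bool,
          (if Findable D n P ν m W ε (bitsOf s) then (1 : ℝ) else 0) := by linarith
      _ ≤ _ := by
        rw [Finset.mul_expect]
        refine Finset.expect_le_expect fun s _ => ?_
        split_ifs with hs
        · rw [mul_one]
          exact quarter_le_of_findable hn hm hε hε1 hW hC hM hT hs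
        · rw [mul_zero]
          exact E_nonneg _ fun z => E_nonneg _ fun c => by split <;> norm_num
  · have hn1 : n = 1 := by have := NeZero.ne n; omega
    calc 1 / 8 * ε ≤ 1 / 4 := by linarith
      _ ≤ _ := Finset.le_expect Finset.univ_nonempty fun s _ =>
        quarter_le_E_search_one hn1 (bitsOf s) _ _ _ _

end

/-! ### The reduction -/

theorem toSamples_ofFn {n M d : ℕ} (G : Hypergraph n M d) (y : Fin M → Bool) :
    toSamples (List.ofFn fun i => List.ofFn fun k => (G i k : ℕ)) (List.ofFn y) =
      samplesOf G y := by
  unfold toSamples samplesOf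
  apply List.ext_getElem
  · simp
  · intro j h1 h2
    simp only [List.length_map, List.length_range, List.length_ofFn] at h1
    simp [h1]

theorem enc_map_bitsOf {n : ℕ} (s : Fin n → Bool) :
    enc ((List.range n).map (bitsOf s)) = Data.ofBits s := by
  rw [← enc_ofFn_bits]
  congr 1
  apply List.ext_getElem
  · simp
  · intro j h1 h2
    simp only [List.length_map, List.length_range] at h1
    simp [bitsOf, h1]

/-- A number of coins that suffices for the search algorithm. -/
def searchCoins (d : ℕ) (D : RandAlg) (x : SearchInst) : ℕ :=
  1 + (runCoins d D x.1 x.2.1 + 2 * d * groupSize d x.1 x.2.1) * x.2.2.2.1.length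

theorem PT.searchCoins (d : ℕ) (D : RandAlg) : PT (searchCoins d D) := by
  unfold RandomLocal.searchCoins runCoins groupSize instBound
  fun_prop

open Classical in
/-- The search algorithm as a randomized algorithm: its success probability in terms of random
samples and coins. -/
theorem exists_search_randAlg {d : ℕ} {D : RandAlg} (hD : D.IsPolyTimeOn (decisionInstances d))
    (X : ℕ) : ∃ A : RandAlg, A.IsPolyTimeOn (searchInstances d) ∧
      ∀ (n m N M : ℕ) [NeZero n] (P : (Fin d → Bool) → Bool) (δ : ℝ) (h0 : 0 ≤ δ) (h1 : δ ≤ 1),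
        (𝔼 s : Fin n → Bool, ((secretDist n P (bern δ h0 h1) (bitsOf s)).iid M).E fun z =>
          (coin.iid (1 + (runCoins d D n m + 2 * d * groupSize d n m) * M)).E fun c =>
            if search d D X n m N z c = (List.range n).map (bitsOf s) then (1 : ℝ) else 0) ≤
          searchSuccess P δ A n m N M := by
  obtain ⟨Q, hQ⟩ := (PT.searchCoins d D).size_le
  obtain ⟨e, he⟩ := exists_eval_le_polyBound Q
  have hf : PT fun x : SearchInst × List Bool => search d D X x.1.1 x.1.2.1 x.1.2.2.1
      (toSamples x.1.2.2.2.1 x.1.2.2.2.2) (x.2.take (searchCoins d D x.1)) := by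
    have := (PT.searchCoins d D).comp (PT.fst' (α := SearchInst) (β := List Bool))
    exact PT.search hD X (by fun_prop) (by fun_prop) (by fun_prop) (by fun_prop) (by fun_prop)
  obtain ⟨A, hAe, hA, hout⟩ := exists_randAlg hf e
  refine ⟨A, hA d, fun n m N M _ P δ h0 h1 => ?_⟩
  have hprob : ∀ (G : Hypergraph n M d) (y : Fin M → Bool) (s : Fin n → Bool),
      (coin.iid (1 + (runCoins d D n m + 2 * d * groupSize d n m) * M)).E (fun c =>
        if search d D X n m N (samplesOf G y) c = (List.range n).map (bitsOf s)
          then (1 : ℝ) else 0) ≤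
        A.outputProb (searchInput m N G y) (.ofBits s) := by
    intro G y s
    have hx := enc_searchInput m N G y
    have hy := toSamples_ofFn G y
    have hT : searchCoins d D (n, m, N, List.ofFn (fun i => List.ofFn fun k => (G i k : ℕ)),
        List.ofFn y) = 1 + (runCoins d D n m + 2 * d * groupSize d n m) * M := by
      simp only [searchCoins, List.length_ofFn]
    have hle := (hQ (n, m, N, List.ofFn (fun i => List.ofFn fun k => (G i k : ℕ)),
      List.ofFn y)).trans (he _)
    rw [sz_nat] at hle
    rw [← hT, hx, ← E_iid_take coin (show searchCoins d D (n, m, N, List.ofFn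
      (fun i => List.ofFn fun k => (G i k : ℕ)), List.ofFn y) ≤ A.numCoins (enc (n, m, N,
        List.ofFn (fun i => List.ofFn fun k => (G i k : ℕ)), List.ofFn y)) by
      rw [RandAlg.numCoins, hAe]
      change _ ≤ polyBound e (sz _)
      omega) fun c => if search d D X n m N (samplesOf G y) c = (List.range n).map (bitsOf s)
        then (1 : ℝ) else 0, coin, E_iid_unif, RandAlg.outputProb]
    refine Finset.expect_le_expect fun r _ => ?_
    by_cases hr : search d D X n m N (samplesOf G y) ((List.ofFn r).take (searchCoins d D (n, m, N,
        List.ofFn (fun i => List.ofFn fun k => (G i k : ℕ)), List.ofFn y))) =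
        (List.range n).map (bitsOf s)
    · rw [if_pos hr, if_pos]
      rw [hout, ← enc_map_bitsOf, ← hr, ← hy]
    · rw [if_neg hr]
      split <;> norm_num
  rw [searchSuccess, Finset.expect_comm]
  refine Finset.expect_le_expect fun s _ => ?_
  rw [E_iid_secretDist]
  refine Finset.expect_le_expect fun G _ => Finset.sum_le_sum fun e _ => ?_
  refine mul_le_mul_of_nonneg_left (hprob G _ s) (Finset.prod_nonneg fun i _ => ?_)
  split <;> linarith

end RandomLocal

theorem mainTheorem4 (d : ℕ) (P : (Fin d → Bool) → Bool) (K : ℕ) :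
    ∃ c : ℝ, 0 < c ∧ ∃ C : ℝ, 0 < C ∧
      ∀ D : RandomLocal.RandAlg, D.IsPolyTimeOn (RandomLocal.decisionInstances d) →
        ∃ A : RandomLocal.RandAlg, A.IsPolyTimeOn (RandomLocal.searchInstances d) ∧
          ∀ (n m : ℕ) (ε δ : ℝ), 1 ≤ n → m ≤ K * n ^ K → 0 < ε → 0 ≤ δ → δ ≤ 1 →
            ε ≤ RandomLocal.decisionAdvantage P δ D n m →
            c * ε ≤ RandomLocal.searchSuccess P δ A n m ⌈1 / ε⌉₊
              ⌊C * m * (n / ε) ^ 2 * Real.log (n / ε) ^ 3⌋₊ := by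
  obtain ⟨W, hW, hWsum⟩ := RandomLocal.exists_weight d
  have hW' : (0 : ℝ) < W := by exact_mod_cast hW
  -- `2 ^ 26 * W ^ 2 = 2 ^ 20 * X ^ 2` for the parameter `X = 8 * W` of the threshold
  refine ⟨1 / 8, by norm_num, 2 ^ 26 * (W : ℝ) ^ 2, by positivity, fun D hD => ?_⟩
  obtain ⟨A, hA, hsucc⟩ := RandomLocal.exists_search_randAlg hD (8 * W)
  refine ⟨A, hA, fun n m ε δ hn _ hε h0 h1 hadv => ?_⟩
  have : NeZero n := ⟨by omega⟩
  rw [RandomLocal.decisionAdvantage_eq P h0 h1] at hadv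
  exact (RandomLocal.le_expect_search hε hW hWsum le_rfl rfl le_rfl hadv).trans
    (hsucc n m _ _ P δ h0 h1)
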